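/- Write $\mathbb R^5=\mathbb H\oplus\mathbb R$ and let $x=(q,t)\in\mathbb R^5$ act on spinors $\psi\in\Delta=\mathbb H^2$ by Clifford multiplication $c(x)=\begin{pmatrix} t & q\\ \bar q & -t\end{pmatrix}$, so that $c(x)^2=|x|^2$. Let $S^4\subset\mathbb R^5$ be the unit sphere with its round metric $g$ and volume form $\mathsf{vol}_{S^4}$, oriented by the outer normal. The bundle of negative chirality spinors over $S^4$ is $$M^8=\{(x,\psi)\in S^4\times\Delta : c(x)\psi=-\psi\},$$ with projection $u\colon M\to S^4$, $u(x,\psi)=x$. Its spin connection is the orthogonal projection, by $\tfrac12(1-c(x))$, of the flat connection of $S^4\times\Delta$; the corresponding vertical part of a tangent vector $(\dot x,\dot\psi)$ at $(x,\psi)$ is $\tfrac12(1-c(x))\dot\psi$. Let $g_{\mathcal V}$ be the fibre metric evaluated on vertical parts, let $\mathsf{vol}_{\mathcal V}$ be the volume form of the fibres (as hermitian planes, with complex structure $\psi\mapsto\psi i$ and the complex orientation) evaluated on vertical parts, and let $\beta$ be the $(2,2)$-form with $\beta(X,Y,\eta,\xi)=\tfrac12\langle \eta,[c(X),c(Y)]\xi\rangle$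 for $X,Y$ horizontal and $\eta,\xi$ vertical. For constants $c_0,c_1>0$ and $r=|\psi|$ put $$w^2=5(c_0+c_1r^2)^{3/5},\qquad v^2=4c_1(c_0+c_1r^2)^{-2/5},\qquad w,v>0,$$ $$h=w^2\,u^*g+v^2g_{\mathcal V},\qquad \Phi=w^4\,u^*\mathsf{vol}_{S^4}+w^2v^2\,\beta+v^4\,\mathsf{vol}_{\mathcal V},$$ and orient $M$ by $\mathsf{vol}_M=v^4\mathsf{vol}_{\mathcal V}\wedge w^4u^*\mathsf{vol}_{S^4}$ (the Bryant--Salamon metric and form). Then: 1. $\Phi$ is a smooth $\mathrm{Spin}(7)$-structure on $M$ inducing the metric $h$ and the given orientation (every tangent space has an oriented $h$-orthonormal basis in which $\Phi$ is the standard Cayley form of $\mathbb R^8$), and $d\Phi=0$, that is, the structure is torsion-free. 2. $u\colon(M,h)\to(S^4,g)$ is a Smith submersion with respect to $\Phi$: $h$ and $g$ are Riemannian metrics, with volume forms $\mathsf{vol}_M$ and $\mathsf{vol}_{S^4}$; $\Phi$ is a calibration (a smooth form with $|\Phi(e_1,\dots,e_4)|\le1$ for all orthonormal $e_1,\dots,e_4$);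 $u$ is a smooth surjection; and with $h^{(0,2)}$ the restriction of $h$ to $(\ker du)^\perp$, $$\Phi\wedge u^*\mathsf{vol}_{S^4}=\Big(\tfrac{|du|}{\sqrt4}\Big)^4\mathsf{vol}_M,\qquad u^*g=\Big(\tfrac{|du|}{\sqrt4}\Big)^2h^{(0,2)}.$$ 3. $u$ is a horizontally conformal submersion, $u^*g=\lambda^2h^{(0,2)}$ with $du_x$ surjective for all $x\in M$, and its dilation is the smooth positive function $\lambda=\tfrac{|du|}{\sqrt4}=\tfrac1w$. 4. $u$ is $4$-harmonic: $\operatorname{div}(|du|^2du)=0$. 5. The fibres of $u$ are Cayley submanifolds: $\Phi(e_1,\dots,e_4)=1$ for every oriented orthonormal basis $e_1,\dots,e_4$ of $\ker du_x$, $x\in M$, where $(\ker du)^\perp$ is oriented by $u^*\mathsf{vol}_{S^4}$ and $\ker du$ such that $\mathsf{vol}_{\ker du}\wedge\mathsf{vol}_{(\ker du)^\perp}=\mathsf{vol}_M$. -/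

import Mathlib

noncomputable section

open scoped Manifold ContDiff Quaternion RealInnerProductSpace
open Metric

namespace Smith

/-! ### Tensors, forms and metrics on a manifold, read in the charts of the manifold -/

/-- Fields of bilinear forms on the tangent spaces of a manifold modelled on `E`. -/
abbrev BilinField (E : Type*) [NormedAddCommGroup E] [NormedSpace ℝ E]
    (M : Type*) [TopologicalSpace M] [ChartedSpace E M] : Type _ :=
  ∀ x : M, TangentSpace 𝓘(ℝ, E) x →ₗ[ℝ] TangentSpace 𝓘(ℝ, E) x →ₗ[ℝ] ℝ

/-- Differential `k`-forms (not necessarily smooth) on a manifold modelled on `E`. -/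
abbrev FormField (E : Type*) [NormedAddCommGroup E] [NormedSpace ℝ E]
    (M : Type*) [TopologicalSpace M] [ChartedSpace E M] (k : ℕ) : Type _ :=
  ∀ x : M, TangentSpace 𝓘(ℝ, E) x [⋀^Fin k]→ₗ[ℝ] ℝ

/-- The wedge product of two alternating forms (sum over shuffles). -/
def wedge {V : Type*} [AddCommGroup V] [Module ℝ V] {k l : ℕ}
    (α : V [⋀^Fin k]→ₗ[ℝ] ℝ) (β : V [⋀^Fin l]→ₗ[ℝ] ℝ) : V [⋀^Fin (k + l)]→ₗ[ℝ] ℝ :=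
  ((LinearMap.mul' ℝ ℝ).compAlternatingMap (α.domCoprod β)).domDomCongr finSumFinEquiv

/-- The contraction `∑ᵢⱼ hⁱʲ B(bᵢ, bⱼ)` of a bilinear `B` with the inverse of the inner product `h`;
it does not depend on the basis `b`. -/
def metricTrace {V W : Type*} [AddCommGroup V] [Module ℝ V] [Module.Finite ℝ V]
    [AddCommGroup W] [Module ℝ W] (h : V → V → ℝ) (B : V → V → W) : W :=
  ∑ i, ∑ j, ((Matrix.of fun i j => h (Module.finBasis ℝ V i) (Module.finBasis ℝ V j))⁻¹ i j) •
    B (Module.finBasis ℝ V i) (Module.finBasis ℝ V j)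

/-- The vector `Γ_y(v, w)` built from the Christoffel symbols of the metric `G` on an open subset of
a vector space: `G(Γ(v, w), z) = ½ (∂_v G(w, z) + ∂_w G(v, z) - ∂_z G(v, w))`. -/
def christoffel {E : Type*} [NormedAddCommGroup E] [NormedSpace ℝ E] [FiniteDimensional ℝ E]
    (G : E → E → E → ℝ) (y v w : E) : E :=
  metricTrace (G y) fun z z' =>
    ((1 / 2 : ℝ) * (fderiv ℝ (fun t => G t w z) y v + fderiv ℝ (fun t => G t v z) y w
      - fderiv ℝ (fun t => G t v w) y z)) • z'

section Manifold

variable {E : Type*} [NormedAddCommGroup E] [NormedSpace ℝ E]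
  {M : Type*} [TopologicalSpace M] [ChartedSpace E M]

/-- The coefficients of the field `h` in the preferred chart at `x`. -/
def coordBilin (h : BilinField E M) (x : M) (y v w : E) : ℝ :=
  h ((extChartAt 𝓘(ℝ, E) x).symm y)
    (mfderiv 𝓘(ℝ, E) 𝓘(ℝ, E) (extChartAt 𝓘(ℝ, E) x).symm y v)
    (mfderiv 𝓘(ℝ, E) 𝓘(ℝ, E) (extChartAt 𝓘(ℝ, E) x).symm y w)

/-- The coefficients of the form `α` in the preferred chart at `x`. -/
def coordForm {k : ℕ} (α : FormField E M k) (x : M) (y : E) (v : Fin k → E) : ℝ :=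
  α ((extChartAt 𝓘(ℝ, E) x).symm y)
    fun i => mfderiv 𝓘(ℝ, E) 𝓘(ℝ, E) (extChartAt 𝓘(ℝ, E) x).symm y (v i)

structure IsRiemannianMetric (h : BilinField E M) : Prop where
  symm : ∀ x v w, h x v w = h x w v
  pos : ∀ x v, v ≠ 0 → 0 < h x v v
  smooth : ∀ (x : M) (v w : E),
    ContDiffOn ℝ ∞ (fun y => coordBilin h x y v w) (extChartAt 𝓘(ℝ, E) x).target

def IsSmoothForm {k : ℕ} (α : FormField E M k) : Prop :=
  ∀ (x : M) (v : Fin k → E),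
    ContDiffOn ℝ ∞ (fun y => coordForm α x y v) (extChartAt 𝓘(ℝ, E) x).target

/-- `dα = 0`, where in a chart
`dα(v₀, …, v_k) = ∑ᵢ (-1)ⁱ ∂_{vᵢ} (α(v₀, …, v̂ᵢ, …, v_k))` for constant vectors `vᵢ`. -/
def IsClosedForm {k : ℕ} (α : FormField E M k) : Prop :=
  ∀ (x : M) (v : Fin (k + 1) → E),
    ∑ i : Fin (k + 1), (-1 : ℝ) ^ (i : ℕ) *
      fderiv ℝ (fun y => coordForm α x y fun j => v (i.succAbove j))
        (extChartAt 𝓘(ℝ, E) x x) (v i) = 0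

def IsOrthonormalFamily (h : BilinField E M) (x : M) {m : ℕ}
    (e : Fin m → TangentSpace 𝓘(ℝ, E) x) : Prop :=
  ∀ i j, h x (e i) (e j) = if i = j then 1 else 0

/-- `μ` is one of the (two, on a connected manifold) Riemannian volume forms of `(M, h)`.
An oriented Riemannian manifold is given by `(M, h)` together with such a `μ`. -/
structure IsVolumeForm {n : ℕ} (h : BilinField E M) (μ : FormField E M n) : Prop where
  dim : Module.finrank ℝ E = n
  smooth : IsSmoothForm μ
  unit : ∀ (x : M) (e : Fin n → TangentSpace 𝓘(ℝ, E) x), IsOrthonormalFamily h x e → |μ x e| = 1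

/-- A calibration is a smooth form of comass at most one, closed or not. -/
structure IsCalibration {k : ℕ} (h : BilinField E M) (α : FormField E M k) : Prop where
  smooth : IsSmoothForm α
  comass : ∀ (x : M) (e : Fin k → TangentSpace 𝓘(ℝ, E) x), IsOrthonormalFamily h x e →
    |α x e| ≤ 1

end Manifold

/-! ### Smooth maps between Riemannian manifolds -/

section Maps

variable {E : Type*} [NormedAddCommGroup E] [NormedSpace ℝ E] [FiniteDimensional ℝ E]
  {M : Type*} [TopologicalSpace M] [ChartedSpace E M]
  {F : Type*} [NormedAddCommGroup F] [NormedSpace ℝ F] [FiniteDimensional ℝ F]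
  {L : Type*} [TopologicalSpace L] [ChartedSpace F L]

/-- The pullback `u^* β` of a form. -/
def pullbackForm {k : ℕ} (u : M → L) (β : FormField F L k) : FormField E M k := fun x =>
  (β (u x)).compLinearMap (mfderiv 𝓘(ℝ, E) 𝓘(ℝ, F) u x).toLinearMap

/-- The pullback `u^* g` of a field of bilinear forms. -/
def pullbackBilin (u : M → L) (g : BilinField F L) : BilinField E M := fun x =>
  (g (u x)).compl₁₂ (mfderiv 𝓘(ℝ, E) 𝓘(ℝ, F) u x).toLinearMap
    (mfderiv 𝓘(ℝ, E) 𝓘(ℝ, F) u x).toLinearMap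

/-- `|du| = (tr_h (u^* g))^{1/2}`. -/
def duNorm (h : BilinField E M) (g : BilinField F L) (u : M → L) (x : M) : ℝ :=
  √(metricTrace (V := E) (fun v w => h x v w) fun v w => pullbackBilin (E := E) u g x v w)

/-- The `p`-tension `τ_p(u) = div(|du|^{p-2} du)` at `x`, read in the preferred charts at `x` and
at `u x`. With `A = |du|^{p-2} du` and the Levi-Civita connections of `h` and `g`,
`(∇_v A)(w) = ∂_v A(w) + Γ^g(du v, A w) - A(Γ^h(v, w))`, and the divergence is the trace of this. -/
def pTension (p : ℝ) (h : BilinField E M) (g : BilinField F L) (u : M → L) (x : M) : F :=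
  let φ := extChartAt 𝓘(ℝ, E) x
  let U : E → F := writtenInExtChartAt 𝓘(ℝ, E) 𝓘(ℝ, F) x u
  let A : E → E →L[ℝ] F := fun y => (duNorm h g u (φ.symm y)) ^ (p - 2) • fderiv ℝ U y
  metricTrace (coordBilin h x (φ x)) fun v w =>
    fderiv ℝ A (φ x) v w
      + christoffel (coordBilin g (u x)) (U (φ x)) (fderiv ℝ U (φ x) v) (A (φ x) w)
      - A (φ x) (christoffel (coordBilin h x) (φ x) v w)

/-- `u` is `p`-harmonic: `div(|du|^{p-2} du) = 0`. -/
def IsPHarmonic (p : ℝ) (h : BilinField E M) (g : BilinField F L) (u : M → L) : Prop :=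
  ContMDiff 𝓘(ℝ, E) 𝓘(ℝ, F) ∞ u ∧ ∀ x, pTension p h g u x = 0

def IsVertical (F : Type*) [NormedAddCommGroup F] [NormedSpace ℝ F]
    {L : Type*} [TopologicalSpace L] [ChartedSpace F L] (u : M → L) (x : M)
    (v : TangentSpace 𝓘(ℝ, E) x) : Prop :=
  mfderiv 𝓘(ℝ, E) 𝓘(ℝ, F) u x v = 0

/-- `v ∈ (ker du_x)^⊥`. -/
def IsHorizontal (F : Type*) [NormedAddCommGroup F] [NormedSpace ℝ F]
    {L : Type*} [TopologicalSpace L] [ChartedSpace F L] (h : BilinField E M) (u : M → L) (x : M)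
    (v : TangentSpace 𝓘(ℝ, E) x) : Prop :=
  ∀ k : TangentSpace 𝓘(ℝ, E) x, IsVertical F u x k → h x v k = 0

/-- `u^* g = c² h^{(0,2)}` at `x`. Both sides vanish when one of the arguments is vertical, so that
this is an equality of bilinear forms on the horizontal space. -/
def ConformalOnHorizontal (h : BilinField E M) (g : BilinField F L) (u : M → L) (x : M)
    (c : ℝ) : Prop :=
  ∀ v w : TangentSpace 𝓘(ℝ, E) x, IsHorizontal F h u x v → IsHorizontal F h u x w →
    pullbackBilin u g x v w = c ^ 2 * h x v w

/-- `u : (M, h) → (L, g)` is a horizontally conformal submersion with dilation `lam`. -/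
structure IsHorizontallyConformalSubmersion (h : BilinField E M) (g : BilinField F L) (u : M → L)
    (lam : M → ℝ) : Prop where
  smooth : ContMDiff 𝓘(ℝ, E) 𝓘(ℝ, F) ∞ u
  surjective : Function.Surjective u
  submersion : ∀ x, Function.Surjective (mfderiv 𝓘(ℝ, E) 𝓘(ℝ, F) u x)
  smooth_dilation : ContMDiff 𝓘(ℝ, E) 𝓘(ℝ, ℝ) ∞ lam
  dilation_pos : ∀ x, 0 < lam x
  conformal : ∀ x, ConformalOnHorizontal h g u x (lam x)

/-- `u : (M, h, μ) → (L, g, ν)` is a Smith submersion with respect to the calibration `α`, where the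
volume forms `μ` and `ν` record the orientations: `α ∧ u^* ν = (|du| / √k)^k μ` and
`u^* g = (|du| / √k)² h^{(0,2)}`, where `k` is the dimension of `L`. -/
structure IsSmithSubmersion {m k : ℕ} (h : BilinField E M) (μ : FormField E M (m + k))
    (g : BilinField F L) (ν : FormField F L k) (α : FormField E M m) (u : M → L) : Prop where
  metric_dom : IsRiemannianMetric h
  vol_dom : IsVolumeForm h μ
  metric_cod : IsRiemannianMetric g
  vol_cod : IsVolumeForm g ν
  calibration : IsCalibration h α
  smooth : ContMDiff 𝓘(ℝ, E) 𝓘(ℝ, F) ∞ u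
  surjective : Function.Surjective u
  smith : ∀ x, wedge (α x) (pullbackForm u ν x) = (duNorm h g u x / √k) ^ k • μ x
  conformal : ∀ x, ConformalOnHorizontal h g u x (duNorm h g u x / √k)

/-- The fibres of the submersion `u` are calibrated by `α`: on each tangent space `ker du_x` of a
fibre, `α` is the volume form. Here `(ker du_x)^⊥` is oriented by `u^* ν`, and `ker du_x` is oriented
such that `vol_{ker du} ∧ vol_{(ker du)^⊥} = μ`. -/
def HasCalibratedFibres {m k : ℕ} (h : BilinField E M) (μ : FormField E M (m + k))
    (ν : FormField F L k) (α : FormField E M m) (u : M → L) : Prop :=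
  (∀ x, Function.Surjective (mfderiv 𝓘(ℝ, E) 𝓘(ℝ, F) u x)) ∧
  ∀ (x : M) (e : Fin m → TangentSpace 𝓘(ℝ, E) x) (f : Fin k → TangentSpace 𝓘(ℝ, E) x),
    IsOrthonormalFamily h x e → (∀ i, IsVertical F u x (e i)) →
    IsOrthonormalFamily h x f → (∀ i, IsHorizontal F h u x (f i)) →
    0 < pullbackForm u ν x f → 0 < μ x (Fin.append e f) → α x e = 1

end Maps

/-! ### `Spin(7)`-structures -/

/-- `dx^{abcd}` on `ℝ⁸`. -/
def dx4 (a b c d : Fin 8) (v : Fin 4 → Fin 8 → ℝ) : ℝ :=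
  Matrix.det (Matrix.of fun i j => v i (![a, b, c, d] j))

/-- The standard Cayley form on `ℝ⁸ = ℝ ⊕ ℝ⁷`: it is `dx⁰ ∧ φ₀ + ψ₀` with
`φ₀ = dx¹²³ - dx¹⁶⁷ - dx⁵²⁷ - dx⁵⁶³ - dx⁴¹⁵ - dx⁴²⁶ - dx⁴³⁷` the standard associative form and
`ψ₀ = ⋆φ₀`. -/
def cayleyForm (v : Fin 4 → Fin 8 → ℝ) : ℝ :=
  dx4 0 1 2 3 v - dx4 0 1 6 7 v - dx4 0 5 2 7 v - dx4 0 5 6 3 v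
    - dx4 0 4 1 5 v - dx4 0 4 2 6 v - dx4 0 4 3 7 v
    + dx4 4 5 6 7 v - dx4 4 5 2 3 v - dx4 4 1 6 3 v - dx4 4 1 2 7 v
    - dx4 2 6 3 7 v - dx4 1 5 3 7 v - dx4 1 5 2 6 v

/-- `Φ` is a `Spin(7)`-structure that induces the metric `h` and the orientation of `μ`: each
tangent space has a basis in which `Φ`, `h`, `μ` are the standard Cayley form, inner product and
volume form of `ℝ⁸`. -/
structure IsSpin7Structure {E : Type*} [NormedAddCommGroup E] [NormedSpace ℝ E]
    {M : Type*} [TopologicalSpace M] [ChartedSpace E M]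
    (h : BilinField E M) (μ : FormField E M 8) (Φ : FormField E M 4) : Prop where
  smooth : IsSmoothForm Φ
  frame : ∀ x : M, ∃ e : Module.Basis (Fin 8) ℝ (TangentSpace 𝓘(ℝ, E) x),
    IsOrthonormalFamily h x e ∧ μ x e = 1 ∧
      ∀ v : Fin 4 → TangentSpace 𝓘(ℝ, E) x, Φ x v = cayleyForm fun i j => e.repr (v i) j

/-! ### The round four-sphere -/

/-- The unit sphere in `ℝ⁵`. -/
abbrev S4 : Type := sphere (0 : EuclideanSpace ℝ (Fin 5)) 1

/-- The differential of the inclusion `S⁴ → ℝ⁵`. -/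
def dS4 (x : S4) : TangentSpace (𝓡 4) x →ₗ[ℝ] EuclideanSpace ℝ (Fin 5) :=
  (mvfderiv (𝓡 4) ((↑) : S4 → EuclideanSpace ℝ (Fin 5)) x).toLinearMap

/-- The round metric on `S⁴`. -/
def roundMetric : BilinField (EuclideanSpace ℝ (Fin 4)) S4 := fun x =>
  (innerₗ (EuclideanSpace ℝ (Fin 5))).compl₁₂ (dS4 x) (dS4 x)

/-- The volume form of `S⁴`, oriented by the outer normal: `vol_x(v₁, …, v₄) = det(x, v₁, …, v₄)`. -/
def sphereVol : FormField (EuclideanSpace ℝ (Fin 4)) S4 4 := fun x =>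
  ((EuclideanSpace.basisFun (Fin 5) ℝ).toBasis.det.curryLeft
    (x : EuclideanSpace ℝ (Fin 5))).compLinearMap (dS4 x)

/-! ### Spinors -/

/-- The spinor space of `ℝ⁵`, as a quaternionic plane. -/
abbrev Spinor : Type := WithLp 2 (ℍ[ℝ] × ℍ[ℝ])

/-- The first four coordinates of a vector of `ℝ⁵`, as a quaternion. -/
def quat (x : EuclideanSpace ℝ (Fin 5)) : ℍ[ℝ] := ⟨x 0, x 1, x 2, x 3⟩

@[simp] theorem quat_re (x : EuclideanSpace ℝ (Fin 5)) : (quat x).re = x 0 := rfl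
@[simp] theorem quat_imI (x : EuclideanSpace ℝ (Fin 5)) : (quat x).imI = x 1 := rfl
@[simp] theorem quat_imJ (x : EuclideanSpace ℝ (Fin 5)) : (quat x).imJ = x 2 := rfl
@[simp] theorem quat_imK (x : EuclideanSpace ℝ (Fin 5)) : (quat x).imK = x 3 := rfl

theorem Spinor.ext {ψ χ : Spinor} (h₁ : ψ.fst = χ.fst) (h₂ : ψ.snd = χ.snd) : ψ = χ :=
  WithLp.ofLp_injective 2 (Prod.ext h₁ h₂)

/-- Clifford multiplication by `x ∈ ℝ⁵` on spinors: the matrix `[[t, q], [q̄, -t]]` for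
`x = (q, t) ∈ ℍ ⊕ ℝ`. One has `c(x)² = |x|²`, see `cliff_cliff`. -/
def cliff (x : EuclideanSpace ℝ (Fin 5)) : Spinor →ₗ[ℝ] Spinor where
  toFun ψ := WithLp.toLp 2 (x 4 • ψ.fst + quat x * ψ.snd, star (quat x) * ψ.fst - x 4 • ψ.snd)
  map_add' ψ χ := by
    apply Spinor.ext <;> simp [mul_add] <;> abel
  map_smul' r ψ := by
    apply Spinor.ext <;> simp [smul_add, smul_sub, smul_comm r]

theorem cliff_fst (x : EuclideanSpace ℝ (Fin 5)) (ψ : Spinor) :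
    (cliff x ψ).fst = x 4 • ψ.fst + quat x * ψ.snd := rfl

theorem cliff_snd (x : EuclideanSpace ℝ (Fin 5)) (ψ : Spinor) :
    (cliff x ψ).snd = star (quat x) * ψ.fst - x 4 • ψ.snd := rfl

theorem norm_sq_eq (x : EuclideanSpace ℝ (Fin 5)) :
    ‖x‖ ^ 2 = ‖quat x‖ ^ 2 + x 4 ^ 2 := by
  rw [sq ‖quat x‖, ← Quaternion.normSq_eq_norm_mul_self, Quaternion.normSq_def']
  simp [EuclideanSpace.norm_sq_eq, Fin.sum_univ_five, quat]

theorem mul_star_mul (q a : ℍ[ℝ]) : q * (star q * a) = ‖q‖ ^ 2 • a := by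
  rw [← mul_assoc, Quaternion.self_mul_star, Quaternion.coe_mul_eq_smul,
    Quaternion.normSq_eq_norm_mul_self, sq]

theorem star_mul_mul (q a : ℍ[ℝ]) : star q * (q * a) = ‖q‖ ^ 2 • a := by
  rw [← mul_assoc, Quaternion.star_mul_self, Quaternion.coe_mul_eq_smul,
    Quaternion.normSq_eq_norm_mul_self, sq]

theorem cliff_cliff (x : EuclideanSpace ℝ (Fin 5)) (ψ : Spinor) :
    cliff x (cliff x ψ) = ‖x‖ ^ 2 • ψ := by
  rw [norm_sq_eq]
  apply Spinor.ext
  · rw [cliff_fst, cliff_fst, cliff_snd, mul_sub, mul_star_mul, mul_smul_comm, WithLp.smul_fst]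
    module
  · rw [cliff_snd, cliff_fst, cliff_snd, mul_add, star_mul_mul, mul_smul_comm, WithLp.smul_snd]
    module

/-! ### The total space of the negative spinor bundle of `S⁴`

For an oriented orthonormal basis `e₁, …, e₄` of `T_x S⁴` one has `-c(e₁)c(e₂)c(e₃)c(e₄) = c(x)` on
spinors, so the spinors of negative chirality at `x` are those with `c(x) ψ = -ψ`. -/

/-- Pairs `(x, ψ)` with `x ∈ S⁴` and `ψ` a spinor of negative chirality at `x`. -/
def NegSpinorBundle : Type :=
  {p : S4 × Spinor // cliff (p.1 : EuclideanSpace ℝ (Fin 5)) p.2 = -p.2}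

namespace NegSpinorBundle

instance : TopologicalSpace NegSpinorBundle := inferInstanceAs (TopologicalSpace {_p // _})
instance : T2Space NegSpinorBundle := inferInstanceAs (T2Space {_p // _})
instance : SecondCountableTopology NegSpinorBundle :=
  inferInstanceAs (SecondCountableTopology {_p // _})

/-- The bundle projection. -/
def proj (p : NegSpinorBundle) : S4 := p.1.1

/-- The spinor component of a point of the bundle. -/
def spinor (p : NegSpinorBundle) : Spinor := p.1.2

/-- Inverse stereographic projection `ℍ → S⁴` from the pole `(0, -1)`. -/
def stereoInv (q : ℍ[ℝ]) : EuclideanSpace ℝ (Fin 5) :=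
  (1 + ‖q‖ ^ 2)⁻¹ • !₂[2 * q.re, 2 * q.imI, 2 * q.imJ, 2 * q.imK, 1 - ‖q‖ ^ 2]

theorem one_add_norm_pos (q : ℍ[ℝ]) : 0 < 1 + ‖q‖ ^ 2 := by positivity

theorem quat_stereoInv (q : ℍ[ℝ]) : quat (stereoInv q) = (2 * (1 + ‖q‖ ^ 2)⁻¹) • q := by
  ext <;> simp [quat, stereoInv] <;> ring

theorem stereoInv_four (q : ℍ[ℝ]) : stereoInv q 4 = (1 - ‖q‖ ^ 2) * (1 + ‖q‖ ^ 2)⁻¹ := by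
  simp [stereoInv]; ring

theorem stereoInv_mem (q : ℍ[ℝ]) : stereoInv q ∈ sphere (0 : EuclideanSpace ℝ (Fin 5)) 1 := by
  have h := one_add_norm_pos q
  rw [mem_sphere_zero_iff_norm, ← sq_eq_sq₀ (norm_nonneg _) zero_le_one, norm_sq_eq,
    quat_stereoInv, stereoInv_four, norm_smul, Real.norm_of_nonneg (by positivity)]
  field_simp
  ring

/-- The inverse of the first chart: over the point with stereographic coordinate `q`, the negative
spinors are the `(-q a, a)` with `a ∈ ℍ`. -/
def chartInv (z : ℍ[ℝ] × ℍ[ℝ]) : NegSpinorBundle :=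
  ⟨(⟨stereoInv z.1, stereoInv_mem z.1⟩, WithLp.toLp 2 (-(z.1 * z.2), z.2)), by
    have h := one_add_norm_pos z.1
    apply Spinor.ext
    · change stereoInv z.1 4 • (-(z.1 * z.2)) + quat (stereoInv z.1) * z.2 = -(-(z.1 * z.2))
      rw [stereoInv_four, quat_stereoInv, smul_mul_assoc]
      match_scalars
      field_simp
      ring
    · change star (quat (stereoInv z.1)) * (-(z.1 * z.2)) - stereoInv z.1 4 • z.2 = -z.2
      rw [stereoInv_four, quat_stereoInv, Quaternion.star_smul, smul_mul_assoc, mul_neg,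
        star_mul_mul]
      match_scalars
      field_simp
      ring⟩

/-- The first chart, on its domain `x ≠ (0, -1)`. -/
def chartFun (p : NegSpinorBundle) : ℍ[ℝ] × ℍ[ℝ] :=
  ((1 + (proj p : EuclideanSpace ℝ (Fin 5)) 4)⁻¹ • quat (proj p : EuclideanSpace ℝ (Fin 5)),
    (spinor p).snd)

theorem continuous_quat : Continuous quat := by
  have : quat = fun x => Quaternion.linearIsometryEquivTuple.symm
      !₂[x 0, x 1, x 2, x 3] := by
    funext x
    ext <;> simp [quat]
  rw [this]
  fun_prop

theorem chartFun_chartInv (z : ℍ[ℝ] × ℍ[ℝ]) : chartFun (chartInv z) = z := by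
  have h := one_add_norm_pos z.1
  have h4 : 1 + (1 - ‖z.1‖ ^ 2) * (1 + ‖z.1‖ ^ 2)⁻¹ = 2 * (1 + ‖z.1‖ ^ 2)⁻¹ := by
    field_simp; ring
  refine Prod.ext ?_ rfl
  change (1 + stereoInv z.1 4)⁻¹ • quat (stereoInv z.1) = z.1
  rw [stereoInv_four, quat_stereoInv, h4, smul_smul, inv_mul_cancel₀ (by positivity), one_smul]

theorem norm_quat_sq (x : S4) :
    ‖quat (x : EuclideanSpace ℝ (Fin 5))‖ ^ 2 = 1 - (x : EuclideanSpace ℝ (Fin 5)) 4 ^ 2 := by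
  have h := norm_sq_eq (x : EuclideanSpace ℝ (Fin 5))
  rw [norm_eq_of_mem_sphere x] at h
  linarith

theorem stereoInv_quat (x : S4) (hx : (x : EuclideanSpace ℝ (Fin 5)) 4 ≠ -1) :
    stereoInv ((1 + (x : EuclideanSpace ℝ (Fin 5)) 4)⁻¹ • quat (x : EuclideanSpace ℝ (Fin 5))) =
      x := by
  have h := norm_quat_sq x
  have hx' : 1 + (x : EuclideanSpace ℝ (Fin 5)) 4 ≠ 0 := fun h => hx (by linarith)
  set t := (x : EuclideanSpace ℝ (Fin 5)) 4 with ht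
  have hn : ‖(1 + t)⁻¹ • quat (x : EuclideanSpace ℝ (Fin 5))‖ ^ 2 = (1 - t) * (1 + t)⁻¹ := by
    rw [norm_smul, mul_pow, h, Real.norm_eq_abs, sq_abs]
    field_simp
    ring
  have h2 : (1 + (1 - t) * (1 + t)⁻¹)⁻¹ = (1 + t) / 2 := by
    field_simp
    ring
  ext i
  rw [stereoInv, hn, h2]
  fin_cases i <;> simp
  · field_simp
  · field_simp
  · field_simp
  · field_simp
  · rw [← ht]
    field_simp
    ring

theorem chartInv_chartFun (p : NegSpinorBundle)
    (hp : (proj p : EuclideanSpace ℝ (Fin 5)) 4 ≠ -1) : chartInv (chartFun p) = p := by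
  have hp' : 1 + (proj p : EuclideanSpace ℝ (Fin 5)) 4 ≠ 0 := fun h => hp (by linarith)
  refine Subtype.ext (Prod.ext (Subtype.ext (stereoInv_quat (proj p) hp)) (Spinor.ext ?_ rfl))
  have h : (proj p : EuclideanSpace ℝ (Fin 5)) 4 • (spinor p).fst +
      quat (proj p : EuclideanSpace ℝ (Fin 5)) * (spinor p).snd = -(spinor p).fst :=
    congrArg WithLp.fst p.2
  change -(((1 + (proj p : EuclideanSpace ℝ (Fin 5)) 4)⁻¹ •
    quat (proj p : EuclideanSpace ℝ (Fin 5))) * (spinor p).snd) = (spinor p).fst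
  rw [smul_mul_assoc, neg_eq_iff_eq_neg, inv_smul_eq_iff₀ hp', add_smul, one_smul, smul_neg,
    eq_sub_of_add_eq' h]
  abel

theorem continuous_proj : Continuous proj := continuous_fst.comp continuous_subtype_val

theorem continuous_spinor : Continuous spinor := continuous_snd.comp continuous_subtype_val

theorem continuous_height :
    Continuous fun p : NegSpinorBundle => (proj p : EuclideanSpace ℝ (Fin 5)) 4 :=
  (PiLp.continuous_apply 2 _ 4).comp (continuous_subtype_val.comp continuous_proj)

theorem continuous_stereoInv : Continuous stereoInv := by
  unfold stereoInv
  refine Continuous.smul (Continuous.inv₀ (by fun_prop) fun q => (one_add_norm_pos q).ne') ?_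
  refine (PiLp.continuous_toLp 2 _).comp (continuous_pi fun i => ?_)
  have h0 := Quaternion.continuous_re
  have h1 := Quaternion.continuous_imI
  have h2 := Quaternion.continuous_imJ
  have h3 := Quaternion.continuous_imK
  fin_cases i <;> simp <;> fun_prop

theorem continuous_chartInv : Continuous chartInv := by
  refine Continuous.subtype_mk (Continuous.prodMk (Continuous.subtype_mk ?_ _) ?_) _
  · exact continuous_stereoInv.comp continuous_fst
  · exact (WithLp.prod_continuous_toLp 2 _ _).comp (by fun_prop)

/-- The chart of the bundle over `S⁴ ∖ {(0, -1)}`. -/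
def chart₁ : OpenPartialHomeomorph NegSpinorBundle (ℍ[ℝ] × ℍ[ℝ]) where
  toFun := chartFun
  invFun := chartInv
  source := {p | (proj p : EuclideanSpace ℝ (Fin 5)) 4 ≠ -1}
  target := Set.univ
  map_source' _ _ := Set.mem_univ _
  map_target' z _ := by
    have h := one_add_norm_pos z.1
    change stereoInv z.1 4 ≠ -1
    rw [stereoInv_four]
    intro h'
    field_simp at h'
    linarith
  left_inv' p hp := chartInv_chartFun p hp
  right_inv' z _ := chartFun_chartInv z
  open_source := isOpen_ne_fun continuous_height continuous_const
  open_target := isOpen_univ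
  continuousOn_toFun := by
    refine ContinuousOn.prodMk (ContinuousOn.fun_smul (ContinuousOn.fun_inv₀ ?_ ?_) ?_) ?_
    · exact (continuous_const.add continuous_height).continuousOn
    · exact fun p hp h => hp (by linarith)
    · exact (continuous_quat.comp (continuous_subtype_val.comp continuous_proj)).continuousOn
    · exact (continuous_snd.comp ((WithLp.prod_continuous_ofLp 2 _ _).comp
        continuous_spinor)).continuousOn
  continuousOn_invFun := continuous_chartInv.continuousOn

/-- The rotation `(q, t) ↦ (q̄, -t)` of `ℝ⁵`. -/
def flipVec (x : EuclideanSpace ℝ (Fin 5)) : EuclideanSpace ℝ (Fin 5) :=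
  !₂[x 0, -x 1, -x 2, -x 3, -x 4]

theorem quat_flipVec (x : EuclideanSpace ℝ (Fin 5)) : quat (flipVec x) = star (quat x) := by
  ext <;> simp [flipVec]

theorem flipVec_mem {x : EuclideanSpace ℝ (Fin 5)}
    (hx : x ∈ sphere (0 : EuclideanSpace ℝ (Fin 5)) 1) :
    flipVec x ∈ sphere (0 : EuclideanSpace ℝ (Fin 5)) 1 := by
  rw [mem_sphere_zero_iff_norm, ← sq_eq_sq₀ (norm_nonneg _) zero_le_one] at hx ⊢
  rw [← hx, norm_sq_eq, norm_sq_eq, quat_flipVec, norm_star]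
  simp [flipVec]

/-- The lift `(q, t, ψ₁, ψ₂) ↦ (q̄, -t, ψ₂, ψ₁)` of this rotation to the bundle. -/
def flip (p : NegSpinorBundle) : NegSpinorBundle :=
  ⟨(⟨flipVec (proj p), flipVec_mem (proj p).2⟩,
      WithLp.toLp 2 ((spinor p).snd, (spinor p).fst)), by
    have h1 : (proj p : EuclideanSpace ℝ (Fin 5)) 4 • (spinor p).fst +
        quat (proj p : EuclideanSpace ℝ (Fin 5)) * (spinor p).snd = -(spinor p).fst :=
      congrArg WithLp.fst p.2
    have h2 : star (quat (proj p : EuclideanSpace ℝ (Fin 5))) * (spinor p).fst -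
        (proj p : EuclideanSpace ℝ (Fin 5)) 4 • (spinor p).snd = -(spinor p).snd :=
      congrArg WithLp.snd p.2
    apply Spinor.ext
    · change flipVec (proj p) 4 • (spinor p).snd + quat (flipVec (proj p)) * (spinor p).fst =
        -(spinor p).snd
      rw [← h2, quat_flipVec]
      simp [flipVec]
      abel
    · change star (quat (flipVec (proj p))) * (spinor p).snd - flipVec (proj p) 4 • (spinor p).fst =
        -(spinor p).fst
      rw [← h1, quat_flipVec]
      simp [flipVec]
      abel⟩

theorem flip_flip (p : NegSpinorBundle) : flip (flip p) = p := by
  refine Subtype.ext (Prod.ext (Subtype.ext ?_) rfl)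
  change flipVec (flipVec (proj p)) = proj p
  ext i
  fin_cases i <;> simp [flipVec]

theorem continuous_flip : Continuous flip := by
  have h := (continuous_subtype_val.comp continuous_proj :
    Continuous fun p : NegSpinorBundle => (proj p : EuclideanSpace ℝ (Fin 5)))
  have hs := continuous_spinor
  refine Continuous.subtype_mk (Continuous.prodMk (Continuous.subtype_mk ?_ _) ?_) _
  · refine (PiLp.continuous_toLp 2 _).comp (continuous_pi fun i => ?_)
    fin_cases i <;> simp <;> fun_prop
  · refine (WithLp.prod_continuous_toLp 2 _ _).comp ?_
    have h' := (WithLp.prod_continuous_ofLp 2 _ _).comp hs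
    exact (continuous_snd.comp h').prodMk (continuous_fst.comp h')

/-- The chart of the bundle over `S⁴ ∖ {(0, 1)}`. -/
def chart₂ : OpenPartialHomeomorph NegSpinorBundle (ℍ[ℝ] × ℍ[ℝ]) :=
  ({ toFun := flip
     invFun := flip
     left_inv := flip_flip
     right_inv := flip_flip
     continuous_toFun := continuous_flip
     continuous_invFun := continuous_flip } :
    NegSpinorBundle ≃ₜ NegSpinorBundle).transOpenPartialHomeomorph chart₁

open Classical in
instance : ChartedSpace (ℍ[ℝ] × ℍ[ℝ]) NegSpinorBundle where
  atlas := {chart₁, chart₂}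
  chartAt p := if (proj p : EuclideanSpace ℝ (Fin 5)) 4 ≠ -1 then chart₁ else chart₂
  mem_chart_source p := by
    split_ifs with h
    · exact h
    · rw [not_not] at h
      change flipVec (proj p) 4 ≠ -1
      simp only [flipVec]
      simp [h]
      norm_num
  chart_mem_atlas p := by
    split_ifs <;> simp

theorem chart₁_symm_trans_chart₂ (z : ℍ[ℝ] × ℍ[ℝ]) (hz : z.1 ≠ 0) :
    chartFun (flip (chartInv z)) = ((‖z.1‖ ^ 2)⁻¹ • star z.1, -(z.1 * z.2)) := by
  have h := one_add_norm_pos z.1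
  have hz' : ‖z.1‖ ≠ 0 := by simpa using hz
  refine Prod.ext ?_ rfl
  change (1 + flipVec (stereoInv z.1) 4)⁻¹ • quat (flipVec (stereoInv z.1)) = _
  rw [quat_flipVec, quat_stereoInv]
  have h4 : flipVec (stereoInv z.1) 4 = -((1 - ‖z.1‖ ^ 2) * (1 + ‖z.1‖ ^ 2)⁻¹) := by
    rw [← stereoInv_four]
    simp [flipVec]
  have h5 : 1 + -((1 - ‖z.1‖ ^ 2) * (1 + ‖z.1‖ ^ 2)⁻¹) = 2 * ‖z.1‖ ^ 2 * (1 + ‖z.1‖ ^ 2)⁻¹ := by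
    field_simp
    ring
  rw [h4, h5, Quaternion.star_smul, smul_smul]
  congr 1
  field_simp

theorem contDiffOn_transition :
    ContDiffOn ℝ ∞ (fun z : ℍ[ℝ] × ℍ[ℝ] => ((‖z.1‖ ^ 2)⁻¹ • star z.1, -(z.1 * z.2)))
      {z | z.1 ≠ 0} := by
  let S : ℍ[ℝ] →ₗ[ℝ] ℍ[ℝ] :=
    { toFun := star, map_add' := star_add, map_smul' := Quaternion.star_smul }
  have h1 : ContDiffOn ℝ ∞ (fun z : ℍ[ℝ] × ℍ[ℝ] => (‖z.1‖ ^ 2)⁻¹) {z | z.1 ≠ 0} :=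
    (contDiff_fst.norm_sq ℝ).contDiffOn.inv fun z hz => by simpa using hz
  have h2 : ContDiffOn ℝ ∞ (fun z : ℍ[ℝ] × ℍ[ℝ] => star z.1) {z | z.1 ≠ 0} :=
    (S.toContinuousLinearMap.contDiff.comp contDiff_fst).contDiffOn
  exact (h1.smul h2).prodMk (contDiff_fst.mul contDiff_snd).neg.contDiffOn

instance : IsManifold 𝓘(ℝ, ℍ[ℝ] × ℍ[ℝ]) ∞ NegSpinorBundle := by
  have hsrc : ∀ z : ℍ[ℝ] × ℍ[ℝ],
      (proj (flip (chartInv z)) : EuclideanSpace ℝ (Fin 5)) 4 ≠ -1 → z.1 ≠ 0 := by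
    intro z h hz
    apply h
    change flipVec (stereoInv z.1) 4 = -1
    simp [flipVec, stereoInv, hz]
  have hid : ∀ e : OpenPartialHomeomorph NegSpinorBundle (ℍ[ℝ] × ℍ[ℝ]),
      ContDiffOn ℝ ∞ (e.symm ≫ₕ e) (e.symm ≫ₕ e).source := fun e =>
    contDiffOn_id.congr fun z hz => e.right_inv (by
      rw [OpenPartialHomeomorph.trans_source] at hz
      exact hz.1)
  apply isManifold_of_contDiffOn
  rintro e e' (rfl | rfl) (rfl | rfl)
  · simpa using hid chart₁
  · refine (contDiffOn_transition.mono (fun z hz => ?_)).congr fun z hz => ?_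
    · exact hsrc z hz.1.2
    · exact chart₁_symm_trans_chart₂ z (hsrc z hz.1.2)
  · refine (contDiffOn_transition.mono (fun z hz => ?_)).congr fun z hz => ?_
    · exact hsrc z hz.1.2
    · exact chart₁_symm_trans_chart₂ z (hsrc z hz.1.2)
  · simpa using hid chart₂

/-! ### The Bryant–Salamon structure -/

/-- The model vector space of the eight-dimensional manifold `NegSpinorBundle`. -/
abbrev Model : Type := ℍ[ℝ] × ℍ[ℝ]

/-- The skew-symmetrisation `B(v, w) - B(w, v)` of a bilinear form. -/
def skew {V : Type*} [AddCommGroup V] [Module ℝ V] (B : V →ₗ[ℝ] V →ₗ[ℝ] ℝ) :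
    V [⋀^Fin 2]→ₗ[ℝ] ℝ where
  toFun v := B (v 0) (v 1) - B (v 1) (v 0)
  map_update_add' v i x y := by
    fin_cases i <;> simp <;> ring
  map_update_smul' v i c x := by
    fin_cases i <;> simp <;> ring
  map_eq_zero_of_eq' v i j h hij := by
    fin_cases i <;> fin_cases j <;> simp_all

/-- `d(ι ∘ proj)`, where `ι : S⁴ → ℝ⁵` is the inclusion. -/
def dBase (p : NegSpinorBundle) :
    TangentSpace 𝓘(ℝ, Model) p →ₗ[ℝ] EuclideanSpace ℝ (Fin 5) :=
  dS4 (proj p) ∘ₗ (mfderiv 𝓘(ℝ, Model) (𝓡 4) proj p).toLinearMap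

/-- The differential of the spinor component. -/
def dSpinor (p : NegSpinorBundle) : TangentSpace 𝓘(ℝ, Model) p →ₗ[ℝ] Spinor :=
  (mvfderiv 𝓘(ℝ, Model) spinor p).toLinearMap

/-- The connection map of the spin connection: the spin connection of the negative spinor bundle
is the orthogonal projection `½ (1 - c(x))` of the flat connection of `S⁴ × Spinor`, and a tangent
vector at `p` is sent to the covariant derivative of the spinor component along it. -/
def vert (p : NegSpinorBundle) : TangentSpace 𝓘(ℝ, Model) p →ₗ[ℝ] Spinor :=
  (1 / 2 : ℝ) • (dSpinor p - cliff (proj p : EuclideanSpace ℝ (Fin 5)) ∘ₗ dSpinor p)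

/-- `g_𝓥`: the fibre metric on vertical parts. -/
def fibreMetric : BilinField Model NegSpinorBundle := fun p =>
  (innerₗ Spinor).compl₁₂ (vert p) (vert p)

/-- The quaternion `i`. -/
def quatI : ℍ[ℝ] := ⟨0, 1, 0, 0⟩

/-- The complex structure `ψ ↦ ψ i` of the spinor space. -/
def mulI : Spinor →ₗ[ℝ] Spinor where
  toFun ψ := WithLp.toLp 2 (ψ.fst * quatI, ψ.snd * quatI)
  map_add' ψ χ := by
    apply Spinor.ext <;> simp [add_mul]
  map_smul' r ψ := by
    apply Spinor.ext <;> simp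

/-- The Kähler form `ω(η, ξ) = ⟨η i, ξ⟩` of the spinor space. -/
def kahler : Spinor [⋀^Fin 2]→ₗ[ℝ] ℝ :=
  (1 / 2 : ℝ) • skew ((innerₗ Spinor) ∘ₗ mulI)

/-- `vol_𝓥`: on vertical parts, the volume form `½ ω ∧ ω` of the fibres of the negative spinor
bundle, which are hermitian planes with their complex orientation. -/
def fibreVol : FormField Model NegSpinorBundle 4 := fun p =>
  AlternatingMap.compLinearMap ((1 / 2 : ℝ) • wedge kahler kahler) (vert p)

/-- The `2`-form `e^a ∧ e^b` of `ℝ⁵`, pulled back to the bundle. -/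
def baseForm (a b : Fin 5) : FormField Model NegSpinorBundle 2 := fun p =>
  (skew ((LinearMap.mul ℝ ℝ).compl₁₂
    (EuclideanSpace.proj (𝕜 := ℝ) a).toLinearMap
    (EuclideanSpace.proj (𝕜 := ℝ) b).toLinearMap)).compLinearMap (dBase p)

/-- The form `½ ⟨η, [c(e_a), c(e_b)] ξ⟩` on vertical parts. -/
def curvForm (a b : Fin 5) : FormField Model NegSpinorBundle 2 := fun p =>
  ((1 / 2 : ℝ) • skew ((innerₗ Spinor).compl₂
    (cliff (EuclideanSpace.single a 1) ∘ₗ cliff (EuclideanSpace.single b 1)))).compLinearMap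
      (vert p)

/-- The `(2,2)`-form `β` with `β(X, Y, η, ξ) = ½ ⟨η, [c(X), c(Y)] ξ⟩` for `X, Y` horizontal and
`η, ξ` vertical; it is `∑_{a < b} e^a ∧ e^b ∧ ½ ⟨·, [c(e_a), c(e_b)] ·⟩`. -/
def betaForm : FormField Model NegSpinorBundle 4 := fun p =>
  (1 / 2 : ℝ) • ∑ a, ∑ b, wedge (baseForm a b p) (curvForm a b p)

/-- `w = (5 (c₀ + c₁ r²)^{3/5})^{1/2}`, where `r = |ψ|` is the norm of the spinor. -/
def bsW (c₀ c₁ : ℝ) (p : NegSpinorBundle) : ℝ :=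
  √(5 * (c₀ + c₁ * ‖spinor p‖ ^ 2) ^ (3 / 5 : ℝ))

/-- `v = (4 c₁ (c₀ + c₁ r²)^{-2/5})^{1/2}`. -/
def bsV (c₀ c₁ : ℝ) (p : NegSpinorBundle) : ℝ :=
  √(4 * c₁ * (c₀ + c₁ * ‖spinor p‖ ^ 2) ^ (-(2 / 5) : ℝ))

/-- The Bryant–Salamon metric `h = w² u^* g + v² g_𝓥`, where `u` is the bundle projection. -/
def bsMetric (c₀ c₁ : ℝ) : BilinField Model NegSpinorBundle := fun p =>
  bsW c₀ c₁ p ^ 2 • pullbackBilin (E := Model) proj roundMetric p + bsV c₀ c₁ p ^ 2 • fibreMetric p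

/-- The Bryant–Salamon form `Φ = w⁴ u^* vol_{S⁴} + w² v² β + v⁴ vol_𝓥`. -/
def bsForm (c₀ c₁ : ℝ) : FormField Model NegSpinorBundle 4 := fun p =>
  bsW c₀ c₁ p ^ 4 • pullbackForm (E := Model) proj sphereVol p
    + (bsW c₀ c₁ p ^ 2 * bsV c₀ c₁ p ^ 2) • betaForm p
    + bsV c₀ c₁ p ^ 4 • fibreVol p

/-- The volume form `(v⁴ vol_𝓥) ∧ (w⁴ u^* vol_{S⁴})`. -/
def bsVol (c₀ c₁ : ℝ) : FormField Model NegSpinorBundle (4 + 4) := fun p =>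
  wedge (bsV c₀ c₁ p ^ 4 • fibreVol p)
    (bsW c₀ c₁ p ^ 4 • pullbackForm (E := Model) proj sphereVol p)

end NegSpinorBundle

end Smith

end

noncomputable section

open scoped Manifold ContDiff Quaternion RealInnerProductSpace
open Metric

namespace Smith

/-! Over the point of S⁴ with stereographic coordinate q the negative spinors are the (-q a, a), so
(q, a) ∈ ℍ ⊕ ℍ are coordinates of M. Put s = 1 + |q|² and let D = da + s⁻¹ q̄ dq a be the covariant
derivative. Then u^*g = 4 s⁻² |dq|², g_𝓥 = s |D|², u^*vol = 16 s⁻⁴ vol(dq), vol_𝓥 = -s² vol(D), and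
β is 4 s⁻¹ times the form `qmixed` in (dq, D). The second chart is the first followed by a rotation
of ℝ⁵ lifted to spinors, so the same formulas hold in both (`exists_chart`).

Algebra. With A = 4 w² s⁻² and B = v² s, the frame (√A dq, √B D) turns h into the Euclidean inner
product and Φ into the constant form `qcayley` (`coordBilin_eq_qdot`, `coordForm_eq_qcayley`). In
suitable real coordinates this is the standard Cayley form (`cayleyForm_qcoord`), and its comass is
at most one because it is an octonionic triple product (`qcayley_eq_octonion`). Vertical means dq =
0 and horizontal means D = 0; conformality with dilation 1/w, the Smith equation and the Cayley
fibres are read off in this frame.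

Closedness. Up to an infinitesimal gauge transformation, the derivative of D has antisymmetric part
equal to the curvature (`covHess_sub`); the gauge terms are absorbed by the derivatives of the
powers of s. There remain the terms from d(c₀ + c₁ r²) = 2 c₁ s ⟨a, D⟩ and those from inserting the
curvature into `qmixed` and into vol(D). By `pairSum_qmixed` and `pairSum_qvol` they cancel for
exactly the given constants and exponents.

4-harmonicity. The energy density |du|² = 4/w² is constant in horizontal directions because the
connection is metric, and the fibres are totally geodesic (`christoffelTrace_vertical`). So the
4-tension reduces to a multiple of the round Laplacian of the inclusion S⁴ → ℝ⁵, which is normal to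
the sphere (`sum_stereoDD`) and disappears in the chart of the target. -/

/-! ### Permutation sums and wedge products. -/

theorem sum_perm_fin_four (f : Fin 4 → Fin 4 → Fin 4 → Fin 4 → ℝ) :
    ∑ σ : Equiv.Perm (Fin 4), ((Equiv.Perm.sign σ : ℤ) : ℝ) * f (σ 0) (σ 1) (σ 2) (σ 3) =
      f 0 1 2 3 - f 0 1 3 2 - f 0 2 1 3 + f 0 2 3 1 + f 0 3 1 2 - f 0 3 2 1
      - f 1 0 2 3 + f 1 0 3 2 + f 1 2 0 3 - f 1 2 3 0 - f 1 3 0 2 + f 1 3 2 0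
      + f 2 0 1 3 - f 2 0 3 1 - f 2 1 0 3 + f 2 1 3 0 + f 2 3 0 1 - f 2 3 1 0
      - f 3 0 1 2 + f 3 0 2 1 + f 3 1 0 2 - f 3 1 2 0 - f 3 2 0 1 + f 3 2 1 0 := by
  simp only [← Equiv.sum_comp Equiv.Perm.decomposeFin.symm, Fintype.sum_prod_type,
    Fin.sum_univ_succ, Finset.univ_unique, Finset.sum_singleton]
  simp [Equiv.Perm.decomposeFin.symm_sign]
  change f 0 1 2 3 + -f 0 1 3 2 + (-f 0 2 1 3 + f 0 2 3 1 + (-f 0 3 2 1 + f 0 3 1 2)) +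
    (-f 1 0 2 3 + f 1 0 3 2 + (f 1 2 0 3 + -f 1 2 3 0 + (f 1 3 2 0 + -f 1 3 0 2)) +
    (-f 2 1 0 3 + f 2 1 3 0 + (f 2 0 1 3 + -f 2 0 3 1 + (f 2 3 0 1 + -f 2 3 1 0)) +
    (-f 3 1 2 0 + f 3 1 0 2 + (f 3 2 1 0 + -f 3 2 0 1 + (f 3 0 2 1 + -f 3 0 1 2))))) = _
  ring

section
variable {V : Type*} [AddCommGroup V] [Module ℝ V] {k l : ℕ}

/-- Every class of shuffles except the trivial one feeds some `e j` to `γ`, so a single summand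
survives. -/
theorem wedge_append (α : V [⋀^Fin k]→ₗ[ℝ] ℝ) (γ : V [⋀^Fin l]→ₗ[ℝ] ℝ) (e : Fin k → V)
    (f : Fin l → V) (h : ∀ (v : Fin l → V) (i : Fin l) (j : Fin k), v i = e j → γ v = 0) :
    wedge α γ (Fin.append e f) = α e * γ f := by
  have hs : ∀ σ : Equiv.Perm (Fin k ⊕ Fin l),
      AlternatingMap.domCoprod.summand α γ (Quotient.mk'' σ)
        (Fin.append e f ∘ finSumFinEquiv) = Equiv.Perm.sign σ •
        ((α fun i => (Fin.append e f ∘ finSumFinEquiv) (σ (Sum.inl i))) ⊗ₜ[ℝ]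
         γ fun i => (Fin.append e f ∘ finSumFinEquiv) (σ (Sum.inr i))) := fun σ => rfl
  change LinearMap.mul' ℝ ℝ (α.domCoprod γ (Fin.append e f ∘ finSumFinEquiv)) = _
  have hsum : α.domCoprod γ (Fin.append e f ∘ finSumFinEquiv) =
      ∑ σ, AlternatingMap.domCoprod.summand α γ σ (Fin.append e f ∘ finSumFinEquiv) := by
    simp
  rw [hsum]
  refine (congrArg _ (Finset.sum_eq_single
    (Quotient.mk'' 1 : Equiv.Perm.ModSumCongr (Fin k) (Fin l)) ?_ ?_)).trans ?_
  rotate_left 2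
  · rw [hs]
    simp
  · intro σ _ hσ
    induction σ using Quotient.inductionOn' with
    | h σ =>
    rw [hs]
    by_cases hm : ∃ i j, σ (Sum.inr i) = Sum.inl j
    · obtain ⟨i, j, hij⟩ := hm
      rw [h (fun i => (Fin.append e f ∘ finSumFinEquiv) (σ (Sum.inr i))) i j (by simp [hij])]
      simp
    -- If no right index goes to the left block, then by finiteness the right block is permuted,
    -- hence the left one too, and `σ` represents the trivial class.
    · exfalso
      push Not at hm
      apply hσ
      rw [Quotient.eq'', QuotientGroup.leftRel_apply, mul_one, inv_mem_iff]
      apply Equiv.Perm.mem_sumCongrHom_range_of_perm_mapsTo_inl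
      rintro _ ⟨i, rfl⟩
      have hg : ∀ i : Fin l, ∃ j, σ (Sum.inr i) = Sum.inr j := fun i => by
        rcases hi : σ (Sum.inr i) with j | j
        · exact absurd hi (hm i j)
        · exact ⟨j, rfl⟩
      choose g hg using hg
      have hinj : Function.Injective g := fun a b hab => by
        have : σ (Sum.inr a) = σ (Sum.inr b) := by rw [hg, hg, hab]
        exact Sum.inr_injective (σ.injective this)
      rcases hi : σ (Sum.inl i) with j | j
      · exact ⟨j, rfl⟩
      · obtain ⟨m, rfl⟩ := Finite.surjective_of_injective hinj j
        rw [← hg] at hi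
        simpa using σ.injective hi
  · simp

/-- The antisymmetrisation of `α ⊗ γ` over all 24 permutations counts each of the six shuffles 2!·2!
= 4 times. -/
theorem wedge_two_two (α γ : V [⋀^Fin 2]→ₗ[ℝ] ℝ) (v : Fin (2 + 2) → V) :
    wedge α γ v = α ![v 0, v 1] * γ ![v 2, v 3] - α ![v 0, v 2] * γ ![v 1, v 3]
      + α ![v 0, v 3] * γ ![v 1, v 2] + α ![v 1, v 2] * γ ![v 0, v 3]
      - α ![v 1, v 3] * γ ![v 0, v 2] + α ![v 2, v 3] * γ ![v 0, v 1] := by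
  have h := congrArg (fun m => LinearMap.mul' ℝ ℝ (m (v ∘ finSumFinEquiv)))
    (MultilinearMap.domCoprod_alternization_eq α γ)
  have h4 : (4 : ℝ) * wedge α γ v =
      ∑ σ : Equiv.Perm (Fin 4), ((Equiv.Perm.sign σ : ℤ) : ℝ) *
       (α ![v (σ 0), v (σ 1)] * γ ![v (σ 2), v (σ 3)]) := by
    have h2 : LinearMap.mul' ℝ ℝ (((Fintype.card (Fin 2)).factorial *
        (Fintype.card (Fin 2)).factorial) • α.domCoprod γ (v ∘ finSumFinEquiv)) =
        4 * wedge α γ v := by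
      rw [map_nsmul]
      simp [wedge]
    rw [← h2]
    refine h.symm.trans ?_
    rw [MultilinearMap.alternatization_apply, map_sum,
      ← Equiv.sum_comp (Equiv.permCongr (finSumFinEquiv (m := 2) (n := 2)))]
    refine Finset.sum_congr rfl fun σ _ => ?_
    have h0 : finSumFinEquiv.symm (0 : Fin (2 + 2)) = Sum.inl 0 := rfl
    have h1 : finSumFinEquiv.symm (1 : Fin (2 + 2)) = Sum.inl 1 := rfl
    have h2 : finSumFinEquiv.symm (2 : Fin (2 + 2)) = Sum.inr 0 := rfl
    have h3 : finSumFinEquiv.symm (3 : Fin (2 + 2)) = Sum.inr 1 := rfl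
    have hpair : ∀ w : Fin 2 → V, ![w 0, w 1] = w := fun w => by
      ext i; fin_cases i <;> rfl
    simp only [Equiv.Perm.sign_permCongr, Equiv.permCongr_apply, h0, h1, h2,
      h3]
    rw [hpair fun i => v (finSumFinEquiv (σ (Sum.inl i))),
      hpair fun i => v (finSumFinEquiv (σ (Sum.inr i)))]
    simp
    rw [Units.smul_def, zsmul_eq_mul]
  rw [sum_perm_fin_four fun a b c d => α ![v a, v b] * γ ![v c, v d]] at h4
  have hα : ∀ x y, α ![x, y] = - α ![y, x] := fun x y => by
    have := α.map_swap ![y, x] (i := 0) (j := 1) (by simp)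
    rw [← this]; congr 1; ext i; fin_cases i <;> simp
  have hγ : ∀ x y, γ ![x, y] = - γ ![y, x] := fun x y => by
    have := γ.map_swap ![y, x] (i := 0) (j := 1) (by simp)
    rw [← this]; congr 1; ext i; fin_cases i <;> simp
  rw [hα (v 1) (v 0), hα (v 2) (v 0), hα (v 3) (v 0), hα (v 2) (v 1), hα (v 3) (v 1),
    hα (v 3) (v 2), hγ (v 1) (v 0), hγ (v 2) (v 0), hγ (v 3) (v 0), hγ (v 2) (v 1), hγ (v 3) (v 1),
    hγ (v 3) (v 2)] at h4
  linarith

end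

/-! ### Metric traces and Christoffel symbols in orthonormal bases. -/

/-- If `P` expresses the auxiliary basis through the orthonormal one and `Q` is its inverse, the
Gram matrix is P Pᵀ with inverse Qᵀ Q; this `Q` carries the contraction back to the orthonormal
basis. -/
theorem metricTrace_eq_sum {V W ι : Type*} [AddCommGroup V] [Module ℝ V] [Module.Finite ℝ V]
    [AddCommGroup W] [Module ℝ W] [Fintype ι] (h : V →ₗ[ℝ] V →ₗ[ℝ] ℝ) (B : V →ₗ[ℝ] V →ₗ[ℝ] W)
    (e : Module.Basis ι ℝ V) [DecidableEq ι] (he : ∀ i j, h (e i) (e j) = if i = j then 1 else 0) :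
    metricTrace (fun v w => h v w) (fun v w => B v w) = ∑ i, B (e i) (e i) := by
  set f := Module.finBasis ℝ V
  set P : Matrix _ _ ℝ := Matrix.of fun i k => e.repr (f i) k with hP
  set Q : Matrix _ _ ℝ := Matrix.of fun k i => f.repr (e k) i with hQ
  have hf : ∀ i, f i = ∑ k, P i k • e k := fun i => (e.sum_repr (f i)).symm
  have hQP : Q * P = 1 := by
    have := e.toMatrix_mul_toMatrix_flip f
    rw [← Matrix.transpose_inj, Matrix.transpose_mul, Matrix.transpose_one, ← this]
    rfl
  have hPQ : P * Q = 1 := by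
    have := f.toMatrix_mul_toMatrix_flip e
    rw [← Matrix.transpose_inj, Matrix.transpose_mul, Matrix.transpose_one, ← this]
    rfl
  have hH : (Matrix.of fun i j => h (f i) (f j)) = P * P.transpose := by
    ext i j
    rw [Matrix.of_apply, hf i, hf j]
    simp [Matrix.mul_apply, he, mul_comm]
  have hinv : (Matrix.of fun i j => h (f i) (f j))⁻¹ = Q.transpose * Q := by
    apply Matrix.inv_eq_left_inv
    rw [hH, Matrix.mul_assoc, ← Matrix.mul_assoc Q, hQP, Matrix.one_mul, ← Matrix.transpose_mul,
      hPQ, Matrix.transpose_one]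
  have he' : ∀ k, e k = ∑ i, Q k i • f i := fun k => (f.sum_repr (e k)).symm
  unfold metricTrace
  simp only
  rw [hinv]
  have : ∀ k, B (e k) (e k) = ∑ i, ∑ j, (Q k i * Q k j) • B (f i) (f j) := fun k => by
    conv_lhs => rw [he' k]
    simp only [map_sum, map_smul, LinearMap.sum_apply, LinearMap.smul_apply, Finset.smul_sum,
      smul_smul]
    rw [Finset.sum_comm]
    simp only [mul_comm]
  simp only [this, Matrix.mul_apply, Matrix.transpose_apply, Finset.sum_smul]
  symm
  rw [Finset.sum_comm]
  exact Finset.sum_congr rfl fun i _ => Finset.sum_comm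

/-- Since `G` is a bare function, `H` and `D` supply the multilinearity of its value and first
derivatives at `y`. -/
theorem christoffel_eq_sum {E ι : Type*} [NormedAddCommGroup E] [NormedSpace ℝ E]
    [FiniteDimensional ℝ E] [Fintype ι] [DecidableEq ι] (G : E → E → E → ℝ) (y : E)
    (H : E →ₗ[ℝ] E →ₗ[ℝ] ℝ) (hH : ∀ v w, G y v w = H v w) (D : E →ₗ[ℝ] E →ₗ[ℝ] E →ₗ[ℝ] ℝ)
    (hD : ∀ u v w, fderiv ℝ (fun t => G t v w) y u = D u v w) (e : Module.Basis ι ℝ E)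
    (he : ∀ i j, H (e i) (e j) = if i = j then 1 else 0) (v w : E) :
    christoffel G y v w =
      ∑ i, ((1 / 2 : ℝ) * (D v w (e i) + D w v (e i) - D (e i) v w)) • e i := by
  have h1 : G y = fun v w => H v w := by ext; exact hH _ _
  unfold christoffel
  rw [h1]
  simp only [hD]
  let B : E →ₗ[ℝ] E →ₗ[ℝ] E := LinearMap.mk₂ ℝ
    (fun z z' => ((1 / 2 : ℝ) * (D v w z + D w v z - D z v w)) • z')
    (fun _ _ _ => by simp only [map_add, LinearMap.add_apply]; module)
    (fun _ _ _ => by simp only [map_smul, LinearMap.smul_apply, smul_eq_mul]; module)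
    (fun _ _ _ => by module) (fun _ _ _ => by module)
  exact metricTrace_eq_sum H B e he

/-! ### Quaternionic algebra -/

theorem quaternion_inner (a b : ℍ[ℝ]) :
    ⟪a, b⟫ = a.re * b.re + a.imI * b.imI + a.imJ * b.imJ + a.imK * b.imK := by
  rw [Quaternion.inner_def]
  simp

theorem quaternion_norm_sq (a : ℍ[ℝ]) :
    ‖a‖ ^ 2 = a.re ^ 2 + a.imI ^ 2 + a.imJ ^ 2 + a.imK ^ 2 := by
  rw [← real_inner_self_eq_norm_sq, quaternion_inner]
  ring

theorem inner_mul_left_mul_left (l a b : ℍ[ℝ]) : ⟪l * a, l * b⟫ = ‖l‖ ^ 2 * ⟪a, b⟫ := by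
  simp only [quaternion_inner, quaternion_norm_sq, Quaternion.re_mul, Quaternion.imI_mul,
    Quaternion.imJ_mul, Quaternion.imK_mul]
  ring

/-- The volume form of the quaternions. -/
def qvol (a b c d : ℍ[ℝ]) : ℝ :=
  ⟪a, b * star c * d⟫ - ⟪b, c⟫ * ⟪a, d⟫ + ⟪b, d⟫ * ⟪a, c⟫ - ⟪c, d⟫ * ⟪a, b⟫

/-- The standard basis `1, i, j, k` of the quaternions. -/
def qbasis : Module.Basis (Fin 4) ℝ ℍ[ℝ] := QuaternionAlgebra.basisOneIJK (-1) 0 (-1)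

theorem qbasis_repr (q : ℍ[ℝ]) : ⇑(qbasis.repr q) = ![q.re, q.imI, q.imJ, q.imK] :=
  QuaternionAlgebra.coe_basisOneIJK_repr _ _ _ _

theorem qbasis_apply (i : Fin 4) : qbasis i =
    (![⟨1, 0, 0, 0⟩, ⟨0, 1, 0, 0⟩, ⟨0, 0, 1, 0⟩, ⟨0, 0, 0, 1⟩] : Fin 4 → ℍ[ℝ]) i := by
  apply qbasis.repr.injective
  apply DFunLike.coe_injective
  rw [Module.Basis.repr_self, qbasis_repr]
  ext j
  fin_cases i <;> fin_cases j <;> simp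

theorem det_fin_four (A : Matrix (Fin 4) (Fin 4) ℝ) : A.det =
    A 0 0 * (A 1 1 * A 2 2 * A 3 3 - A 1 1 * A 2 3 * A 3 2 - A 1 2 * A 2 1 * A 3 3
      + A 1 2 * A 2 3 * A 3 1 + A 1 3 * A 2 1 * A 3 2 - A 1 3 * A 2 2 * A 3 1)
    - A 0 1 * (A 1 0 * A 2 2 * A 3 3 - A 1 0 * A 2 3 * A 3 2 - A 1 2 * A 2 0 * A 3 3
      + A 1 2 * A 2 3 * A 3 0 + A 1 3 * A 2 0 * A 3 2 - A 1 3 * A 2 2 * A 3 0)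
    + A 0 2 * (A 1 0 * A 2 1 * A 3 3 - A 1 0 * A 2 3 * A 3 1 - A 1 1 * A 2 0 * A 3 3
      + A 1 1 * A 2 3 * A 3 0 + A 1 3 * A 2 0 * A 3 1 - A 1 3 * A 2 1 * A 3 0)
    - A 0 3 * (A 1 0 * A 2 1 * A 3 2 - A 1 0 * A 2 2 * A 3 1 - A 1 1 * A 2 0 * A 3 2
      + A 1 1 * A 2 2 * A 3 0 + A 1 2 * A 2 0 * A 3 1 - A 1 2 * A 2 1 * A 3 0) := by
  rw [Matrix.det_succ_row_zero]
  simp only [Fin.sum_univ_four, Matrix.det_fin_three, Matrix.submatrix_apply]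
  change (-1) ^ 0 * A 0 0 * (A 1 1 * A 2 2 * A 3 3 - A 1 1 * A 2 3 * A 3 2 - A 1 2 * A 2 1 * A 3 3
      + A 1 2 * A 2 3 * A 3 1 + A 1 3 * A 2 1 * A 3 2 - A 1 3 * A 2 2 * A 3 1)
    + (-1) ^ 1 * A 0 1 * (A 1 0 * A 2 2 * A 3 3 - A 1 0 * A 2 3 * A 3 2 - A 1 2 * A 2 0 * A 3 3
      + A 1 2 * A 2 3 * A 3 0 + A 1 3 * A 2 0 * A 3 2 - A 1 3 * A 2 2 * A 3 0)
    + (-1) ^ 2 * A 0 2 * (A 1 0 * A 2 1 * A 3 3 - A 1 0 * A 2 3 * A 3 1 - A 1 1 * A 2 0 * A 3 3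
      + A 1 1 * A 2 3 * A 3 0 + A 1 3 * A 2 0 * A 3 1 - A 1 3 * A 2 1 * A 3 0)
    + (-1) ^ 3 * A 0 3 * (A 1 0 * A 2 1 * A 3 2 - A 1 0 * A 2 2 * A 3 1 - A 1 1 * A 2 0 * A 3 2
      + A 1 1 * A 2 2 * A 3 0 + A 1 2 * A 2 0 * A 3 1 - A 1 2 * A 2 1 * A 3 0) = _
  ring

theorem qbasis_det (v : Fin 4 → ℍ[ℝ]) : qbasis.det v = qvol (v 0) (v 1) (v 2) (v 3) := by
  rw [Module.Basis.det_apply, det_fin_four]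
  simp only [Module.Basis.toMatrix_apply, qbasis_repr, qvol, quaternion_inner, Quaternion.re_mul,
    Quaternion.imI_mul, Quaternion.imJ_mul, Quaternion.imK_mul, Quaternion.re_star,
    Quaternion.imI_star, Quaternion.imJ_star, Quaternion.imK_star, Matrix.cons_val]
  ring

/-- Four-forms on ℍ form a line, so the volume forms of base and fibre need only be evaluated on 1,
i, j, k. -/
theorem alternating_eq_qvol (α : ℍ[ℝ] [⋀^Fin 4]→ₗ[ℝ] ℝ) (v : Fin 4 → ℍ[ℝ]) :
    α v = α qbasis * qvol (v 0) (v 1) (v 2) (v 3) := by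
  conv_lhs => rw [α.eq_smul_basis_det qbasis]
  rw [AlternatingMap.smul_apply, qbasis_det, smul_eq_mul]

/-! ### The model Cayley form on ℍ ⊕ ℍ. -/

/-- The form `⟨D, Im(X̄ Y) E⟩`. -/
def qcurv (X Y D E : ℍ[ℝ]) : ℝ := (1 / 2) * ⟪D, (star X * Y - star Y * X) * E⟫

/-- The mixed part of the model Cayley form of `ℍ ⊕ ℍ`. -/
def qmixed (u v w z : ℍ[ℝ] × ℍ[ℝ]) : ℝ :=
  qcurv u.1 v.1 w.2 z.2 - qcurv u.1 w.1 v.2 z.2 + qcurv u.1 z.1 v.2 w.2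
    + qcurv v.1 w.1 u.2 z.2 - qcurv v.1 z.1 u.2 w.2 + qcurv w.1 z.1 u.2 v.2

/-- The model Cayley form of `ℍ ⊕ ℍ`. -/
def qcayley (u v w z : ℍ[ℝ] × ℍ[ℝ]) : ℝ :=
  qvol u.1 v.1 w.1 z.1 + qmixed u v w z - qvol u.2 v.2 w.2 z.2

/-- The coordinates of `ℍ ⊕ ℍ` in which the model Cayley form is the standard one. -/
def qcoord (v : ℍ[ℝ] × ℍ[ℝ]) : Fin 8 → ℝ :=
  ![v.2.re, -v.2.imI, -v.2.imJ, -v.2.imK, v.1.re, v.1.imI, v.1.imJ, v.1.imK]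

/-- The conjugation of the second summand in `qcoord` reverses its orientation, which accounts for
the minus sign of the second volume form in `qcayley`. -/
theorem cayleyForm_qcoord (v : Fin 4 → ℍ[ℝ] × ℍ[ℝ]) :
    cayleyForm (fun i => qcoord (v i)) = qcayley (v 0) (v 1) (v 2) (v 3) := by
  simp only [cayleyForm, dx4, det_fin_four, Matrix.of_apply, qcoord, Matrix.cons_val, qcayley,
    qmixed, qvol, qcurv, quaternion_inner, Quaternion.re_mul,
    Quaternion.imI_mul, Quaternion.imJ_mul, Quaternion.imK_mul, Quaternion.re_star,
    Quaternion.imI_star, Quaternion.imJ_star, Quaternion.imK_star, Quaternion.re_sub,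
    Quaternion.imI_sub, Quaternion.imJ_sub, Quaternion.imK_sub]
  ring

/-- The inner product of `ℍ ⊕ ℍ`. -/
def qdot (u v : ℍ[ℝ] × ℍ[ℝ]) : ℝ := ⟪u.1, v.1⟫ + ⟪u.2, v.2⟫

/-- The product of octonions, as pairs of quaternions. -/
def octMul (u v : ℍ[ℝ] × ℍ[ℝ]) : ℍ[ℝ] × ℍ[ℝ] :=
  (u.1 * v.1 - v.2 * star u.2, star u.1 * v.2 + v.1 * u.2)

/-- The conjugation of octonions. -/
def octConj (u : ℍ[ℝ] × ℍ[ℝ]) : ℍ[ℝ] × ℍ[ℝ] := (star u.1, -u.2)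

theorem qdot_octMul (u v : ℍ[ℝ] × ℍ[ℝ]) :
    qdot (octMul u v) (octMul u v) = qdot u u * qdot v v := by
  simp only [qdot, octMul, quaternion_inner, Quaternion.re_mul,
    Quaternion.imI_mul, Quaternion.imJ_mul, Quaternion.imK_mul, Quaternion.re_star,
    Quaternion.imI_star, Quaternion.imJ_star, Quaternion.imK_star, Quaternion.re_sub,
    Quaternion.imI_sub, Quaternion.imJ_sub, Quaternion.imK_sub, Quaternion.re_add,
    Quaternion.imI_add, Quaternion.imJ_add, Quaternion.imK_add]
  ring

theorem qdot_octConj (u : ℍ[ℝ] × ℍ[ℝ]) : qdot (octConj u) (octConj u) = qdot u u := by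
  simp [qdot, octConj]

/-- The products of inner products are the corrections that make ⟨x, y(z̄ w)⟩ alternating. -/
theorem qcayley_eq_octonion (x y z w : ℍ[ℝ] × ℍ[ℝ]) :
    qcayley x y z w = qdot x (octMul y (octMul (octConj z) w))
      - qdot y z * qdot x w + qdot y w * qdot x z - qdot z w * qdot x y := by
  simp only [qcayley, qmixed, qvol, qcurv, qdot, octMul, octConj, quaternion_inner,
    Quaternion.re_mul,
    Quaternion.imI_mul, Quaternion.imJ_mul, Quaternion.imK_mul, Quaternion.re_star,
    Quaternion.imI_star, Quaternion.imJ_star, Quaternion.imK_star, Quaternion.re_sub,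
    Quaternion.imI_sub, Quaternion.imJ_sub, Quaternion.imK_sub, Quaternion.re_add,
    Quaternion.imI_add, Quaternion.imJ_add, Quaternion.imK_add, Quaternion.re_neg,
    Quaternion.imI_neg, Quaternion.imJ_neg, Quaternion.imK_neg]
  ring

theorem qdot_sq_le (u v : ℍ[ℝ] × ℍ[ℝ]) : qdot u v ^ 2 ≤ qdot u u * qdot v v := by
  have h := real_inner_mul_inner_self_le (WithLp.toLp 2 u) (WithLp.toLp 2 v)
  simp only [WithLp.prod_inner_apply] at h
  rw [sq]
  exact h

/-- On orthonormal vectors the corrections vanish; Cauchy–Schwarz and the multiplicativity of the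
octonion norm bound what is left. -/
theorem abs_qcayley_le_one (v : Fin 4 → ℍ[ℝ] × ℍ[ℝ])
    (h : ∀ i j, qdot (v i) (v j) = if i = j then 1 else 0) :
    |qcayley (v 0) (v 1) (v 2) (v 3)| ≤ 1 := by
  rw [qcayley_eq_octonion, h 1 2, h 1 3, h 2 3, ← sq_le_one_iff_abs_le_one]
  have := qdot_sq_le (v 0) (octMul (v 1) (octMul (octConj (v 2)) (v 3)))
  rw [qdot_octMul, qdot_octMul, qdot_octConj, h, h, h, h] at this
  simpa using this

namespace NegSpinorBundle

/-! ### Stereographic coordinates and negative spinors -/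

/-- The inclusion `ℍ → ℍ ⊕ ℝ = ℝ⁵`. -/
def quatVec : ℍ[ℝ] →L[ℝ] EuclideanSpace ℝ (Fin 5) :=
  LinearMap.toContinuousLinearMap
  { toFun := fun q => !₂[q.re, q.imI, q.imJ, q.imK, 0]
    map_add' := fun x y => by ext i; fin_cases i <;> simp
    map_smul' := fun c x => by ext i; fin_cases i <;> simp }

theorem quatVec_apply (q : ℍ[ℝ]) : quatVec q = !₂[q.re, q.imI, q.imJ, q.imK, 0] := rfl

/-- The north pole of `S⁴`. -/
def northPole : EuclideanSpace ℝ (Fin 5) := !₂[0, 0, 0, 0, 1]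

theorem stereoInv_eq (q : ℍ[ℝ]) : stereoInv q =
    (1 + ‖q‖ ^ 2)⁻¹ • ((2 : ℝ) • quatVec q + (2 : ℝ) • northPole) - northPole := by
  have h := one_add_norm_pos q
  ext i
  fin_cases i <;> simp [stereoInv, quatVec_apply, northPole]
  field_simp
  ring

/-- The differential of inverse stereographic projection. -/
def stereoD (q : ℍ[ℝ]) : ℍ[ℝ] →L[ℝ] EuclideanSpace ℝ (Fin 5) :=
  (2 * (1 + ‖q‖ ^ 2)⁻¹) • quatVec -
    (innerSL ℝ q).smulRight ((2 * (1 + ‖q‖ ^ 2)⁻¹) • (stereoInv q + northPole))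

theorem stereoD_apply (q X : ℍ[ℝ]) : stereoD q X = (2 * (1 + ‖q‖ ^ 2)⁻¹) • quatVec X -
    (⟪q, X⟫ * (2 * (1 + ‖q‖ ^ 2)⁻¹)) • (stereoInv q + northPole) := by
  simp [stereoD, smul_smul]

theorem hasFDerivAt_inv_one_add_norm_sq (q : ℍ[ℝ]) :
    HasFDerivAt (fun q : ℍ[ℝ] => (1 + ‖q‖ ^ 2)⁻¹)
      (-((2 * ((1 + ‖q‖ ^ 2) ^ 2)⁻¹) • innerSL ℝ q)) q := by
  have h := one_add_norm_pos q
  have h1 : HasFDerivAt (fun q : ℍ[ℝ] => 1 + ‖q‖ ^ 2) ((2 : ℝ) • innerSL ℝ q) q := by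
    have := ((hasStrictFDerivAt_norm_sq q).hasFDerivAt).const_add (1 : ℝ)
    rw [two_smul] at this ⊢
    exact this
  have := (hasDerivAt_inv h.ne').comp_hasFDerivAt q h1
  refine HasFDerivAt.congr_fderiv (f := fun q : ℍ[ℝ] => (1 + ‖q‖ ^ 2)⁻¹) this ?_
  refine ContinuousLinearMap.ext fun X => ?_
  simp
  ring

theorem hasFDerivAt_stereoInv (q : ℍ[ℝ]) : HasFDerivAt stereoInv (stereoD q) q := by
  have h := one_add_norm_pos q
  have h1 := (((hasFDerivAt_inv_one_add_norm_sq q).smul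
    (((2 : ℝ) • quatVec).hasFDerivAt.add_const ((2 : ℝ) • northPole))).sub_const northPole)
  have h2 : stereoInv = fun q => (1 + ‖q‖ ^ 2)⁻¹ • (((2 : ℝ) • quatVec) q + (2 : ℝ) • northPole)
      - northPole := by
    funext q; exact stereoInv_eq q
  rw [h2]
  refine HasFDerivAt.congr_fderiv h1 ?_
  refine ContinuousLinearMap.ext fun X => ?_
  rw [stereoD_apply, stereoInv_eq]
  simp
  match_scalars <;> field_simp

theorem quat_stereoD (q X : ℍ[ℝ]) : quat (stereoD q X) = (2 * (1 + ‖q‖ ^ 2)⁻¹) • X -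
    (4 * ⟪q, X⟫ * ((1 + ‖q‖ ^ 2) ^ 2)⁻¹) • q := by
  rw [stereoD_apply]
  ext <;> simp [quat, quatVec_apply, stereoInv, northPole] <;> field_simp <;> ring

theorem stereoD_four (q X : ℍ[ℝ]) :
    stereoD q X 4 = -(4 * ⟪q, X⟫ * ((1 + ‖q‖ ^ 2) ^ 2)⁻¹) := by
  have h := one_add_norm_pos q
  rw [stereoD_apply]
  simp [quatVec_apply, stereoInv, northPole]
  field_simp
  ring

theorem inner_eq_quat (x y : EuclideanSpace ℝ (Fin 5)) :
    ⟪x, y⟫ = ⟪quat x, quat y⟫ + x 4 * y 4 := by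
  rw [quaternion_inner]
  simp [PiLp.inner_apply, Fin.sum_univ_five]
  ring

theorem inner_stereoD (q X Y : ℍ[ℝ]) :
    ⟪stereoD q X, stereoD q Y⟫ = 4 * ((1 + ‖q‖ ^ 2) ^ 2)⁻¹ * ⟪X, Y⟫ := by
  have h := one_add_norm_pos q
  rw [inner_eq_quat, quat_stereoD, quat_stereoD, stereoD_four, stereoD_four]
  simp only [inner_sub_left, inner_sub_right, inner_smul_left, inner_smul_right,
    real_inner_self_eq_norm_sq, real_inner_comm q X, RCLike.conj_to_real]
  field_simp
  ring

theorem inner_stereoInv_stereoD (q X : ℍ[ℝ]) : ⟪stereoInv q, stereoD q X⟫ = 0 := by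
  have h := one_add_norm_pos q
  rw [inner_eq_quat, quat_stereoD, stereoD_four, quat_stereoInv, stereoInv_four]
  simp only [inner_sub_right, inner_smul_left, inner_smul_right,
    real_inner_self_eq_norm_sq, RCLike.conj_to_real]
  field_simp
  ring

/-- The spinors of negative chirality over the point with stereographic coordinate `q`. -/
def negSpin (q : ℍ[ℝ]) : ℍ[ℝ] →ₗ[ℝ] Spinor where
  toFun D := WithLp.toLp 2 (-(q * D), D)
  map_add' D E := by
    apply Spinor.ext <;> simp [mul_add]
    abel
  map_smul' c D := by
    apply Spinor.ext <;> simp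

theorem inner_negSpin (q D E : ℍ[ℝ]) :
    ⟪negSpin q D, negSpin q E⟫ = (1 + ‖q‖ ^ 2) * ⟪D, E⟫ := by
  change ⟪-(q * D), -(q * E)⟫ + ⟪D, E⟫ = _
  rw [inner_neg_neg, inner_mul_left_mul_left]
  ring

theorem star_mul_eq_inner_sub (q X : ℍ[ℝ]) : star X * q = (2 * ⟪q, X⟫) • 1 - star q * X := by
  rw [quaternion_inner]
  ext <;> simp <;> ring

theorem mul_star_eq_inner_sub (q X : ℍ[ℝ]) : X * star q = (2 * ⟪q, X⟫) • 1 - q * star X := by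
  rw [quaternion_inner]
  ext <;> simp <;> ring

/-- Clifford multiplication by a tangent vector exchanges chiralities, and the positive spinors are
the (c, q̄ c). In the parameters D and c it is left multiplication by X in this direction and by X̄
in the other, up to the factor 2/s; composites therefore give the products X̄ Y of `qcurv`. -/
theorem cliff_stereoD_negSpin (q X D : ℍ[ℝ]) : cliff (stereoD q X) (negSpin q D) =
    (2 * (1 + ‖q‖ ^ 2)⁻¹) • WithLp.toLp 2 (X * D, star q * (X * D)) := by
  have h := one_add_norm_pos q
  apply Spinor.ext
  · change stereoD q X 4 • (-(q * D)) + quat (stereoD q X) * D = (2 * (1 + ‖q‖ ^ 2)⁻¹) • (X * D)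
    rw [stereoD_four, quat_stereoD, sub_mul, smul_mul_assoc, smul_mul_assoc]
    module
  · change star (quat (stereoD q X)) * (-(q * D)) - stereoD q X 4 • D =
      (2 * (1 + ‖q‖ ^ 2)⁻¹) • (star q * (X * D))
    rw [stereoD_four, quat_stereoD, star_sub, Quaternion.star_smul, Quaternion.star_smul, sub_mul,
      smul_mul_assoc, smul_mul_assoc, mul_neg, mul_neg, star_mul_mul, ← mul_assoc (star X),
      star_mul_eq_inner_sub, sub_mul, smul_mul_assoc, one_mul, mul_assoc]
    match_scalars <;> field_simp
    ring

theorem cliff_stereoD_posSpin (q X c : ℍ[ℝ]) :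
    cliff (stereoD q X) (WithLp.toLp 2 (c, star q * c)) =
    (2 * (1 + ‖q‖ ^ 2)⁻¹) • negSpin q (star X * c) := by
  have h := one_add_norm_pos q
  apply Spinor.ext
  · change stereoD q X 4 • c + quat (stereoD q X) * (star q * c) =
      (2 * (1 + ‖q‖ ^ 2)⁻¹) • (-(q * (star X * c)))
    rw [stereoD_four, quat_stereoD, sub_mul,
      smul_mul_assoc, smul_mul_assoc, mul_star_mul, ← mul_assoc X,
      mul_star_eq_inner_sub, sub_mul (_ • _), smul_mul_assoc, one_mul, mul_assoc q]
    match_scalars <;> field_simp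
    ring
  · change star (quat (stereoD q X)) * c - stereoD q X 4 • (star q * c) =
      (2 * (1 + ‖q‖ ^ 2)⁻¹) • (star X * c)
    rw [stereoD_four, quat_stereoD, star_sub, Quaternion.star_smul, Quaternion.star_smul, sub_mul,
      smul_mul_assoc, smul_mul_assoc]
    module

theorem cliff_cliff_stereoD_negSpin (q X Y D : ℍ[ℝ]) :
    cliff (stereoD q X) (cliff (stereoD q Y) (negSpin q D)) =
      (4 * ((1 + ‖q‖ ^ 2) ^ 2)⁻¹) • negSpin q (star X * Y * D) := by
  rw [cliff_stereoD_negSpin, map_smul, cliff_stereoD_posSpin, smul_smul, mul_assoc (star X)]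
  congr 1
  have h := one_add_norm_pos q
  field_simp
  ring

/-- The differential of the spinor component, in coordinates. -/
def spinD (z : ℍ[ℝ] × ℍ[ℝ]) (v : ℍ[ℝ] × ℍ[ℝ]) : Spinor :=
  WithLp.toLp 2 (-(v.1 * z.2 + z.1 * v.2), v.2)

/-- The covariant derivative, in coordinates. -/
def covD (z : ℍ[ℝ] × ℍ[ℝ]) : ℍ[ℝ] × ℍ[ℝ] →ₗ[ℝ] ℍ[ℝ] where
  toFun v := v.2 + (1 + ‖z.1‖ ^ 2)⁻¹ • (star z.1 * v.1 * z.2)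
  map_add' u v := by
    simp only [Prod.fst_add, Prod.snd_add, mul_add, add_mul, smul_add]
    abel
  map_smul' c v := by
    simp only [Prod.smul_fst, Prod.smul_snd, mul_smul_comm, smul_mul_assoc, RingHom.id_apply,
      smul_add, smul_comm c]

theorem covD_apply (z v : ℍ[ℝ] × ℍ[ℝ]) :
    covD z v = v.2 + (1 + ‖z.1‖ ^ 2)⁻¹ • (star z.1 * v.1 * z.2) := rfl

/-- Projecting (-(dq a + q da), da) orthogonally onto the plane of the (-q D, D) gives D = s⁻¹ (da +
q̄ (dq a + q da)), which is the covariant derivative. -/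
theorem proj_spinD (z v : ℍ[ℝ] × ℍ[ℝ]) :
    (1 / 2 : ℝ) • (spinD z v - cliff (stereoInv z.1) (spinD z v)) = negSpin z.1 (covD z v) := by
  have h := one_add_norm_pos z.1
  apply Spinor.ext
  · change (1 / 2 : ℝ) • (-(v.1 * z.2 + z.1 * v.2) - (stereoInv z.1 4 • (-(v.1 * z.2 + z.1 * v.2))
      + quat (stereoInv z.1) * v.2)) = -(z.1 * (v.2 + (1 + ‖z.1‖ ^ 2)⁻¹ • (star z.1 * v.1 * z.2)))
    rw [stereoInv_four, quat_stereoInv, smul_mul_assoc, mul_add, mul_smul_comm, mul_assoc (star _),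
      mul_star_mul]
    match_scalars <;> field_simp <;> ring
  · change (1 / 2 : ℝ) • (v.2 - (star (quat (stereoInv z.1)) * (-(v.1 * z.2 + z.1 * v.2))
      - stereoInv z.1 4 • v.2)) = v.2 + (1 + ‖z.1‖ ^ 2)⁻¹ • (star z.1 * v.1 * z.2)
    rw [stereoInv_four, quat_stereoInv, Quaternion.star_smul, smul_mul_assoc, mul_neg, mul_add,
      star_mul_mul, mul_assoc (star _)]
    match_scalars <;> field_simp
    ring

end NegSpinorBundle

namespace NegSpinorBundle

/-! ### The constituents of the Bryant–Salamon form, in coordinates -/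

/-- A pair of an oriented isometry of `ℝ⁵` and a compatible unitary map of spinors. -/
structure IsSpinIsometry (L : EuclideanSpace ℝ (Fin 5) →ₗ[ℝ] EuclideanSpace ℝ (Fin 5))
    (S : Spinor →ₗ[ℝ] Spinor) : Prop where
  inner_base : ∀ x y, ⟪L x, L y⟫ = ⟪x, y⟫
  inner_spinor : ∀ η ξ, ⟪S η, S ξ⟫ = ⟪η, ξ⟫
  map_cliff : ∀ x η, cliff (L x) (S η) = S (cliff x η)
  map_mulI : ∀ η, mulI (S η) = S (mulI η)
  det_comp : ∀ v : Fin 5 → EuclideanSpace ℝ (Fin 5),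
    (EuclideanSpace.basisFun (Fin 5) ℝ).toBasis.det (L ∘ v) =
      (EuclideanSpace.basisFun (Fin 5) ℝ).toBasis.det v

theorem isSpinIsometry_id : IsSpinIsometry LinearMap.id LinearMap.id :=
  ⟨fun _ _ => rfl, fun _ _ => rfl, fun _ _ => rfl, fun _ => rfl, fun _ => rfl⟩

/-- The rotation `flipVec` as a linear map. -/
def flipLin : EuclideanSpace ℝ (Fin 5) →ₗ[ℝ] EuclideanSpace ℝ (Fin 5) where
  toFun := flipVec
  map_add' x y := by ext i; fin_cases i <;> simp [flipVec] <;> ring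
  map_smul' c x := by ext i; fin_cases i <;> simp [flipVec]

/-- The exchange of the two quaternionic components of a spinor. -/
def swapSpin : Spinor →ₗ[ℝ] Spinor where
  toFun ψ := WithLp.toLp 2 (ψ.snd, ψ.fst)
  map_add' ψ χ := by apply Spinor.ext <;> simp
  map_smul' c ψ := by apply Spinor.ext <;> simp

/-- An even number of coordinates changes sign, so orientation is preserved; the swap commutes with
right multiplications, in particular with the complex structure. -/
theorem isSpinIsometry_flip : IsSpinIsometry flipLin swapSpin where
  inner_base x y := by
    rw [inner_eq_quat, inner_eq_quat]
    change ⟪quat (flipVec x), quat (flipVec y)⟫ + flipVec x 4 * flipVec y 4 = _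
    rw [quat_flipVec, quat_flipVec, quaternion_inner, quaternion_inner]
    simp [flipVec]
  inner_spinor η ξ := by
    change ⟪η.snd, ξ.snd⟫ + ⟪η.fst, ξ.fst⟫ = ⟪η.fst, ξ.fst⟫ + ⟪η.snd, ξ.snd⟫
    rw [add_comm]
  map_cliff x η := by
    apply Spinor.ext
    · change flipVec x 4 • η.snd + quat (flipVec x) * η.fst = star (quat x) * η.fst - x 4 • η.snd
      rw [quat_flipVec, show flipVec x 4 = -x 4 from rfl]
      module
    · change star (quat (flipVec x)) * η.snd - flipVec x 4 • η.fst =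
        x 4 • η.fst + quat x * η.snd
      rw [quat_flipVec, star_star, show flipVec x 4 = -x 4 from rfl]
      module
  map_mulI η := rfl
  det_comp v := by
    rw [Module.Basis.det_comp]
    have h : LinearMap.det flipLin = 1 := by
      rw [← LinearMap.det_toMatrix (EuclideanSpace.basisFun (Fin 5) ℝ).toBasis]
      have : LinearMap.toMatrix (EuclideanSpace.basisFun (Fin 5) ℝ).toBasis
          (EuclideanSpace.basisFun (Fin 5) ℝ).toBasis flipLin =
          Matrix.diagonal ![1, -1, -1, -1, -1] := by
        ext i j
        rw [LinearMap.toMatrix_apply]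
        fin_cases i <;> fin_cases j <;> simp [flipLin, flipVec]
      rw [this, Matrix.det_diagonal, Fin.prod_univ_five]
      simp
    rw [h, one_mul]

theorem det_stereo_qbasis (q : ℍ[ℝ]) :
    (EuclideanSpace.basisFun (Fin 5) ℝ).toBasis.det
      (Matrix.vecCons (stereoInv q) fun i => stereoD q (qbasis i)) =
      16 * ((1 + ‖q‖ ^ 2) ^ 4)⁻¹ := by
  have h := one_add_norm_pos q
  have hm : 2 * (1 + ‖q‖ ^ 2)⁻¹ * (1 + ‖q‖ ^ 2) = 2 := by field_simp
  have h16 : 16 * ((1 + ‖q‖ ^ 2) ^ 4)⁻¹ = (2 * (1 + ‖q‖ ^ 2)⁻¹) ^ 4 := by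
    rw [mul_pow, inv_pow]
    norm_num
  rw [h16]
  obtain ⟨m, hm'⟩ : ∃ m, 2 * (1 + ‖q‖ ^ 2)⁻¹ = m := ⟨_, rfl⟩
  have hs : ∀ j, stereoInv q j = m * (quatVec q j + northPole j) - northPole j := by
    intro j
    rw [stereoInv_eq, ← hm']
    simp
    ring
  have hD : ∀ i : Fin 4, ∀ j : Fin 5, stereoD q (qbasis i) j = m * quatVec (qbasis i) j -
      ![q.re, q.imI, q.imJ, q.imK] i * m * (m * (quatVec q j + northPole j)) := by
    intro i j
    have hi : ⟪q, qbasis i⟫ = ![q.re, q.imI, q.imJ, q.imK] i := by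
      rw [quaternion_inner, qbasis_apply]
      fin_cases i <;> simp
    rw [stereoD_apply, hi, hm']
    simp [hs]
    ring
  have hv := quaternion_norm_sq q
  rw [hm'] at hm ⊢
  have hq : ∀ (q : ℍ[ℝ]) (j : Fin 5), quatVec q j = ![q.re, q.imI, q.imJ, q.imK, 0] j :=
    fun _ _ => rfl
  have hM : (EuclideanSpace.basisFun (Fin 5) ℝ).toBasis.toMatrix
      (Matrix.vecCons (stereoInv q) fun i => stereoD q (qbasis i)) =
      !![m * q.re, m * 1 - q.re * m * (m * q.re), -(q.imI * m * (m * q.re)),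
          -(q.imJ * m * (m * q.re)), -(q.imK * m * (m * q.re));
        m * q.imI, -(q.re * m * (m * q.imI)), m * 1 - q.imI * m * (m * q.imI),
          -(q.imJ * m * (m * q.imI)), -(q.imK * m * (m * q.imI));
        m * q.imJ, -(q.re * m * (m * q.imJ)), -(q.imI * m * (m * q.imJ)),
          m * 1 - q.imJ * m * (m * q.imJ), -(q.imK * m * (m * q.imJ));
        m * q.imK, -(q.re * m * (m * q.imK)), -(q.imI * m * (m * q.imK)),
          -(q.imJ * m * (m * q.imK)), m * 1 - q.imK * m * (m * q.imK);
        m - 1, -(q.re * m * m), -(q.imI * m * m), -(q.imJ * m * m), -(q.imK * m * m)] := by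
    ext i j
    rw [Module.Basis.toMatrix_apply]
    refine Fin.cases ?_ (fun j => ?_) j
    · fin_cases i <;> simp [hs, quatVec_apply, northPole]
    · change stereoD q (qbasis j) i = _
      rw [hD, qbasis_apply, hq, hq]
      fin_cases i <;> fin_cases j <;> simp [northPole]
  rw [Module.Basis.det_apply, hM, Matrix.det_succ_column_zero, Fin.sum_univ_five]
  simp only [det_fin_four]
  simp [Fin.succAbove, Matrix.submatrix_apply]
  rw [hv] at hm
  -- The determinant expands to m⁵ s - m⁴ with m = 2/s, and m s = 2.
  linear_combination m ^ 4 * hm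

/-- Both sides are alternating in `X`, so the computation on 1, i, j, k suffices. The factor is
(2/s)⁴; its positivity says that the outer normal orientation of S⁴ agrees with the standard one of
ℍ. -/
theorem det_stereo (q : ℍ[ℝ]) (X : Fin 4 → ℍ[ℝ]) :
    (EuclideanSpace.basisFun (Fin 5) ℝ).toBasis.det
      (Matrix.vecCons (stereoInv q) fun i => stereoD q (X i)) =
      16 * ((1 + ‖q‖ ^ 2) ^ 4)⁻¹ * qvol (X 0) (X 1) (X 2) (X 3) := by
  have hα : ∀ Y : Fin 4 → ℍ[ℝ], ((EuclideanSpace.basisFun (Fin 5) ℝ).toBasis.det.curryLeft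
      (stereoInv q)).compLinearMap (stereoD q).toLinearMap Y =
      (EuclideanSpace.basisFun (Fin 5) ℝ).toBasis.det
        (Matrix.vecCons (stereoInv q) fun i => stereoD q (Y i)) := fun Y => by
    rw [AlternatingMap.compLinearMap_apply, AlternatingMap.curryLeft_apply_apply]
    rfl
  rw [← det_stereo_qbasis q, ← hα, ← hα]
  exact alternating_eq_qvol _ X

theorem kahler_apply (v : Fin 2 → Spinor) :
    kahler v = (1 / 2 : ℝ) * (⟪mulI (v 0), v 1⟫ - ⟪mulI (v 1), v 0⟫) := rfl

/-- The volume form of the fibres on spinors. -/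
def spinVol : Spinor [⋀^Fin 4]→ₗ[ℝ] ℝ := (1 / 2 : ℝ) • wedge kahler kahler

theorem spinVol_apply (η : Fin 4 → Spinor) : spinVol η =
    kahler ![η 0, η 1] * kahler ![η 2, η 3] - kahler ![η 0, η 2] * kahler ![η 1, η 3]
      + kahler ![η 0, η 3] * kahler ![η 1, η 2] := by
  change (1 / 2 : ℝ) * wedge kahler kahler η = _
  rw [wedge_two_two]
  ring

theorem IsSpinIsometry.spinVol_comp {L S} (h : IsSpinIsometry L S) (η : Fin 4 → Spinor) :
    spinVol (fun i => S (η i)) = spinVol η := by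
  simp only [spinVol_apply, kahler_apply, Matrix.cons_val, h.map_mulI, h.inner_spinor]

theorem mulI_negSpin (q D : ℍ[ℝ]) : mulI (negSpin q D) = negSpin q (D * quatI) := by
  apply Spinor.ext
  · change -(q * D) * quatI = -(q * (D * quatI))
    rw [neg_mul, mul_assoc]
  · rfl

theorem kahler_negSpin (q D E : ℍ[ℝ]) : kahler ![negSpin q D, negSpin q E] =
    (1 + ‖q‖ ^ 2) * ((1 / 2 : ℝ) * (⟪D * quatI, E⟫ - ⟪E * quatI, D⟫)) := by
  rw [kahler_apply]
  simp only [Matrix.cons_val, mulI_negSpin, inner_negSpin]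
  ring

/-- For right multiplication by i the complex orientation is that of 1, i, j, ji = -k, hence the
minus sign; the Kähler form scales by s and its square by s². -/
theorem spinVol_negSpin (q : ℍ[ℝ]) (D : Fin 4 → ℍ[ℝ]) :
    spinVol (fun i => negSpin q (D i)) =
      -(1 + ‖q‖ ^ 2) ^ 2 * qvol (D 0) (D 1) (D 2) (D 3) := by
  refine (alternating_eq_qvol (spinVol.compLinearMap (negSpin q)) D).trans ?_
  congr 1
  change spinVol (fun i => negSpin q (qbasis i)) = _
  simp only [spinVol_apply, kahler_negSpin, quaternion_inner, Quaternion.re_mul,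
    Quaternion.imI_mul, Quaternion.imJ_mul, Quaternion.imK_mul]
  simp only [qbasis_apply, quatI]
  simp
  ring

/-- The form `½ ⟨η, [c(X), c(Y)] ξ⟩`. -/
def cliffCurv (X Y : EuclideanSpace ℝ (Fin 5)) (η ξ : Spinor) : ℝ :=
  (1 / 2) * ⟪η, cliff X (cliff Y ξ) - cliff Y (cliff X ξ)⟫

theorem IsSpinIsometry.cliffCurv_comp {L S} (h : IsSpinIsometry L S)
    (X Y : EuclideanSpace ℝ (Fin 5)) (η ξ : Spinor) :
    cliffCurv (L X) (L Y) (S η) (S ξ) = cliffCurv X Y η ξ := by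
  simp only [cliffCurv, h.map_cliff, ← map_sub, h.inner_spinor]

theorem cliffCurv_stereoD (q X Y D E : ℍ[ℝ]) :
    cliffCurv (stereoD q X) (stereoD q Y) (negSpin q D) (negSpin q E) =
      4 * (1 + ‖q‖ ^ 2)⁻¹ * qcurv X Y D E := by
  have h := one_add_norm_pos q
  rw [cliffCurv, cliff_cliff_stereoD_negSpin, cliff_cliff_stereoD_negSpin, ← smul_sub, ← map_sub,
    inner_smul_right, inner_negSpin, qcurv, sub_mul]
  field_simp

theorem inner_cliff (x : EuclideanSpace ℝ (Fin 5)) (η ξ : Spinor) :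
    ⟪η, cliff x ξ⟫ = ⟪cliff x η, ξ⟫ := by
  change ⟪η.fst, x 4 • ξ.fst + quat x * ξ.snd⟫ + ⟪η.snd, star (quat x) * ξ.fst - x 4 • ξ.snd⟫ =
    ⟪x 4 • η.fst + quat x * η.snd, ξ.fst⟫ + ⟪star (quat x) * η.fst - x 4 • η.snd, ξ.snd⟫
  simp only [quaternion_inner]
  simp
  ring

theorem cliff_eq_sum (x : EuclideanSpace ℝ (Fin 5)) (ψ : Spinor) :
    cliff x ψ = ∑ a, x a • cliff (EuclideanSpace.single a 1) ψ := by
  apply Spinor.ext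
  · rw [cliff_fst, Fin.sum_univ_five]
    simp only [WithLp.add_fst, WithLp.smul_fst, cliff_fst]
    ext <;> simp <;> ring
  · rw [cliff_snd, Fin.sum_univ_five]
    simp only [WithLp.add_snd, WithLp.smul_snd, cliff_snd]
    ext <;> simp <;> ring

/-- Each c(e_a) is self-adjoint, so skewing ⟨η, c(e_a) c(e_b) ξ⟩ in the spinors produces the
commutator. The outer ½ compensates for summing over ordered pairs. -/
theorem sum_baseForm_mul_curvForm (p : NegSpinorBundle)
    (u v w z : TangentSpace 𝓘(ℝ, Model) p) :
    (1 / 2 : ℝ) * ∑ a, ∑ b, baseForm a b p ![u, v] * curvForm a b p ![w, z] =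
      cliffCurv (dBase p u) (dBase p v) (vert p w) (vert p z) := by
  have hb : ∀ a b, baseForm a b p ![u, v] =
      dBase p u a * dBase p v b - dBase p v a * dBase p u b := fun _ _ => rfl
  have hc : ∀ a b, curvForm a b p ![w, z] = (1 / 2 : ℝ) *
      (⟪vert p w, cliff (EuclideanSpace.single a 1) (cliff (EuclideanSpace.single b 1) (vert p z))⟫ -
      ⟪vert p z, cliff (EuclideanSpace.single a 1)
        (cliff (EuclideanSpace.single b 1) (vert p w))⟫) := fun _ _ => rfl
  simp only [hb, hc]
  generalize dBase p u = X
  generalize dBase p v = Y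
  generalize vert p w = η
  generalize vert p z = ξ
  have hcc : ∀ (X Y : EuclideanSpace ℝ (Fin 5)) (η ξ : Spinor), ⟪η, cliff X (cliff Y ξ)⟫ =
      ∑ a, ∑ b, X a * Y b * ⟪η, cliff (EuclideanSpace.single a 1)
        (cliff (EuclideanSpace.single b 1) ξ)⟫ := fun X Y η ξ => by
    rw [cliff_eq_sum X, inner_sum]
    refine Finset.sum_congr rfl fun a _ => ?_
    rw [cliff_eq_sum Y, map_sum, inner_smul_right, inner_sum, Finset.mul_sum]
    refine Finset.sum_congr rfl fun b _ => ?_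
    rw [map_smul, inner_smul_right]
    ring
  have h1 : ⟪η, cliff X (cliff Y ξ)⟫ = ⟪ξ, cliff Y (cliff X η)⟫ := by
    rw [inner_cliff, inner_cliff, real_inner_comm]
  have h2 : ⟪η, cliff Y (cliff X ξ)⟫ = ⟪ξ, cliff X (cliff Y η)⟫ := by
    rw [inner_cliff, inner_cliff, real_inner_comm]
  have h3 : cliffCurv X Y η ξ = (1 / 4 : ℝ) *
      (⟪η, cliff X (cliff Y ξ)⟫ - ⟪η, cliff Y (cliff X ξ)⟫ - ⟪ξ, cliff X (cliff Y η)⟫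
        + ⟪ξ, cliff Y (cliff X η)⟫) := by
    rw [cliffCurv, inner_sub_right, ← h1, ← h2]
    ring
  rw [h3, hcc X Y η ξ, hcc Y X η ξ, hcc X Y ξ η, hcc Y X ξ η]
  simp only [← Finset.sum_sub_distrib, ← Finset.sum_add_distrib, Finset.mul_sum]
  refine Finset.sum_congr rfl fun a _ => Finset.sum_congr rfl fun b _ => ?_
  ring

theorem betaForm_apply (p : NegSpinorBundle) (v : Fin 4 → TangentSpace 𝓘(ℝ, Model) p) :
    betaForm p v =
      cliffCurv (dBase p (v 0)) (dBase p (v 1)) (vert p (v 2)) (vert p (v 3))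
      - cliffCurv (dBase p (v 0)) (dBase p (v 2)) (vert p (v 1)) (vert p (v 3))
      + cliffCurv (dBase p (v 0)) (dBase p (v 3)) (vert p (v 1)) (vert p (v 2))
      + cliffCurv (dBase p (v 1)) (dBase p (v 2)) (vert p (v 0)) (vert p (v 3))
      - cliffCurv (dBase p (v 1)) (dBase p (v 3)) (vert p (v 0)) (vert p (v 2))
      + cliffCurv (dBase p (v 2)) (dBase p (v 3)) (vert p (v 0)) (vert p (v 1)) := by
  simp only [← sum_baseForm_mul_curvForm]
  have h : betaForm p v = (1 / 2 : ℝ) * ∑ a, ∑ b, wedge (baseForm a b p) (curvForm a b p) v := by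
    have hs : ∀ f : Fin 5 → (TangentSpace 𝓘(ℝ, Model) p) [⋀^Fin 4]→ₗ[ℝ] ℝ,
        (∑ a, f a) v = ∑ a, f a v := fun f => by
      simp only [Fin.sum_univ_five, AlternatingMap.add_apply]
    change (1 / 2 : ℝ) * (∑ a, ∑ b, wedge (baseForm a b p) (curvForm a b p)) v = _
    simp only [hs]
  rw [h]
  simp only [wedge_two_two, Finset.sum_add_distrib, Finset.sum_sub_distrib]
  ring

end NegSpinorBundle

/-! ### Tensors in the charts of a manifold -/

theorem contMDiff_of_extChartAt_symm {E : Type*} [NormedAddCommGroup E]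
    [NormedSpace ℝ E] {M : Type*} [TopologicalSpace M] [ChartedSpace E M] {F : Type*}
    [NormedAddCommGroup F] [NormedSpace ℝ F] {f : M → F} (hf : Continuous f)
    (h : ∀ x, ContDiffOn ℝ ∞ (f ∘ (extChartAt 𝓘(ℝ, E) x).symm) (extChartAt 𝓘(ℝ, E) x).target) :
    ContMDiff 𝓘(ℝ, E) 𝓘(ℝ, F) ∞ f := by
  intro x
  rw [contMDiffAt_iff]
  refine ⟨hf.continuousAt, ?_⟩
  have := (h x).contDiffAt ((isOpen_extChartAt_target x).mem_nhds (mem_extChartAt_target x))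
  exact this.contDiffWithinAt

section Charts

variable {E : Type*} [NormedAddCommGroup E] [NormedSpace ℝ E]
  {M : Type*} [TopologicalSpace M] [ChartedSpace E M] [IsManifold 𝓘(ℝ, E) ∞ M]
  {F : Type*} [NormedAddCommGroup F] [NormedSpace ℝ F]

/-- `TangentSpace` at x is the model space seen through the preferred chart at x. This makes
pointwise statements special cases of coordinate formulas. -/
theorem mfderiv_extChartAt_symm_self (x : M) :
    mfderiv 𝓘(ℝ, E) 𝓘(ℝ, E) (extChartAt 𝓘(ℝ, E) x).symm (extChartAt 𝓘(ℝ, E) x x) =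
      ContinuousLinearMap.id ℝ E := by
  have : IsManifold 𝓘(ℝ, E) 1 M := IsManifold.of_le (n := ∞) (by simp)
  have h := mfderivWithin_range_extChartAt_symm (I := 𝓘(ℝ, E)) (x := x)
  rw [modelWithCornersSelf_coe, Set.range_id, mfderivWithin_univ] at h
  exact h

theorem coordBilin_self (h : BilinField E M) (x : M) (v w : E) :
    coordBilin h x (extChartAt 𝓘(ℝ, E) x x) v w = h x v w := by
  unfold coordBilin
  rw [mfderiv_extChartAt_symm_self]
  have : ∀ q : M, q = x → h q v w = h x v w := by rintro _ rfl; rfl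
  exact this _ (extChartAt_to_inv x)

theorem coordForm_self {k : ℕ} (α : FormField E M k) (x : M) (v : Fin k → E) :
    coordForm α x (extChartAt 𝓘(ℝ, E) x x) v = α x v := by
  unfold coordForm
  rw [mfderiv_extChartAt_symm_self]
  have : ∀ q : M, q = x → α q v = α x v := by rintro _ rfl; rfl
  exact this _ (extChartAt_to_inv x)

theorem mdifferentiableAt_extChartAt_symm (x : M) {y : E} (hy : y ∈ (extChartAt 𝓘(ℝ, E) x).target) :
    MDifferentiableAt 𝓘(ℝ, E) 𝓘(ℝ, E) (extChartAt 𝓘(ℝ, E) x).symm y :=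
  ((contMDiffOn_extChartAt_symm (n := ∞) x).contMDiffAt
    ((isOpen_extChartAt_target x).mem_nhds hy)).mdifferentiableAt (by simp)

theorem mvfderiv_comp_extChartAt_symm {f : M → F} (x : M) {y : E}
    (hy : y ∈ (extChartAt 𝓘(ℝ, E) x).target)
    (hf : MDifferentiableAt 𝓘(ℝ, E) 𝓘(ℝ, F) f ((extChartAt 𝓘(ℝ, E) x).symm y)) (v : E) :
    mvfderiv 𝓘(ℝ, E) f ((extChartAt 𝓘(ℝ, E) x).symm y)
      (mfderiv 𝓘(ℝ, E) 𝓘(ℝ, E) (extChartAt 𝓘(ℝ, E) x).symm y v) =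
      fderiv ℝ (f ∘ (extChartAt 𝓘(ℝ, E) x).symm) y v := by
  rw [← mfderiv_eq_fderiv]
  exact (mfderiv_comp_apply y hf (mdifferentiableAt_extChartAt_symm x hy) v).symm

end Charts

/-! ### The charts of the bundle, related by spin isometries. -/

namespace NegSpinorBundle

/-- The pair is the identity for the first chart and the flip for the second. Later computations use
only `IsSpinIsometry` and so treat both charts at once. -/
theorem exists_isSpinIsometry_chart (p : NegSpinorBundle) : ∃ L S, IsSpinIsometry L S ∧
    ∀ y : Model, (proj ((extChartAt 𝓘(ℝ, Model) p).symm y) : EuclideanSpace ℝ (Fin 5)) =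
        L (stereoInv y.1) ∧
      spinor ((extChartAt 𝓘(ℝ, Model) p).symm y) = S (negSpin y.1 y.2) := by
  classical
  by_cases h : (proj p : EuclideanSpace ℝ (Fin 5)) 4 ≠ -1
  · have hc : ∀ y : Model, (extChartAt 𝓘(ℝ, Model) p).symm y = chartInv y := fun y => by
      change (if (proj p : EuclideanSpace ℝ (Fin 5)) 4 ≠ -1 then chart₁ else chart₂).symm y = _
      rw [if_pos h]
      rfl
    exact ⟨_, _, isSpinIsometry_id, fun y => by rw [hc]; exact ⟨rfl, rfl⟩⟩
  · have hc : ∀ y : Model, (extChartAt 𝓘(ℝ, Model) p).symm y = flip (chartInv y) := fun y => by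
      change (if (proj p : EuclideanSpace ℝ (Fin 5)) 4 ≠ -1 then chart₁ else chart₂).symm y = _
      rw [if_neg h]
      rfl
    exact ⟨_, _, isSpinIsometry_flip, fun y => by rw [hc]; exact ⟨rfl, rfl⟩⟩

theorem extChartAt_target_eq (p : NegSpinorBundle) :
    (extChartAt 𝓘(ℝ, Model) p).target = Set.univ := by
  have h1 : chart₁.target = Set.univ := rfl
  have h2 : chart₂.target = Set.univ := by
    simp [chart₂, h1]
  have h : (chartAt Model p).target = Set.univ := by
    change (if (proj p : EuclideanSpace ℝ (Fin 5)) 4 ≠ -1 then chart₁ else chart₂).target = _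
    split_ifs
    exacts [h1, h2]
  rw [extChartAt_target, h]
  simp

theorem stereoInv_contDiff : ContDiff ℝ ∞ stereoInv := by
  have h2 : stereoInv = fun q => (1 + ‖q‖ ^ 2)⁻¹ • (((2 : ℝ) • quatVec) q + (2 : ℝ) • northPole)
      - northPole := by
    funext q; exact stereoInv_eq q
  rw [h2]
  refine ContDiff.sub (ContDiff.smul (ContDiff.inv ?_ fun q => (one_add_norm_pos q).ne') ?_)
    contDiff_const
  · exact contDiff_const.add (contDiff_id.norm_sq ℝ)
  · exact ((2 : ℝ) • quatVec).contDiff.add contDiff_const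

theorem hasFDerivAt_negSpin (z v : Model) : ∃ D : Model →L[ℝ] Spinor, D v = spinD z v ∧
    HasFDerivAt (fun y : Model => negSpin y.1 y.2) D z := by
  have h1 : HasFDerivAt (fun y : Model => y.1 * y.2) _ z :=
    (hasFDerivAt_fst (𝕜 := ℝ) (p := z)).mul' (hasFDerivAt_snd (𝕜 := ℝ) (p := z))
  have h2 := (h1.neg).prodMk (hasFDerivAt_snd (𝕜 := ℝ) (p := z))
  have h3 := (WithLp.prodContinuousLinearEquiv 2 ℝ ℍ[ℝ] ℍ[ℝ]).symm.hasFDerivAt.comp z h2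
  refine ⟨_, ?_, h3⟩
  apply Spinor.ext
  · change -(z.1 * v.2 + v.1 * z.2) = -(v.1 * z.2 + z.1 * v.2)
    rw [add_comm]
  · rfl

theorem negSpin_contDiff : ContDiff ℝ ∞ (fun y : Model => negSpin y.1 y.2) := by
  have h : ContDiff ℝ ∞ (fun y : Model => (-(y.1 * y.2), y.2)) := by fun_prop
  exact (WithLp.prodContinuousLinearEquiv 2 ℝ ℍ[ℝ] ℍ[ℝ]).symm.contDiff.comp h

theorem base_contMDiff : ContMDiff 𝓘(ℝ, Model) 𝓘(ℝ, EuclideanSpace ℝ (Fin 5)) ∞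
    (fun p : NegSpinorBundle => (proj p : EuclideanSpace ℝ (Fin 5))) := by
  refine contMDiff_of_extChartAt_symm (continuous_subtype_val.comp continuous_proj) fun p => ?_
  obtain ⟨L, S, -, h⟩ := exists_isSpinIsometry_chart p
  have : (fun p : NegSpinorBundle => (proj p : EuclideanSpace ℝ (Fin 5))) ∘
      (extChartAt 𝓘(ℝ, Model) p).symm = fun y => L.toContinuousLinearMap (stereoInv y.1) :=
    funext fun y => (h y).1
  rw [this]
  exact (L.toContinuousLinearMap.contDiff.comp (stereoInv_contDiff.comp contDiff_fst)).contDiffOn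

theorem spinor_contMDiff : ContMDiff 𝓘(ℝ, Model) 𝓘(ℝ, Spinor) ∞ spinor := by
  refine contMDiff_of_extChartAt_symm continuous_spinor fun p => ?_
  obtain ⟨L, S, -, h⟩ := exists_isSpinIsometry_chart p
  have : spinor ∘ (extChartAt 𝓘(ℝ, Model) p).symm =
      fun y => S.toContinuousLinearMap (negSpin y.1 y.2) := funext fun y => (h y).2
  rw [this]
  exact (S.toContinuousLinearMap.contDiff.comp negSpin_contDiff).contDiffOn

instance finrank_fact : Fact (Module.finrank ℝ (EuclideanSpace ℝ (Fin 5)) = 4 + 1) := ⟨by simp⟩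

theorem proj_contMDiff : ContMDiff 𝓘(ℝ, Model) (𝓡 4) ∞ proj :=
  ContMDiff.codRestrict_sphere base_contMDiff fun p => (proj p).2

theorem dBase_eq (p : NegSpinorBundle) (v : TangentSpace 𝓘(ℝ, Model) p) : dBase p v =
    mvfderiv 𝓘(ℝ, Model) (fun p : NegSpinorBundle => (proj p : EuclideanSpace ℝ (Fin 5))) p v := by
  have h := mfderiv_comp_apply (g := ((↑) : S4 → EuclideanSpace ℝ (Fin 5))) p
    ((contMDiff_coe_sphere (m := ∞) (n := 4)).mdifferentiableAt (by simp))
    (proj_contMDiff.mdifferentiableAt (by simp)) v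
  exact h.symm

/-- The vector with coordinates `v` at the point with coordinates `y` in the preferred chart at
`p`. -/
def coordVec (p : NegSpinorBundle) (y v : Model) :
    TangentSpace 𝓘(ℝ, Model) ((extChartAt 𝓘(ℝ, Model) p).symm y) :=
  mfderiv 𝓘(ℝ, Model) 𝓘(ℝ, Model) (extChartAt 𝓘(ℝ, Model) p).symm y v

/-- Because `S` intertwines Clifford multiplication at the two base points, the projection onto
negative spinors passes through `S`, and the covariant derivative has one formula for both charts.
-/
theorem exists_chart (p : NegSpinorBundle) : ∃ L S, IsSpinIsometry L S ∧
    ∀ y : Model, (proj ((extChartAt 𝓘(ℝ, Model) p).symm y) : EuclideanSpace ℝ (Fin 5)) =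
        L (stereoInv y.1) ∧
      spinor ((extChartAt 𝓘(ℝ, Model) p).symm y) = S (negSpin y.1 y.2) ∧
      (∀ v, dBase _ (coordVec p y v) = L (stereoD y.1 v.1)) ∧
      (∀ v, vert _ (coordVec p y v) = S (negSpin y.1 (covD y v))) := by
  obtain ⟨L, S, hLS, h⟩ := exists_isSpinIsometry_chart p
  have hy : ∀ y : Model, y ∈ (extChartAt 𝓘(ℝ, Model) p).target := fun y => by
    rw [extChartAt_target_eq]; trivial
  refine ⟨L, S, hLS, fun y => ⟨(h y).1, (h y).2, fun v => ?_, fun v => ?_⟩⟩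
  · rw [dBase_eq]
    refine (mvfderiv_comp_extChartAt_symm p (hy y)
      (base_contMDiff.mdifferentiableAt (by simp)) v).trans ?_
    have : (fun p : NegSpinorBundle => (proj p : EuclideanSpace ℝ (Fin 5))) ∘
        (extChartAt 𝓘(ℝ, Model) p).symm = fun y => L.toContinuousLinearMap (stereoInv y.1) :=
      funext fun y => (h y).1
    rw [this]
    have h1 := (L.toContinuousLinearMap.hasFDerivAt (x := stereoInv y.1)).comp y
      ((hasFDerivAt_stereoInv y.1).comp y (hasFDerivAt_fst (𝕜 := ℝ) (p := y)))
    exact congrArg (fun T : Model →L[ℝ] _ => T v) h1.fderiv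
  · have hs : dSpinor _ (coordVec p y v) = S (spinD y v) := by
      refine (mvfderiv_comp_extChartAt_symm p (hy y)
        (spinor_contMDiff.mdifferentiableAt (by simp)) v).trans ?_
      have : spinor ∘ (extChartAt 𝓘(ℝ, Model) p).symm =
        fun y => S.toContinuousLinearMap (negSpin y.1 y.2) := funext fun y => (h y).2
      rw [this]
      obtain ⟨D, hD, hD'⟩ := hasFDerivAt_negSpin y v
      have h1 := (S.toContinuousLinearMap.hasFDerivAt (x := negSpin y.1 y.2)).comp y hD'
      rw [← hD]
      exact congrArg (fun T : Model →L[ℝ] _ => T v) h1.fderiv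
    change (1 / 2 : ℝ) • (dSpinor _ (coordVec p y v) - cliff (proj _ : EuclideanSpace ℝ (Fin 5))
      (dSpinor _ (coordVec p y v))) = _
    rw [hs, (h y).1, hLS.map_cliff, ← map_sub, ← map_smul, proj_spinD]

end NegSpinorBundle

namespace NegSpinorBundle

/-! ### The Bryant–Salamon structure in coordinates -/

/-- `c₀ + c₁ r²`. -/
def bsR (c₀ c₁ : ℝ) (z : Model) : ℝ := c₀ + c₁ * ((1 + ‖z.1‖ ^ 2) * ‖z.2‖ ^ 2)

/-- The coefficient `w²`. -/
def coordW2 (c₀ c₁ : ℝ) (z : Model) : ℝ := 5 * bsR c₀ c₁ z ^ (3 / 5 : ℝ)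

/-- The coefficient `v²`. -/
def coordV2 (c₀ c₁ : ℝ) (z : Model) : ℝ := 4 * c₁ * bsR c₀ c₁ z ^ (-(2 / 5) : ℝ)

theorem bsR_pos {c₀ c₁ : ℝ} (hc₀ : 0 < c₀) (hc₁ : 0 < c₁) (z : Model) : 0 < bsR c₀ c₁ z := by
  unfold bsR
  positivity

theorem coordW2_pos {c₀ c₁ : ℝ} (hc₀ : 0 < c₀) (hc₁ : 0 < c₁) (z : Model) :
    0 < coordW2 c₀ c₁ z := by
  have := Real.rpow_pos_of_pos (bsR_pos hc₀ hc₁ z) (3 / 5)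
  unfold coordW2
  positivity

theorem coordV2_pos {c₀ c₁ : ℝ} (hc₀ : 0 < c₀) (hc₁ : 0 < c₁) (z : Model) :
    0 < coordV2 c₀ c₁ z := by
  have := Real.rpow_pos_of_pos (bsR_pos hc₀ hc₁ z) (-(2 / 5))
  unfold coordV2
  positivity

theorem norm_spinor_sq (p : NegSpinorBundle) (y : Model) :
    ‖spinor ((extChartAt 𝓘(ℝ, Model) p).symm y)‖ ^ 2 = (1 + ‖y.1‖ ^ 2) * ‖y.2‖ ^ 2 := by
  obtain ⟨L, S, hLS, h⟩ := exists_chart p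
  rw [(h y).2.1, ← real_inner_self_eq_norm_sq, hLS.inner_spinor, inner_negSpin,
    real_inner_self_eq_norm_sq]

theorem bsW_sq {c₀ c₁ : ℝ} (hc₀ : 0 < c₀) (hc₁ : 0 < c₁) (p : NegSpinorBundle) (y : Model) :
    bsW c₀ c₁ ((extChartAt 𝓘(ℝ, Model) p).symm y) ^ 2 = coordW2 c₀ c₁ y := by
  unfold bsW
  rw [norm_spinor_sq, Real.sq_sqrt]
  · rfl
  · exact (coordW2_pos hc₀ hc₁ y).le

theorem bsV_sq {c₀ c₁ : ℝ} (hc₀ : 0 < c₀) (hc₁ : 0 < c₁) (p : NegSpinorBundle) (y : Model) :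
    bsV c₀ c₁ ((extChartAt 𝓘(ℝ, Model) p).symm y) ^ 2 = coordV2 c₀ c₁ y := by
  unfold bsV
  rw [norm_spinor_sq, Real.sq_sqrt]
  · rfl
  · exact (coordV2_pos hc₀ hc₁ y).le

theorem bsW_pos {c₀ c₁ : ℝ} (hc₀ : 0 < c₀) (hc₁ : 0 < c₁) (p : NegSpinorBundle) :
    0 < bsW c₀ c₁ p := by
  have h := Real.rpow_pos_of_pos (show 0 < c₀ + c₁ * ‖spinor p‖ ^ 2 by positivity) (3 / 5)
  exact Real.sqrt_pos.2 (by positivity)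

theorem pullbackBilin_coordVec (p : NegSpinorBundle) (y v w : Model) :
    pullbackBilin (E := Model) proj roundMetric _ (coordVec p y v) (coordVec p y w) =
      4 * ((1 + ‖y.1‖ ^ 2) ^ 2)⁻¹ * ⟪v.1, w.1⟫ := by
  obtain ⟨L, S, hLS, h⟩ := exists_chart p
  change ⟪dBase _ (coordVec p y v), dBase _ (coordVec p y w)⟫ = _
  rw [(h y).2.2.1, (h y).2.2.1, hLS.inner_base, inner_stereoD]

theorem fibreMetric_coordVec (p : NegSpinorBundle) (y v w : Model) :
    fibreMetric _ (coordVec p y v) (coordVec p y w) =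
      (1 + ‖y.1‖ ^ 2) * ⟪covD y v, covD y w⟫ := by
  obtain ⟨L, S, hLS, h⟩ := exists_chart p
  change ⟪vert _ (coordVec p y v), vert _ (coordVec p y w)⟫ = _
  rw [(h y).2.2.2, (h y).2.2.2, hLS.inner_spinor, inner_negSpin]

theorem pullbackForm_sphereVol (p : NegSpinorBundle)
    (v : Fin 4 → TangentSpace 𝓘(ℝ, Model) p) :
    pullbackForm (E := Model) proj sphereVol p v = (EuclideanSpace.basisFun (Fin 5) ℝ).toBasis.det
      (Matrix.vecCons (proj p : EuclideanSpace ℝ (Fin 5)) fun i => dBase p (v i)) := by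
  unfold pullbackForm sphereVol
  rw [AlternatingMap.compLinearMap_apply, AlternatingMap.compLinearMap_apply,
    AlternatingMap.curryLeft_apply_apply]
  rfl

theorem pullbackForm_coordVec (p : NegSpinorBundle) (y : Model) (v : Fin 4 → Model) :
    pullbackForm (E := Model) proj sphereVol _ (fun i => coordVec p y (v i)) =
      16 * ((1 + ‖y.1‖ ^ 2) ^ 4)⁻¹ * qvol (v 0).1 (v 1).1 (v 2).1 (v 3).1 := by
  obtain ⟨L, S, hLS, h⟩ := exists_chart p
  have h1 : pullbackForm (E := Model) proj sphereVol _ (fun i => coordVec p y (v i)) =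
      (EuclideanSpace.basisFun (Fin 5) ℝ).toBasis.det
        (Matrix.vecCons (proj ((extChartAt 𝓘(ℝ, Model) p).symm y) : EuclideanSpace ℝ (Fin 5))
          fun i => dBase _ (coordVec p y (v i))) := pullbackForm_sphereVol _ _
  have h2 : Matrix.vecCons (proj ((extChartAt 𝓘(ℝ, Model) p).symm y) : EuclideanSpace ℝ (Fin 5))
      (fun i => dBase _ (coordVec p y (v i))) =
      L ∘ Matrix.vecCons (stereoInv y.1) fun i => stereoD y.1 (v i).1 := by
    funext i
    refine Fin.cases ?_ (fun i => ?_) i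
    · exact (h y).1
    · exact (h y).2.2.1 _
  rw [h1, h2, hLS.det_comp]
  exact det_stereo y.1 fun i => (v i).1

theorem fibreVol_coordVec (p : NegSpinorBundle) (y : Model) (v : Fin 4 → Model) :
    fibreVol _ (fun i => coordVec p y (v i)) = -(1 + ‖y.1‖ ^ 2) ^ 2 *
      qvol (covD y (v 0)) (covD y (v 1)) (covD y (v 2)) (covD y (v 3)) := by
  obtain ⟨L, S, hLS, h⟩ := exists_chart p
  change spinVol (fun i => vert _ (coordVec p y (v i))) = _
  simp only [(h y).2.2.2]
  rw [hLS.spinVol_comp fun i => negSpin y.1 (covD y (v i))]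
  exact spinVol_negSpin y.1 fun i => covD y (v i)

/-- The base component and the covariant derivative of a vector. -/
def split (y v : Model) : Model := (v.1, covD y v)

theorem betaForm_coordVec (p : NegSpinorBundle) (y : Model) (v : Fin 4 → Model) :
    betaForm _ (fun i => coordVec p y (v i)) = 4 * (1 + ‖y.1‖ ^ 2)⁻¹ *
      qmixed (split y (v 0)) (split y (v 1)) (split y (v 2)) (split y (v 3)) := by
  obtain ⟨L, S, hLS, h⟩ := exists_chart p
  rw [betaForm_apply]
  simp only [(h y).2.2.1, (h y).2.2.2, hLS.cliffCurv_comp, cliffCurv_stereoD, qmixed, split]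
  ring

theorem coordBilin_bsMetric {c₀ c₁ : ℝ} (hc₀ : 0 < c₀) (hc₁ : 0 < c₁) (p : NegSpinorBundle)
    (y v w : Model) : coordBilin (bsMetric c₀ c₁) p y v w =
      coordW2 c₀ c₁ y * (4 * ((1 + ‖y.1‖ ^ 2) ^ 2)⁻¹) * ⟪v.1, w.1⟫
      + coordV2 c₀ c₁ y * (1 + ‖y.1‖ ^ 2) * ⟪covD y v, covD y w⟫ := by
  have h : coordBilin (bsMetric c₀ c₁) p y v w =
    bsW c₀ c₁ ((extChartAt 𝓘(ℝ, Model) p).symm y) ^ 2 *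
      pullbackBilin (E := Model) proj roundMetric _ (coordVec p y v) (coordVec p y w)
    + bsV c₀ c₁ ((extChartAt 𝓘(ℝ, Model) p).symm y) ^ 2 *
      fibreMetric _ (coordVec p y v) (coordVec p y w) := rfl
  rw [h, bsW_sq hc₀ hc₁, bsV_sq hc₀ hc₁, pullbackBilin_coordVec, fibreMetric_coordVec]
  ring

theorem coordForm_bsForm {c₀ c₁ : ℝ} (hc₀ : 0 < c₀) (hc₁ : 0 < c₁) (p : NegSpinorBundle)
    (y : Model) (v : Fin 4 → Model) : coordForm (bsForm c₀ c₁) p y v =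
      coordW2 c₀ c₁ y ^ 2 * (16 * ((1 + ‖y.1‖ ^ 2) ^ 4)⁻¹) *
        qvol (v 0).1 (v 1).1 (v 2).1 (v 3).1
      + coordW2 c₀ c₁ y * coordV2 c₀ c₁ y * (4 * (1 + ‖y.1‖ ^ 2)⁻¹) *
        qmixed (split y (v 0)) (split y (v 1)) (split y (v 2)) (split y (v 3))
      - coordV2 c₀ c₁ y ^ 2 * (1 + ‖y.1‖ ^ 2) ^ 2 *
        qvol (covD y (v 0)) (covD y (v 1)) (covD y (v 2)) (covD y (v 3)) := by
  have h : coordForm (bsForm c₀ c₁) p y v =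
    bsW c₀ c₁ ((extChartAt 𝓘(ℝ, Model) p).symm y) ^ 4 *
      pullbackForm (E := Model) proj sphereVol _ (fun i => coordVec p y (v i))
    + bsW c₀ c₁ ((extChartAt 𝓘(ℝ, Model) p).symm y) ^ 2 *
      bsV c₀ c₁ ((extChartAt 𝓘(ℝ, Model) p).symm y) ^ 2 *
        betaForm _ (fun i => coordVec p y (v i))
    + bsV c₀ c₁ ((extChartAt 𝓘(ℝ, Model) p).symm y) ^ 4 *
      fibreVol _ (fun i => coordVec p y (v i)) := rfl
  have hw : bsW c₀ c₁ ((extChartAt 𝓘(ℝ, Model) p).symm y) ^ 4 = coordW2 c₀ c₁ y ^ 2 := by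
    rw [← bsW_sq hc₀ hc₁ p y]; ring
  have hv : bsV c₀ c₁ ((extChartAt 𝓘(ℝ, Model) p).symm y) ^ 4 = coordV2 c₀ c₁ y ^ 2 := by
    rw [← bsV_sq hc₀ hc₁ p y]; ring
  rw [h, hw, hv, bsW_sq hc₀ hc₁, bsV_sq hc₀ hc₁,
    pullbackForm_coordVec, betaForm_coordVec, fibreVol_coordVec]
  ring

/-- The tangent frame map, an isometry from the metric with coefficients `α², β²` to `ℍ ⊕ ℍ`. -/
def frameEquiv (α β : ℝ) (hα : α ≠ 0) (hβ : β ≠ 0) (z : Model) : Model ≃ₗ[ℝ] Model where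
  toFun v := (α • v.1, β • covD z v)
  map_add' u v := by simp
  map_smul' c v := by simp [smul_comm c]
  invFun u := (α⁻¹ • u.1, β⁻¹ • u.2 - (1 + ‖z.1‖ ^ 2)⁻¹ • (star z.1 * (α⁻¹ • u.1) * z.2))
  left_inv v := by
    simp [covD_apply, smul_smul, hα, hβ]
  right_inv u := by
    simp [covD_apply, smul_smul, hα, hβ]

/-- `qcoord` as a linear equivalence. -/
def qcoordEquiv : Model ≃ₗ[ℝ] (Fin 8 → ℝ) where
  toFun := qcoord
  map_add' u v := by
    ext i; fin_cases i <;> simp [qcoord] <;> ring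
  map_smul' c v := by
    ext i; fin_cases i <;> simp [qcoord]
  invFun t := (⟨t 4, t 5, t 6, t 7⟩, ⟨t 0, -t 1, -t 2, -t 3⟩)
  left_inv v := by
    simp [qcoord]
    rfl
  right_inv t := by
    ext i; fin_cases i <;> simp [qcoord]

theorem qdot_eq_sum (u v : Model) : qdot u v = ∑ i, qcoord u i * qcoord v i := by
  simp [qdot, quaternion_inner, qcoord, Fin.sum_univ_succ]
  ring

/-- The adapted basis of a tangent space. -/
def frameBasis (α β : ℝ) (hα : α ≠ 0) (hβ : β ≠ 0) (z : Model) : Module.Basis (Fin 8) ℝ Model :=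
  Module.Basis.ofEquivFun ((frameEquiv α β hα hβ z).trans qcoordEquiv)

theorem frameBasis_repr (α β : ℝ) (hα : α ≠ 0) (hβ : β ≠ 0) (z v : Model) (j : Fin 8) :
    (frameBasis α β hα hβ z).repr v j = qcoord (frameEquiv α β hα hβ z v) j := rfl

theorem qdot_frameBasis (α β : ℝ) (hα : α ≠ 0) (hβ : β ≠ 0) (z : Model) (i j : Fin 8) :
    qdot (frameEquiv α β hα hβ z (frameBasis α β hα hβ z i))
      (frameEquiv α β hα hβ z (frameBasis α β hα hβ z j)) = if i = j then 1 else 0 := by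
  rw [qdot_eq_sum]
  simp only [← frameBasis_repr, Module.Basis.repr_self, Finsupp.single_apply]
  simp

end NegSpinorBundle

/-! ### Determinants, scaling and smoothness of the model forms. -/

theorem abs_det_eq_one {ι V : Type*} [Fintype ι] [DecidableEq ι] [AddCommGroup V] [Module ℝ V]
    (b : Module.Basis ι ℝ V) (e : ι → V)
    (h : ∀ i j, ∑ k, b.repr (e i) k * b.repr (e j) k = if i = j then 1 else 0) :
    |b.det e| = 1 := by
  have h1 : (b.toMatrix e).transpose * b.toMatrix e = 1 := by
    ext i j
    simp only [Matrix.mul_apply, Matrix.transpose_apply, Module.Basis.toMatrix_apply, h,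
      Matrix.one_apply]
  have h2 := congrArg Matrix.det h1
  rw [Matrix.det_mul, Matrix.det_transpose, Matrix.det_one, ← Module.Basis.det_apply] at h2
  rw [← sq_eq_sq₀ (abs_nonneg _) zero_le_one, sq_abs, sq, h2, one_pow]

theorem qbasis_det_apply (v : Fin 4 → ℍ[ℝ]) : qbasis.det v = qvol (v 0) (v 1) (v 2) (v 3) := by
  rw [alternating_eq_qvol qbasis.det v, Module.Basis.det_self, one_mul]

theorem abs_qvol_eq_one (v : Fin 4 → ℍ[ℝ]) (h : ∀ i j, ⟪v i, v j⟫ = if i = j then (1 : ℝ) else 0) :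
    |qvol (v 0) (v 1) (v 2) (v 3)| = 1 := by
  rw [← qbasis_det_apply]
  refine abs_det_eq_one _ _ fun i j => ?_
  rw [← h, quaternion_inner, qbasis_repr, qbasis_repr]
  simp [Fin.sum_univ_four]

/-- The three constituents are homogeneous of bidegrees (4,0), (2,2) and (0,4). -/
theorem qcayley_smul (α β : ℝ) (u v w z : ℍ[ℝ] × ℍ[ℝ]) :
    qcayley (α • u.1, β • u.2) (α • v.1, β • v.2) (α • w.1, β • w.2) (α • z.1, β • z.2) =
      α ^ 4 * qvol u.1 v.1 w.1 z.1 + α ^ 2 * β ^ 2 * qmixed u v w z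
        - β ^ 4 * qvol u.2 v.2 w.2 z.2 := by
  simp only [qcayley, qmixed, qvol, qcurv, inner_smul_left, inner_smul_right, Quaternion.star_smul,
    smul_mul_assoc, mul_smul_comm, ← smul_sub, RCLike.conj_to_real, smul_smul]
  ring

/-- Quaternionic conjugation as a continuous linear map. -/
def quatStar : ℍ[ℝ] →L[ℝ] ℍ[ℝ] :=
  LinearMap.toContinuousLinearMap
  { toFun := star
    map_add' := star_add
    map_smul' := Quaternion.star_smul }

theorem _root_.ContDiff.qvol {E : Type*} [NormedAddCommGroup E] [NormedSpace ℝ E]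
    {a b c d : E → ℍ[ℝ]} (ha : ContDiff ℝ ∞ a) (hb : ContDiff ℝ ∞ b) (hc : ContDiff ℝ ∞ c)
    (hd : ContDiff ℝ ∞ d) : ContDiff ℝ ∞ fun x => qvol (a x) (b x) (c x) (d x) := by
  have hc' : ContDiff ℝ ∞ fun x => star (c x) := quatStar.contDiff.comp hc
  have h1 := (ha.inner ℝ ((hb.mul hc').mul hd))
  exact ((h1.sub ((hb.inner ℝ hc).mul (ha.inner ℝ hd))).add
    ((hb.inner ℝ hd).mul (ha.inner ℝ hc))).sub ((hc.inner ℝ hd).mul (ha.inner ℝ hb))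

theorem _root_.ContDiff.qcurv {E : Type*} [NormedAddCommGroup E] [NormedSpace ℝ E]
    {a b c d : E → ℍ[ℝ]} (ha : ContDiff ℝ ∞ a) (hb : ContDiff ℝ ∞ b) (hc : ContDiff ℝ ∞ c)
    (hd : ContDiff ℝ ∞ d) : ContDiff ℝ ∞ fun x => qcurv (a x) (b x) (c x) (d x) := by
  have ha' : ContDiff ℝ ∞ fun x => star (a x) := quatStar.contDiff.comp ha
  have hb' : ContDiff ℝ ∞ fun x => star (b x) := quatStar.contDiff.comp hb
  exact contDiff_const.mul (hc.inner ℝ (((ha'.mul hb).sub (hb'.mul ha)).mul hd))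

theorem _root_.ContDiff.qcayley {E : Type*} [NormedAddCommGroup E] [NormedSpace ℝ E]
    {u v w z : E → ℍ[ℝ] × ℍ[ℝ]} (hu : ContDiff ℝ ∞ u) (hv : ContDiff ℝ ∞ v) (hw : ContDiff ℝ ∞ w)
    (hz : ContDiff ℝ ∞ z) : ContDiff ℝ ∞ fun x => qcayley (u x) (v x) (w x) (z x) :=
  ((hu.fst.qvol hv.fst hw.fst hz.fst).add
    ((((((hu.fst.qcurv hv.fst hw.snd hz.snd).sub (hu.fst.qcurv hw.fst hv.snd hz.snd)).add
      (hu.fst.qcurv hz.fst hv.snd hw.snd)).add (hv.fst.qcurv hw.fst hu.snd hz.snd)).sub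
      (hv.fst.qcurv hz.fst hu.snd hw.snd)).add (hw.fst.qcurv hz.fst hu.snd hv.snd))).sub
    (hu.snd.qvol hv.snd hw.snd hz.snd)

namespace NegSpinorBundle

/-! ### Orthonormal frames -/

theorem bsR_contDiff (c₀ c₁ : ℝ) : ContDiff ℝ ∞ (bsR c₀ c₁) := by
  have h1 : ContDiff ℝ ∞ fun z : Model => ‖z.1‖ ^ 2 := contDiff_fst.norm_sq ℝ
  have h2 : ContDiff ℝ ∞ fun z : Model => ‖z.2‖ ^ 2 := contDiff_snd.norm_sq ℝ
  exact contDiff_const.add (contDiff_const.mul ((contDiff_const.add h1).mul h2))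

theorem coordW2_contDiff {c₀ c₁ : ℝ} (hc₀ : 0 < c₀) (hc₁ : 0 < c₁) :
    ContDiff ℝ ∞ (coordW2 c₀ c₁) :=
  contDiff_const.mul ((bsR_contDiff c₀ c₁).rpow_const_of_ne fun z => (bsR_pos hc₀ hc₁ z).ne')

theorem coordV2_contDiff {c₀ c₁ : ℝ} (hc₀ : 0 < c₀) (hc₁ : 0 < c₁) :
    ContDiff ℝ ∞ (coordV2 c₀ c₁) :=
  contDiff_const.mul ((bsR_contDiff c₀ c₁).rpow_const_of_ne fun z => (bsR_pos hc₀ hc₁ z).ne')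

/-- The coefficient of the metric on base components. -/
def coordA (c₀ c₁ : ℝ) (z : Model) : ℝ := coordW2 c₀ c₁ z * (4 * ((1 + ‖z.1‖ ^ 2) ^ 2)⁻¹)

/-- The coefficient of the metric on covariant derivatives. -/
def coordB (c₀ c₁ : ℝ) (z : Model) : ℝ := coordV2 c₀ c₁ z * (1 + ‖z.1‖ ^ 2)

variable {c₀ c₁ : ℝ} (hc₀ : 0 < c₀) (hc₁ : 0 < c₁)

theorem coordA_pos {c₀ c₁ : ℝ} (hc₀ : 0 < c₀) (hc₁ : 0 < c₁)
    (z : Model) : 0 < coordA c₀ c₁ z := by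
  have := coordW2_pos hc₀ hc₁ z
  unfold coordA
  positivity

theorem coordB_pos {c₀ c₁ : ℝ} (hc₀ : 0 < c₀) (hc₁ : 0 < c₁)
    (z : Model) : 0 < coordB c₀ c₁ z := by
  have := coordV2_pos hc₀ hc₁ z
  unfold coordB
  positivity

theorem one_add_norm_sq_contDiff : ContDiff ℝ ∞ fun z : Model => 1 + ‖z.1‖ ^ 2 :=
  contDiff_const.add (contDiff_fst.norm_sq ℝ)

theorem coordA_contDiff {c₀ c₁ : ℝ} (hc₀ : 0 < c₀) (hc₁ : 0 < c₁) :
    ContDiff ℝ ∞ (coordA c₀ c₁) :=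
  (coordW2_contDiff hc₀ hc₁).mul (contDiff_const.mul
    ((one_add_norm_sq_contDiff.pow 2).inv fun z => by positivity))

theorem coordB_contDiff {c₀ c₁ : ℝ} (hc₀ : 0 < c₀) (hc₁ : 0 < c₁) :
    ContDiff ℝ ∞ (coordB c₀ c₁) :=
  (coordV2_contDiff hc₀ hc₁).mul one_add_norm_sq_contDiff

theorem covD_contDiff (v : Model) : ContDiff ℝ ∞ fun z : Model => covD z v := by
  have h : ContDiff ℝ ∞ fun z : Model => star z.1 := quatStar.contDiff.comp contDiff_fst
  exact contDiff_const.add ((one_add_norm_sq_contDiff.inv fun z => by positivity).smul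
    ((h.mul contDiff_const).mul contDiff_snd))

/-- The isometry from the Bryant–Salamon metric at a point to the standard metric of `ℍ ⊕ ℍ`. -/
def bsFrame (z : Model) : Model ≃ₗ[ℝ] Model :=
  frameEquiv (√(coordA c₀ c₁ z)) (√(coordB c₀ c₁ z))
    (Real.sqrt_pos.2 (coordA_pos hc₀ hc₁ z)).ne' (Real.sqrt_pos.2 (coordB_pos hc₀ hc₁ z)).ne' z

/-- The adapted orthonormal basis at a point. -/
def bsBasis (z : Model) : Module.Basis (Fin 8) ℝ Model :=
  frameBasis (√(coordA c₀ c₁ z)) (√(coordB c₀ c₁ z))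
    (Real.sqrt_pos.2 (coordA_pos hc₀ hc₁ z)).ne' (Real.sqrt_pos.2 (coordB_pos hc₀ hc₁ z)).ne' z

theorem bsFrame_fst (z v : Model) : (bsFrame hc₀ hc₁ z v).1 = √(coordA c₀ c₁ z) • v.1 := rfl

theorem bsFrame_snd (z v : Model) : (bsFrame hc₀ hc₁ z v).2 = √(coordB c₀ c₁ z) • covD z v := rfl

theorem bsFrame_bsBasis (z : Model) (i : Fin 8) :
    bsFrame hc₀ hc₁ z (bsBasis hc₀ hc₁ z i) = qcoordEquiv.symm (Pi.single i 1) := by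
  rw [bsBasis, frameBasis, Module.Basis.coe_ofEquivFun]
  exact LinearEquiv.apply_symm_apply (bsFrame hc₀ hc₁ z) _

theorem bsFrame_contDiff (v : Model) : ContDiff ℝ ∞ fun z => bsFrame hc₀ hc₁ z v :=
  (((coordA_contDiff hc₀ hc₁).sqrt fun z => (coordA_pos hc₀ hc₁ z).ne').smul contDiff_const).prodMk
    (((coordB_contDiff hc₀ hc₁).sqrt fun z => (coordB_pos hc₀ hc₁ z).ne').smul (covD_contDiff v))

theorem coordBilin_eq_qdot (p : NegSpinorBundle) (y v w : Model) :
    coordBilin (bsMetric c₀ c₁) p y v w = qdot (bsFrame hc₀ hc₁ y v) (bsFrame hc₀ hc₁ y w) := by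
  rw [coordBilin_bsMetric hc₀ hc₁, qdot]
  simp only [bsFrame_fst, bsFrame_snd, inner_smul_left, inner_smul_right, RCLike.conj_to_real]
  simp only [← mul_assoc, Real.mul_self_sqrt (coordA_pos hc₀ hc₁ y).le,
    Real.mul_self_sqrt (coordB_pos hc₀ hc₁ y).le]
  simp only [coordA, coordB]
  ring

/-- With A = 4 w² s⁻² and B = v² s, the coefficients 16 w⁴ s⁻⁴, 4 w² v² s⁻¹ and v⁴ s² are A², AB and
B², the weights that `qcayley_smul` gives to the three bidegrees. -/
theorem coordForm_eq_qcayley (p : NegSpinorBundle) (y : Model) (v : Fin 4 → Model) :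
    coordForm (bsForm c₀ c₁) p y v = qcayley (bsFrame hc₀ hc₁ y (v 0)) (bsFrame hc₀ hc₁ y (v 1))
      (bsFrame hc₀ hc₁ y (v 2)) (bsFrame hc₀ hc₁ y (v 3)) := by
  have h := one_add_norm_pos y.1
  have hA := Real.sq_sqrt (coordA_pos hc₀ hc₁ y).le
  have hB := Real.sq_sqrt (coordB_pos hc₀ hc₁ y).le
  have hA4 : √(coordA c₀ c₁ y) ^ 4 = coordA c₀ c₁ y ^ 2 := by
    rw [show 4 = 2 * 2 from rfl, pow_mul, hA]
  have hB4 : √(coordB c₀ c₁ y) ^ 4 = coordB c₀ c₁ y ^ 2 := by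
    rw [show 4 = 2 * 2 from rfl, pow_mul, hB]
  rw [coordForm_bsForm hc₀ hc₁]
  refine Eq.trans ?_ (qcayley_smul (√(coordA c₀ c₁ y)) (√(coordB c₀ c₁ y)) (split y (v 0))
    (split y (v 1)) (split y (v 2)) (split y (v 3))).symm
  rw [hA4, hB4, hA, hB]
  simp only [coordA, coordB, split]
  field_simp
  ring

/-- The isometry from a tangent space to `ℍ ⊕ ℍ`. -/
def tangentFrame (p : NegSpinorBundle) : TangentSpace 𝓘(ℝ, Model) p ≃ₗ[ℝ] Model :=
  bsFrame hc₀ hc₁ (extChartAt 𝓘(ℝ, Model) p p)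

/-- The adapted orthonormal basis of a tangent space. -/
def tangentBasis (p : NegSpinorBundle) : Module.Basis (Fin 8) ℝ (TangentSpace 𝓘(ℝ, Model) p) :=
  bsBasis hc₀ hc₁ (extChartAt 𝓘(ℝ, Model) p p)

theorem tangentBasis_repr (p : NegSpinorBundle) (v : TangentSpace 𝓘(ℝ, Model) p) (j : Fin 8) :
    (tangentBasis hc₀ hc₁ p).repr v j = qcoord (tangentFrame hc₀ hc₁ p v) j := rfl

theorem tangentFrame_tangentBasis (p : NegSpinorBundle) (i : Fin 8) :
    tangentFrame hc₀ hc₁ p (tangentBasis hc₀ hc₁ p i) = qcoordEquiv.symm (Pi.single i 1) :=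
  bsFrame_bsBasis hc₀ hc₁ _ i

theorem bsMetric_apply (p : NegSpinorBundle) (v w : TangentSpace 𝓘(ℝ, Model) p) :
    bsMetric c₀ c₁ p v w = qdot (tangentFrame hc₀ hc₁ p v) (tangentFrame hc₀ hc₁ p w) :=
  (coordBilin_self (E := Model) _ p v w).symm.trans (coordBilin_eq_qdot hc₀ hc₁ p _ v w)

theorem bsForm_apply (p : NegSpinorBundle) (v : Fin 4 → TangentSpace 𝓘(ℝ, Model) p) :
    bsForm c₀ c₁ p v = qcayley (tangentFrame hc₀ hc₁ p (v 0)) (tangentFrame hc₀ hc₁ p (v 1))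
      (tangentFrame hc₀ hc₁ p (v 2)) (tangentFrame hc₀ hc₁ p (v 3)) :=
  (coordForm_self (E := Model) _ p v).symm.trans (coordForm_eq_qcayley hc₀ hc₁ p _ v)

theorem isOrthonormalFamily_tangentBasis (p : NegSpinorBundle) :
    IsOrthonormalFamily (bsMetric c₀ c₁) p (tangentBasis hc₀ hc₁ p) := fun i j => by
  rw [bsMetric_apply hc₀ hc₁]
  exact qdot_frameBasis _ _ _ _ _ i j

theorem qdot_bsBasis (z : Model) (i j : Fin 8) :
    qdot (bsFrame hc₀ hc₁ z (bsBasis hc₀ hc₁ z i)) (bsFrame hc₀ hc₁ z (bsBasis hc₀ hc₁ z j)) =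
      if i = j then 1 else 0 :=
  qdot_frameBasis _ _ _ _ z i j

theorem qdot_self_pos {u : Model} (hu : u ≠ 0) : 0 < qdot u u := by
  rw [qdot, real_inner_self_eq_norm_sq, real_inner_self_eq_norm_sq]
  rcases Prod.mk_eq_zero.not.1 (show ¬ ((u.1, u.2) : Model) = 0 from hu) |> not_and_or.1 with h | h
  · have := norm_pos_iff.2 h
    positivity
  · have := norm_pos_iff.2 h
    positivity

theorem isRiemannianMetric_bsMetric {c₀ c₁ : ℝ} (hc₀ : 0 < c₀) (hc₁ : 0 < c₁) :
    IsRiemannianMetric (bsMetric c₀ c₁) where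
  symm p v w := by
    rw [bsMetric_apply hc₀ hc₁, bsMetric_apply hc₀ hc₁]
    simp only [qdot, real_inner_comm]
  pos p v hv := by
    rw [bsMetric_apply hc₀ hc₁]
    exact qdot_self_pos fun h => hv ((LinearEquiv.map_eq_zero_iff _).1 h)
  smooth p v w := by
    simp only [coordBilin_eq_qdot hc₀ hc₁]
    have hv := bsFrame_contDiff hc₀ hc₁ v
    have hw := bsFrame_contDiff hc₀ hc₁ w
    exact ((hv.fst.inner ℝ hw.fst).add (hv.snd.inner ℝ hw.snd)).contDiffOn

theorem isSmoothForm_bsForm {c₀ c₁ : ℝ} (hc₀ : 0 < c₀) (hc₁ : 0 < c₁) :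
    IsSmoothForm (bsForm c₀ c₁) := fun p v => by
  simp only [coordForm_eq_qcayley hc₀ hc₁]
  exact ((bsFrame_contDiff hc₀ hc₁ _).qcayley (bsFrame_contDiff hc₀ hc₁ _)
    (bsFrame_contDiff hc₀ hc₁ _) (bsFrame_contDiff hc₀ hc₁ _)).contDiffOn

theorem isCalibration_bsForm {c₀ c₁ : ℝ} (hc₀ : 0 < c₀) (hc₁ : 0 < c₁) :
    IsCalibration (bsMetric c₀ c₁) (bsForm c₀ c₁) where
  smooth := isSmoothForm_bsForm hc₀ hc₁
  comass p e he := by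
    rw [bsForm_apply hc₀ hc₁]
    exact abs_qcayley_le_one (fun i => tangentFrame hc₀ hc₁ p (e i))
      fun i j => by rw [← bsMetric_apply hc₀ hc₁, he]

end NegSpinorBundle

/-! ### Vertical and horizontal vectors, and the volume form in the adapted frame. -/

theorem pullbackForm_eq_zero {E : Type*} [NormedAddCommGroup E] [NormedSpace ℝ E]
    {M : Type*} [TopologicalSpace M] [ChartedSpace E M]
    {F : Type*} [NormedAddCommGroup F] [NormedSpace ℝ F]
    {L : Type*} [TopologicalSpace L] [ChartedSpace F L] {k : ℕ} (u : M → L) (ν : FormField F L k)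
    {x : M} {v : Fin k → TangentSpace 𝓘(ℝ, E) x} {i : Fin k} (h : IsVertical F u x (v i)) :
    pullbackForm u ν x v = 0 := by
  unfold pullbackForm
  rw [AlternatingMap.compLinearMap_apply]
  exact AlternatingMap.map_coord_zero _ i h

/-- The coefficients of a form in a chart, as an alternating form on the model space. -/
def coordAlt {E : Type*} [NormedAddCommGroup E] [NormedSpace ℝ E]
    {M : Type*} [TopologicalSpace M] [ChartedSpace E M] {k : ℕ} (α : FormField E M k) (x : M)
    (y : E) : E [⋀^Fin k]→ₗ[ℝ] ℝ :=
  (α ((extChartAt 𝓘(ℝ, E) x).symm y)).compLinearMap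
    (mfderiv 𝓘(ℝ, E) 𝓘(ℝ, E) (extChartAt 𝓘(ℝ, E) x).symm y).toLinearMap

theorem coordAlt_apply {E : Type*} [NormedAddCommGroup E] [NormedSpace ℝ E]
    {M : Type*} [TopologicalSpace M] [ChartedSpace E M] {k : ℕ} (α : FormField E M k) (x : M)
    (y : E) (v : Fin k → E) : coordAlt α x y v = coordForm α x y v := rfl

namespace NegSpinorBundle

theorem dS4_injective (x : S4) : Function.Injective (dS4 x) :=
  injective_mvfderiv_subtypeVal_sphere x

theorem isVertical_iff_dBase (p : NegSpinorBundle) (v : TangentSpace 𝓘(ℝ, Model) p) :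
    IsVertical (EuclideanSpace ℝ (Fin 4)) proj p v ↔ dBase p v = 0 :=
  ((dS4 (proj p)).map_eq_zero_iff (dS4_injective _)).symm

theorem stereoD_eq_zero_iff (q X : ℍ[ℝ]) : stereoD q X = 0 ↔ X = 0 := by
  have h := one_add_norm_pos q
  rw [← inner_self_eq_zero (𝕜 := ℝ), inner_stereoD, mul_eq_zero, inner_self_eq_zero]
  exact or_iff_right (by positivity)

theorem isVertical_coordVec_iff (p : NegSpinorBundle) (y v : Model) :
    IsVertical (EuclideanSpace ℝ (Fin 4)) proj _ (coordVec p y v) ↔ v.1 = 0 := by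
  obtain ⟨L, S, hLS, h⟩ := exists_chart p
  rw [isVertical_iff_dBase, (h y).2.2.1, ← inner_self_eq_zero (𝕜 := ℝ), hLS.inner_base,
    inner_self_eq_zero, stereoD_eq_zero_iff]

theorem isVertical_iff (p : NegSpinorBundle) (v : TangentSpace 𝓘(ℝ, Model) p) :
    IsVertical (EuclideanSpace ℝ (Fin 4)) proj p v ↔ Prod.fst (α := ℍ[ℝ]) (β := ℍ[ℝ]) v = 0 := by
  have h := isVertical_coordVec_iff p (extChartAt 𝓘(ℝ, Model) p p) v
  unfold coordVec at h
  rw [mfderiv_extChartAt_symm_self] at h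
  -- The inverse chart returns `p` only up to a propositional equality, so the point is generalised
  -- before substituting.
  have key : ∀ q : NegSpinorBundle, q = p →
      (IsVertical (EuclideanSpace ℝ (Fin 4)) proj q (v : Model) ↔
        IsVertical (EuclideanSpace ℝ (Fin 4)) proj p v) := by
    rintro _ rfl; rfl
  exact (key _ (extChartAt_to_inv p)).symm.trans h

variable {c₀ c₁ : ℝ} (hc₀ : 0 < c₀) (hc₁ : 0 < c₁)

theorem isVertical_iff_tangentFrame (p : NegSpinorBundle) (v : TangentSpace 𝓘(ℝ, Model) p) :
    IsVertical (EuclideanSpace ℝ (Fin 4)) proj p v ↔ (tangentFrame hc₀ hc₁ p v).1 = 0 := by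
  rw [isVertical_iff]
  change _ ↔ √(coordA c₀ c₁ _) • Prod.fst (α := ℍ[ℝ]) (β := ℍ[ℝ]) v = 0
  rw [smul_eq_zero]
  exact (or_iff_right (Real.sqrt_pos.2 (coordA_pos hc₀ hc₁ _)).ne').symm

/-- Testing orthogonality against the vertical vector with the same fibre component shows that this
component has norm zero. -/
theorem tangentFrame_snd_eq_zero (p : NegSpinorBundle) (v : TangentSpace 𝓘(ℝ, Model) p)
    (hv : IsHorizontal (EuclideanSpace ℝ (Fin 4)) (bsMetric c₀ c₁) proj p v) :
    (tangentFrame hc₀ hc₁ p v).2 = 0 := by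
  have h := hv ((tangentFrame hc₀ hc₁ p).symm (0, (tangentFrame hc₀ hc₁ p v).2))
  rw [isVertical_iff_tangentFrame hc₀ hc₁, bsMetric_apply hc₀ hc₁,
    LinearEquiv.apply_symm_apply] at h
  simpa [qdot] using h rfl

theorem sqrt_pow_four {a : ℝ} (h : 0 ≤ a) : √a ^ 4 = a ^ 2 := by
  rw [show 4 = 2 * 2 from rfl, pow_mul, Real.sq_sqrt h]

theorem qvol_smul (c : ℝ) (a b d e : ℍ[ℝ]) :
    qvol (c • a) (c • b) (c • d) (c • e) = c ^ 4 * qvol a b d e := by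
  have := qcayley_smul c 0 (a, 0) (b, 0) (d, 0) (e, 0)
  simpa [qcayley, qmixed, qcurv, qvol] using this

theorem qvol_star (a b c d : ℍ[ℝ]) : qvol (star a) (star b) (star c) (star d) = -qvol a b c d := by
  simp only [qvol, quaternion_inner, Quaternion.re_mul, Quaternion.imI_mul, Quaternion.imJ_mul,
    Quaternion.imK_mul, Quaternion.re_star, Quaternion.imI_star, Quaternion.imJ_star,
    Quaternion.imK_star]
  ring

theorem coordForm_pullback (p : NegSpinorBundle) (y : Model) (v : Fin 4 → Model) :
    coordW2 c₀ c₁ y ^ 2 * coordForm (pullbackForm (E := Model) proj sphereVol) p y v =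
      qvol (bsFrame hc₀ hc₁ y (v 0)).1 (bsFrame hc₀ hc₁ y (v 1)).1 (bsFrame hc₀ hc₁ y (v 2)).1
        (bsFrame hc₀ hc₁ y (v 3)).1 := by
  have h : coordForm (pullbackForm (E := Model) proj sphereVol) p y v = _ :=
    pullbackForm_coordVec p y v
  simp only [bsFrame_fst]
  rw [h, qvol_smul, sqrt_pow_four (coordA_pos hc₀ hc₁ y).le, coordA]
  have := one_add_norm_pos y.1
  field_simp
  ring

theorem coordForm_fibreVol (p : NegSpinorBundle) (y : Model) (v : Fin 4 → Model) :
    coordV2 c₀ c₁ y ^ 2 * coordForm fibreVol p y v =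
      -qvol (bsFrame hc₀ hc₁ y (v 0)).2 (bsFrame hc₀ hc₁ y (v 1)).2 (bsFrame hc₀ hc₁ y (v 2)).2
        (bsFrame hc₀ hc₁ y (v 3)).2 := by
  have h : coordForm fibreVol p y v = _ := fibreVol_coordVec p y v
  simp only [bsFrame_snd]
  rw [h, qvol_smul, sqrt_pow_four (coordB_pos hc₀ hc₁ y).le, coordB]
  ring

theorem bsVol_append (c₀ c₁ : ℝ) (p : NegSpinorBundle)
    (e f : Fin 4 → TangentSpace 𝓘(ℝ, Model) p)
    (he : ∀ i, IsVertical (EuclideanSpace ℝ (Fin 4)) proj p (e i)) :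
    bsVol c₀ c₁ p (Fin.append e f) =
      (bsV c₀ c₁ p ^ 4 * fibreVol p e) *
        (bsW c₀ c₁ p ^ 4 * pullbackForm (E := Model) proj sphereVol p f) := by
  rw [bsVol, wedge_append, AlternatingMap.smul_apply, AlternatingMap.smul_apply, smul_eq_mul,
    smul_eq_mul]
  intro v i j hv
  rw [AlternatingMap.smul_apply, pullbackForm_eq_zero (i := i), smul_zero]
  rw [hv]
  exact he j

theorem coordForm_bsVol_append (p : NegSpinorBundle) (y : Model) (e f : Fin 4 → Model)
    (he : ∀ i, (e i).1 = 0) : coordForm (bsVol c₀ c₁) p y (Fin.append e f) =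
      -qvol (bsFrame hc₀ hc₁ y (e 0)).2 (bsFrame hc₀ hc₁ y (e 1)).2 (bsFrame hc₀ hc₁ y (e 2)).2
        (bsFrame hc₀ hc₁ y (e 3)).2 *
      qvol (bsFrame hc₀ hc₁ y (f 0)).1 (bsFrame hc₀ hc₁ y (f 1)).1 (bsFrame hc₀ hc₁ y (f 2)).1
        (bsFrame hc₀ hc₁ y (f 3)).1 := by
  have h1 : (fun i => coordVec p y (Fin.append e f i)) =
      Fin.append (fun i => coordVec p y (e i)) fun i => coordVec p y (f i) := by
    funext i
    refine Fin.addCases (fun i => ?_) (fun i => ?_) i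
    · rw [Fin.append_left, Fin.append_left]
    · rw [Fin.append_right, Fin.append_right]
  have h2 : coordForm (bsVol c₀ c₁) p y (Fin.append e f) =
    bsVol c₀ c₁ ((extChartAt 𝓘(ℝ, Model) p).symm y) fun i => coordVec p y (Fin.append e f i) := by
    rw [coordForm]
    simp only [coordVec]
  have hw : bsW c₀ c₁ ((extChartAt 𝓘(ℝ, Model) p).symm y) ^ 4 = coordW2 c₀ c₁ y ^ 2 := by
    rw [← bsW_sq hc₀ hc₁ p y]; ring
  have hv : bsV c₀ c₁ ((extChartAt 𝓘(ℝ, Model) p).symm y) ^ 4 = coordV2 c₀ c₁ y ^ 2 := by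
    rw [← bsV_sq hc₀ hc₁ p y]; ring
  rw [h2, h1, bsVol_append, hw, hv, ← coordForm_fibreVol hc₀ hc₁ p, ← coordForm_pullback hc₀ hc₁ p]
  · rfl
  · exact fun i => (isVertical_coordVec_iff p y (e i)).2 (he i)

theorem bsFrame_bsBasis_left (z : Model) (i : Fin 4) :
    bsFrame hc₀ hc₁ z (bsBasis hc₀ hc₁ z (Fin.castAdd 4 i)) = (0, star (qbasis i)) := by
  rw [bsFrame_bsBasis]
  refine Prod.ext ?_ (Quaternion.ext_iff.2 ⟨?_, ?_, ?_, ?_⟩)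
  · fin_cases i <;> ext <;> simp [qcoordEquiv]
  · rw [Quaternion.re_star, qbasis_apply]
    fin_cases i <;> simp [qcoordEquiv]
  · rw [Quaternion.imI_star, qbasis_apply]
    fin_cases i <;> simp [qcoordEquiv]
  · rw [Quaternion.imJ_star, qbasis_apply]
    fin_cases i <;> simp [qcoordEquiv]
  · rw [Quaternion.imK_star, qbasis_apply]
    fin_cases i <;> simp [qcoordEquiv]

theorem bsFrame_bsBasis_right (z : Model) (i : Fin 4) :
    bsFrame hc₀ hc₁ z (bsBasis hc₀ hc₁ z (Fin.natAdd 4 i)) = (qbasis i, 0) := by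
  rw [bsFrame_bsBasis, qbasis_apply]
  fin_cases i <;> ext <;> simp [qcoordEquiv]

/-- Both sides have top degree, so one value decides. On the adapted basis the conjugated fibre
vectors have volume -1, cancelling the sign of vol_𝓥. -/
theorem coordForm_bsVol (p : NegSpinorBundle) (y : Model) (v : Fin 8 → Model) :
    coordForm (bsVol c₀ c₁) p y v = (bsBasis hc₀ hc₁ y).det v := by
  have h1 : coordAlt (bsVol c₀ c₁) p y (bsBasis hc₀ hc₁ y) = 1 := by
    have h2 : Fin.append (m := 4) (n := 4)
        (fun i => bsBasis hc₀ hc₁ y (Fin.castAdd 4 i))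
        (fun i => bsBasis hc₀ hc₁ y (Fin.natAdd 4 i)) = bsBasis hc₀ hc₁ y :=
      Fin.append_castAdd_natAdd (m := 4) (n := 4) (f := bsBasis hc₀ hc₁ y)
    have h3 := coordForm_bsVol_append hc₀ hc₁ p y
      (fun i => bsBasis hc₀ hc₁ y (Fin.castAdd 4 i)) (fun i => bsBasis hc₀ hc₁ y (Fin.natAdd 4 i))
      fun i => by
        have := congrArg Prod.fst (bsFrame_bsBasis_left hc₀ hc₁ y i)
        rw [bsFrame_fst] at this
        exact (smul_eq_zero.1 this).resolve_left (Real.sqrt_pos.2 (coordA_pos hc₀ hc₁ _)).ne'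
    rw [coordAlt_apply, ← h2, h3]
    simp only [bsFrame_bsBasis_left, bsFrame_bsBasis_right]
    rw [qvol_star, ← qbasis_det_apply, Module.Basis.det_self, neg_neg, one_mul]
  rw [← coordAlt_apply, AlternatingMap.eq_smul_basis_det (bsBasis hc₀ hc₁ y)
    (coordAlt (bsVol c₀ c₁) p y), h1, one_smul]

end NegSpinorBundle

namespace NegSpinorBundle

/-! ### The algebraic properties of the Bryant–Salamon structure -/

theorem bsW_sq_eq {c₀ c₁ : ℝ} (hc₀ : 0 < c₀) (hc₁ : 0 < c₁) (p : NegSpinorBundle) :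
    bsW c₀ c₁ p ^ 2 = coordW2 c₀ c₁ (extChartAt 𝓘(ℝ, Model) p p) := by
  rw [← bsW_sq hc₀ hc₁ p, extChartAt_to_inv]

theorem bsW_eq_sqrt {c₀ c₁ : ℝ} (hc₀ : 0 < c₀) (hc₁ : 0 < c₁) (p : NegSpinorBundle) (y : Model) :
    bsW c₀ c₁ ((extChartAt 𝓘(ℝ, Model) p).symm y) = √(coordW2 c₀ c₁ y) := by
  rw [← bsW_sq hc₀ hc₁ p, Real.sqrt_sq (bsW_pos hc₀ hc₁ _).le]

variable {c₀ c₁ : ℝ} (hc₀ : 0 < c₀) (hc₁ : 0 < c₁)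

theorem bsVol_apply (p : NegSpinorBundle) (v : Fin 8 → TangentSpace 𝓘(ℝ, Model) p) :
    bsVol c₀ c₁ p v = (tangentBasis hc₀ hc₁ p).det v :=
  (coordForm_self (E := Model) (bsVol c₀ c₁) p v).symm.trans (coordForm_bsVol hc₀ hc₁ p _ v)

theorem coordBilin_pullback (p : NegSpinorBundle) (y v w : Model) :
    coordBilin (pullbackBilin (E := Model) proj roundMetric) p y v w = (coordW2 c₀ c₁ y)⁻¹ *
      ⟪(bsFrame hc₀ hc₁ y v).1, (bsFrame hc₀ hc₁ y w).1⟫ := by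
  have h : coordBilin (pullbackBilin (E := Model) proj roundMetric) p y v w = _ :=
    pullbackBilin_coordVec p y v w
  simp only [bsFrame_fst, inner_smul_left, inner_smul_right, RCLike.conj_to_real]
  rw [h, ← mul_assoc (√_), Real.mul_self_sqrt (coordA_pos hc₀ hc₁ y).le, coordA]
  have := one_add_norm_pos y.1
  have := coordW2_pos hc₀ hc₁ y
  field_simp

theorem pullbackBilin_apply (p : NegSpinorBundle) (v w : TangentSpace 𝓘(ℝ, Model) p) :
    pullbackBilin (E := Model) proj roundMetric p v w = (bsW c₀ c₁ p ^ 2)⁻¹ *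
      ⟪(tangentFrame hc₀ hc₁ p v).1, (tangentFrame hc₀ hc₁ p w).1⟫ := by
  rw [bsW_sq_eq hc₀ hc₁]
  exact (coordBilin_self (E := Model) _ p v w).symm.trans (coordBilin_pullback hc₀ hc₁ p _ v w)

theorem fibreVol_apply (p : NegSpinorBundle) (v : Fin 4 → TangentSpace 𝓘(ℝ, Model) p) :
    bsV c₀ c₁ p ^ 4 * fibreVol p v =
      -qvol (tangentFrame hc₀ hc₁ p (v 0)).2 (tangentFrame hc₀ hc₁ p (v 1)).2
        (tangentFrame hc₀ hc₁ p (v 2)).2 (tangentFrame hc₀ hc₁ p (v 3)).2 := by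
  have h := coordForm_fibreVol hc₀ hc₁ p (extChartAt 𝓘(ℝ, Model) p p) v
  have h4 : bsV c₀ c₁ p ^ 4 = coordV2 c₀ c₁ (extChartAt 𝓘(ℝ, Model) p p) ^ 2 := by
    rw [← bsV_sq hc₀ hc₁ p, extChartAt_to_inv]; ring
  rw [h4]
  refine Eq.trans ?_ h
  congr 1
  exact (coordForm_self (E := Model) _ p v).symm

theorem bsForm_vertical (p : NegSpinorBundle) (e : Fin 4 → TangentSpace 𝓘(ℝ, Model) p)
    (he : ∀ i, IsVertical (EuclideanSpace ℝ (Fin 4)) proj p (e i)) :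
    bsForm c₀ c₁ p e = -qvol (tangentFrame hc₀ hc₁ p (e 0)).2
      (tangentFrame hc₀ hc₁ p (e 1)).2 (tangentFrame hc₀ hc₁ p (e 2)).2
      (tangentFrame hc₀ hc₁ p (e 3)).2 := by
  have h0 : ∀ i, (tangentFrame hc₀ hc₁ p (e i)).1 = 0 := fun i =>
    (isVertical_iff_tangentFrame hc₀ hc₁ p (e i)).1 (he i)
  rw [bsForm_apply hc₀ hc₁, qcayley, qmixed]
  simp only [h0]
  simp [qvol, qcurv]

/-- On vertical vectors Φ reduces to v⁴ vol_𝓥, the first factor of the volume form. Both the Smith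
equation and the sign in the calibration of the fibres come from this. -/
theorem bsVol_append_eq {c₀ c₁ : ℝ} (hc₀ : 0 < c₀) (hc₁ : 0 < c₁) (p : NegSpinorBundle)
    (e f : Fin 4 → TangentSpace 𝓘(ℝ, Model) p)
    (he : ∀ i, IsVertical (EuclideanSpace ℝ (Fin 4)) proj p (e i)) :
    bsVol c₀ c₁ p (Fin.append e f) =
      bsForm c₀ c₁ p e * (bsW c₀ c₁ p ^ 4 * pullbackForm (E := Model) proj sphereVol p f) := by
  rw [bsVol_append _ _ _ _ _ he, bsForm_vertical hc₀ hc₁ p e he, fibreVol_apply hc₀ hc₁]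

theorem isSmoothForm_bsVol {c₀ c₁ : ℝ} (hc₀ : 0 < c₀) (hc₁ : 0 < c₁) :
    IsSmoothForm (bsVol c₀ c₁) := fun p v => by
  have h : ∀ y, coordForm (bsVol c₀ c₁) p y v = ∑ σ : Equiv.Perm (Fin 8), (Equiv.Perm.sign σ : ℤ) •
      ∏ i, qcoord (bsFrame hc₀ hc₁ y (v i)) (σ i) := fun y => by
    rw [coordForm_bsVol hc₀ hc₁, Module.Basis.det_apply, Matrix.det_apply]
    rfl
  have hq : ∀ j, ContDiff ℝ ∞ fun u : Model => qcoord u j := fun j =>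
    (LinearMap.toContinuousLinearMap (LinearMap.proj j ∘ₗ qcoordEquiv.toLinearMap)).contDiff
  refine ContDiff.contDiffOn ?_
  simp only [h]
  refine ContDiff.sum fun σ _ => ?_
  simp only [zsmul_eq_mul]
  exact contDiff_const.mul (contDiff_prod fun i _ => (hq _).comp (bsFrame_contDiff hc₀ hc₁ _))

theorem abs_bsVol_eq_one {c₀ c₁ : ℝ} (hc₀ : 0 < c₀) (hc₁ : 0 < c₁) (p : NegSpinorBundle)
    (e : Fin 8 → TangentSpace 𝓘(ℝ, Model) p)
    (he : IsOrthonormalFamily (bsMetric c₀ c₁) p e) : |bsVol c₀ c₁ p e| = 1 := by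
  rw [bsVol_apply hc₀ hc₁]
  refine abs_det_eq_one _ _ fun i j => ?_
  simp only [tangentBasis_repr]
  rw [← qdot_eq_sum, ← bsMetric_apply hc₀ hc₁, he]

theorem isVolumeForm_bsVol {c₀ c₁ : ℝ} (hc₀ : 0 < c₀) (hc₁ : 0 < c₁) :
    IsVolumeForm (bsMetric c₀ c₁) (bsVol c₀ c₁) where
  dim := by
    rw [Module.finrank_prod, Quaternion.finrank_eq_four]
  smooth := isSmoothForm_bsVol hc₀ hc₁
  unit := abs_bsVol_eq_one hc₀ hc₁

theorem isSpin7Structure {c₀ c₁ : ℝ} (hc₀ : 0 < c₀) (hc₁ : 0 < c₁) :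
    IsSpin7Structure (bsMetric c₀ c₁) (bsVol c₀ c₁) (bsForm c₀ c₁) where
  smooth := isSmoothForm_bsForm hc₀ hc₁
  frame p := by
    refine ⟨tangentBasis hc₀ hc₁ p, isOrthonormalFamily_tangentBasis hc₀ hc₁ p, ?_, fun v => ?_⟩
    · rw [bsVol_apply hc₀ hc₁, Module.Basis.det_self]
    · rw [bsForm_apply hc₀ hc₁]
      simp only [tangentBasis_repr]
      exact (cayleyForm_qcoord fun i => tangentFrame hc₀ hc₁ p (v i)).symm

/-- In the adapted basis the four vertical vectors contribute nothing to the trace and each of the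
four horizontal ones contributes w⁻². -/
theorem duNorm_eq {c₀ c₁ : ℝ} (hc₀ : 0 < c₀) (hc₁ : 0 < c₁) (p : NegSpinorBundle) :
    duNorm (bsMetric c₀ c₁) roundMetric proj p = 2 / bsW c₀ c₁ p := by
  let H : Model →ₗ[ℝ] Model →ₗ[ℝ] ℝ := bsMetric c₀ c₁ p
  let B : Model →ₗ[ℝ] Model →ₗ[ℝ] ℝ := pullbackBilin (E := Model) proj roundMetric p
  let e : Module.Basis (Fin 8) ℝ Model := tangentBasis hc₀ hc₁ p
  have h := metricTrace_eq_sum H B e (isOrthonormalFamily_tangentBasis hc₀ hc₁ p)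
  have h2 : ∑ i, pullbackBilin (E := Model) proj roundMetric p (tangentBasis hc₀ hc₁ p i)
      (tangentBasis hc₀ hc₁ p i) = (2 / bsW c₀ c₁ p) ^ 2 := by
    simp only [pullbackBilin_apply hc₀ hc₁, tangentFrame_tangentBasis, quaternion_inner]
    simp [Fin.sum_univ_eight, qcoordEquiv]
    ring
  unfold duNorm
  rw [Real.sqrt_eq_iff_mul_self_eq_of_pos (div_pos two_pos (bsW_pos hc₀ hc₁ p)), ← sq, ← h2]
  exact h.symm

theorem sqrt_four : √(4 : ℝ) = 2 := by
  rw [show (4 : ℝ) = 2 ^ 2 by norm_num]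
  exact Real.sqrt_sq zero_le_two

theorem duNorm_div {c₀ c₁ : ℝ} (hc₀ : 0 < c₀) (hc₁ : 0 < c₁) (p : NegSpinorBundle) :
    duNorm (bsMetric c₀ c₁) roundMetric proj p / √4 = 1 / bsW c₀ c₁ p := by
  rw [duNorm_eq hc₀ hc₁, sqrt_four]
  field_simp

theorem conformalOnHorizontal {c₀ c₁ : ℝ} (hc₀ : 0 < c₀) (hc₁ : 0 < c₁) (p : NegSpinorBundle) :
    ConformalOnHorizontal (bsMetric c₀ c₁) roundMetric proj p (1 / bsW c₀ c₁ p) := by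
  intro v w hv hw
  rw [pullbackBilin_apply hc₀ hc₁, bsMetric_apply hc₀ hc₁, qdot,
    tangentFrame_snd_eq_zero hc₀ hc₁ p v hv, inner_zero_left, add_zero, one_div, inv_pow]

/-- The vectors (X, 0) meet the vertical space only in zero, and they form a space of the same
dimension four as the target. -/
theorem mfderiv_proj_surjective (p : NegSpinorBundle) :
    Function.Surjective (mfderiv 𝓘(ℝ, Model) (𝓡 4) proj p) := by
  let T : ℍ[ℝ] →ₗ[ℝ] EuclideanSpace ℝ (Fin 4) :=
    (mfderiv 𝓘(ℝ, Model) (𝓡 4) proj p).toLinearMap ∘ₗ LinearMap.inl ℝ ℍ[ℝ] ℍ[ℝ]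
  have hT : Function.Injective T := by
    rw [injective_iff_map_eq_zero]
    intro X hX
    exact (isVertical_iff p ((X, 0) : Model)).1 hX
  have hS := (LinearMap.injective_iff_surjective_of_finrank_eq_finrank
    (by rw [Quaternion.finrank_eq_four, finrank_euclideanSpace_fin])).1 hT
  intro w
  obtain ⟨X, hX⟩ := hS w
  exact ⟨((X, 0) : Model), hX⟩

theorem proj_surjective : Function.Surjective proj := fun x =>
  ⟨⟨(x, 0), by simp⟩, rfl⟩

theorem isHorizontallyConformalSubmersion {c₀ c₁ : ℝ} (hc₀ : 0 < c₀) (hc₁ : 0 < c₁) :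
    IsHorizontallyConformalSubmersion (bsMetric c₀ c₁) roundMetric proj
      (fun p => 1 / bsW c₀ c₁ p) where
  smooth := proj_contMDiff
  surjective := proj_surjective
  submersion := mfderiv_proj_surjective
  smooth_dilation := by
    refine contMDiff_of_extChartAt_symm ?_ fun p => ?_
    · have hs : Continuous fun p : NegSpinorBundle => ‖spinor p‖ := spinor_contMDiff.continuous.norm
      refine continuous_const.div ?_ fun p => (bsW_pos hc₀ hc₁ p).ne'
      refine Continuous.sqrt (continuous_const.mul
        (Continuous.rpow_const (continuous_const.add (continuous_const.mul (hs.pow 2))) fun p =>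
          Or.inl ?_))
      positivity
    · have h : (fun p => 1 / bsW c₀ c₁ p) ∘ (extChartAt 𝓘(ℝ, Model) p).symm =
          fun y => 1 / √(coordW2 c₀ c₁ y) := by
        funext y
        exact congrArg (1 / ·) (bsW_eq_sqrt hc₀ hc₁ p y)
      rw [h]
      exact (contDiff_const.div
        ((coordW2_contDiff hc₀ hc₁).sqrt fun z => (coordW2_pos hc₀ hc₁ z).ne')
        fun z => (Real.sqrt_pos.2 (coordW2_pos hc₀ hc₁ z)).ne').contDiffOn
  dilation_pos p := one_div_pos.2 (bsW_pos hc₀ hc₁ p)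
  conformal := conformalOnHorizontal hc₀ hc₁

/-- Evaluate these top-degree forms on the adapted basis, whose first half is vertical: the wedge
factors there, and so does the volume form, with an additional w⁴. -/
theorem wedge_bsForm_pullbackForm {c₀ c₁ : ℝ} (hc₀ : 0 < c₀) (hc₁ : 0 < c₁)
    (p : NegSpinorBundle) :
    wedge (bsForm c₀ c₁ p) (pullbackForm (E := Model) proj sphereVol p) =
      (1 / bsW c₀ c₁ p) ^ 4 • bsVol c₀ c₁ p := by
  have hpos := bsW_pos hc₀ hc₁ p
  have h2 : Fin.append (m := 4) (n := 4)
      (fun i => tangentBasis hc₀ hc₁ p (Fin.castAdd 4 i))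
      (fun i => tangentBasis hc₀ hc₁ p (Fin.natAdd 4 i)) = tangentBasis hc₀ hc₁ p :=
    Fin.append_castAdd_natAdd (m := 4) (n := 4) (f := tangentBasis hc₀ hc₁ p)
  have hv : ∀ i, IsVertical (EuclideanSpace ℝ (Fin 4)) proj p
      (tangentBasis hc₀ hc₁ p (Fin.castAdd 4 i)) := fun i => by
    rw [isVertical_iff_tangentFrame hc₀ hc₁]
    exact congrArg Prod.fst (bsFrame_bsBasis_left hc₀ hc₁ _ i)
  have key : wedge (bsForm c₀ c₁ p) (pullbackForm (E := Model) proj sphereVol p)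
      (tangentBasis hc₀ hc₁ p) = (1 / bsW c₀ c₁ p) ^ 4 • bsVol c₀ c₁ p (tangentBasis hc₀ hc₁ p) := by
    rw [← h2, bsVol_append_eq hc₀ hc₁ p _ _ hv, wedge_append]
    · rw [smul_eq_mul]
      field_simp
    · intro v i j hij
      refine pullbackForm_eq_zero (i := i) _ _ ?_
      rw [hij]
      exact hv j
  rw [AlternatingMap.eq_smul_basis_det (tangentBasis hc₀ hc₁ p)
    (wedge (bsForm c₀ c₁ p) (pullbackForm (E := Model) proj sphereVol p)),
    AlternatingMap.eq_smul_basis_det (tangentBasis hc₀ hc₁ p) (bsVol c₀ c₁ p), key, smul_eq_mul, smul_smul]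

/-- The frame maps an orthonormal basis of the vertical space to one of ℍ, so Φ is ±1 on it; the
orientation convention makes Φ positive because the volume form is Φ(e) w⁴ u^*vol(f). -/
theorem hasCalibratedFibres {c₀ c₁ : ℝ} (hc₀ : 0 < c₀) (hc₁ : 0 < c₁) :
    HasCalibratedFibres (bsMetric c₀ c₁) (bsVol c₀ c₁) sphereVol (bsForm c₀ c₁) proj := by
  refine ⟨mfderiv_proj_surjective, fun p e f he hev hf hfh hν hμ => ?_⟩
  have hpos := bsW_pos hc₀ hc₁ p
  rw [bsVol_append_eq hc₀ hc₁ p e f hev] at hμ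
  have hΦ : 0 < bsForm c₀ c₁ p e := pos_of_mul_pos_left hμ (by positivity)
  have h0 : ∀ i, (tangentFrame hc₀ hc₁ p (e i)).1 = 0 := fun i =>
    (isVertical_iff_tangentFrame hc₀ hc₁ p (e i)).1 (hev i)
  have h1 := bsForm_vertical hc₀ hc₁ p e hev
  have h2 := abs_qvol_eq_one (fun i => (tangentFrame hc₀ hc₁ p (e i)).2) fun i j => by
    rw [← he i j, bsMetric_apply hc₀ hc₁, qdot, h0, inner_zero_left, zero_add]
  rw [← abs_neg, ← h1, abs_of_pos hΦ] at h2
  exact h2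

end NegSpinorBundle

/-! ### The round sphere in stereographic charts -/

/-- The preferred chart at x is stereographic projection from -x, which puts x at the origin. `J` is
the inclusion of the hyperplane orthogonal to x and `P` the orthogonal projection onto it, both in a
fixed orthonormal identification with ℝ⁴. -/
theorem exists_sphere_chart (x : S4) :
    ∃ (J : EuclideanSpace ℝ (Fin 4) →ₗᵢ[ℝ] EuclideanSpace ℝ (Fin 5))
      (P : EuclideanSpace ℝ (Fin 5) →L[ℝ] EuclideanSpace ℝ (Fin 4)),
      (∀ y, ⟪(x : EuclideanSpace ℝ (Fin 5)), J y⟫ = 0) ∧ P x = 0 ∧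
      (∀ y, ((extChartAt (𝓡 4) x).symm y : EuclideanSpace ℝ (Fin 5)) =
        (‖y‖ ^ 2 + 4)⁻¹ • ((4 : ℝ) • J y + (8 : ℝ) • (x : EuclideanSpace ℝ (Fin 5))) - x) ∧
      (∀ z : S4, extChartAt (𝓡 4) x z =
        (2 / (1 + ⟪(x : EuclideanSpace ℝ (Fin 5)), z⟫)) • P z) ∧
      (extChartAt (𝓡 4) x).target = Set.univ := by
  let U := (OrthonormalBasis.fromOrthogonalSpanSingleton (𝕜 := ℝ) 4
    (ne_zero_of_mem_unit_sphere (-x))).repr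
  let J : EuclideanSpace ℝ (Fin 4) →ₗᵢ[ℝ] EuclideanSpace ℝ (Fin 5) :=
    (Submodule.subtypeₗᵢ _).comp U.symm.toLinearIsometry
  let P : EuclideanSpace ℝ (Fin 5) →L[ℝ] EuclideanSpace ℝ (Fin 4) :=
    U.toContinuousLinearEquiv.toContinuousLinearMap ∘L
      (ℝ ∙ ((-x : S4) : EuclideanSpace ℝ (Fin 5)))ᗮ.orthogonalProjectionOnto
  have hJ : ∀ y, ⟪(x : EuclideanSpace ℝ (Fin 5)), J y⟫ = 0 := fun y => by
    have h := (U.symm y).2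
    rw [Submodule.mem_orthogonal_singleton_iff_inner_right] at h
    have h' : ⟪-(x : EuclideanSpace ℝ (Fin 5)), J y⟫ = 0 := h
    rwa [inner_neg_left, neg_eq_zero] at h'
  refine ⟨J, P, hJ, ?_, fun y => ?_, fun z => ?_, ?_⟩
  · have : (ℝ ∙ ((-x : S4) : EuclideanSpace ℝ (Fin 5)))ᗮ.orthogonalProjectionOnto
        (x : EuclideanSpace ℝ (Fin 5)) = 0 := by
      rw [Submodule.orthogonalProjectionOnto_eq_zero_iff, Submodule.orthogonal_orthogonal,
        Submodule.mem_span_singleton]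
      exact ⟨-1, by simp⟩
    exact (congrArg U this).trans (map_zero U)
  · have h := stereographic'_symm_apply (n := 4) (-x) y
    have hn : ‖((U.symm y : _) : EuclideanSpace ℝ (Fin 5))‖ = ‖y‖ := J.norm_map y
    have h1 : ((extChartAt (𝓡 4) x).symm y : EuclideanSpace ℝ (Fin 5)) =
      (‖J y‖ ^ 2 + 4)⁻¹ • (4 : ℝ) • J y + (‖J y‖ ^ 2 + 4)⁻¹ • (‖J y‖ ^ 2 - 4) •
        (-(x : EuclideanSpace ℝ (Fin 5))) := h
    rw [h1, J.norm_map]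
    have : ‖y‖ ^ 2 + 4 ≠ 0 := by positivity
    match_scalars <;> field_simp
    ring
  · have h1 : extChartAt (𝓡 4) x z = U ((2 / ((1 : ℝ) - ⟪((-x : S4) : EuclideanSpace ℝ (Fin 5)), z⟫)) •
      (ℝ ∙ ((-x : S4) : EuclideanSpace ℝ (Fin 5)))ᗮ.orthogonalProjectionOnto
        (z : EuclideanSpace ℝ (Fin 5))) := rfl
    have h2 : (1 : ℝ) - ⟪((-x : S4) : EuclideanSpace ℝ (Fin 5)), z⟫ =
        1 + ⟪(x : EuclideanSpace ℝ (Fin 5)), z⟫ := by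
      have h3 : ((-x : S4) : EuclideanSpace ℝ (Fin 5)) = -(x : EuclideanSpace ℝ (Fin 5)) := rfl
      rw [h3, inner_neg_left, sub_neg_eq_add]
    rw [h1, map_smul, h2]
    rfl
  · rw [extChartAt_target]
    have : (chartAt (EuclideanSpace ℝ (Fin 4)) x).target = Set.univ := stereographic'_target (-x)
    rw [this]
    simp

/-- Inverse stereographic projection from `-x` in a linear chart `J` of the tangent space. -/
def sphereParam (x : EuclideanSpace ℝ (Fin 5))
    (J : EuclideanSpace ℝ (Fin 4) →ₗᵢ[ℝ] EuclideanSpace ℝ (Fin 5)) (y : EuclideanSpace ℝ (Fin 4)) :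
    EuclideanSpace ℝ (Fin 5) :=
  (‖y‖ ^ 2 + 4)⁻¹ • ((4 : ℝ) • J y + (8 : ℝ) • x) - x

/-- The differential of `sphereParam`. -/
def sphereParamD (x : EuclideanSpace ℝ (Fin 5))
    (J : EuclideanSpace ℝ (Fin 4) →ₗᵢ[ℝ] EuclideanSpace ℝ (Fin 5))
    (y v : EuclideanSpace ℝ (Fin 4)) : EuclideanSpace ℝ (Fin 5) :=
  (4 * (‖y‖ ^ 2 + 4)⁻¹) • J v -
    (2 * ⟪y, v⟫ * ((‖y‖ ^ 2 + 4) ^ 2)⁻¹) • ((4 : ℝ) • J y + (8 : ℝ) • x)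

theorem fderiv_sphereParam (x : EuclideanSpace ℝ (Fin 5))
    (J : EuclideanSpace ℝ (Fin 4) →ₗᵢ[ℝ] EuclideanSpace ℝ (Fin 5))
    (y v : EuclideanSpace ℝ (Fin 4)) :
    fderiv ℝ (sphereParam x J) y v = sphereParamD x J y v := by
  have hs : ‖y‖ ^ 2 + 4 ≠ 0 := by positivity
  have h1 : HasFDerivAt (fun y : EuclideanSpace ℝ (Fin 4) => ‖y‖ ^ 2 + 4)
      ((2 : ℝ) • innerSL ℝ y) y := by
    have := ((hasStrictFDerivAt_norm_sq y).hasFDerivAt).add_const (4 : ℝ)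
    rw [two_smul] at this ⊢
    exact this
  have h2 := (hasDerivAt_inv hs).comp_hasFDerivAt y h1
  have h3 := (h2.smul (((4 : ℝ) • J.toContinuousLinearMap).hasFDerivAt.add_const
    ((8 : ℝ) • x))).sub_const x
  have h4 := congrArg (fun T : EuclideanSpace ℝ (Fin 4) →L[ℝ] EuclideanSpace ℝ (Fin 5) => T v)
    h3.fderiv
  refine Eq.trans h4 ?_
  simp [sphereParamD]
  module

theorem inner_sphereParamD {x : EuclideanSpace ℝ (Fin 5)} (hx : ‖x‖ = 1)
    (J : EuclideanSpace ℝ (Fin 4) →ₗᵢ[ℝ] EuclideanSpace ℝ (Fin 5)) (hJ : ∀ y, ⟪x, J y⟫ = 0)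
    (y v w : EuclideanSpace ℝ (Fin 4)) :
    ⟪sphereParamD x J y v, sphereParamD x J y w⟫ = 16 * ((‖y‖ ^ 2 + 4) ^ 2)⁻¹ * ⟪v, w⟫ := by
  have hs : ‖y‖ ^ 2 + 4 ≠ 0 := by positivity
  have hJ' : ∀ y, ⟪J y, x⟫ = 0 := fun y => by rw [real_inner_comm, hJ]
  simp only [sphereParamD, inner_sub_left, inner_sub_right, inner_smul_left, inner_smul_right,
    inner_add_left, inner_add_right, hJ, hJ', J.inner_map_map, real_inner_self_eq_norm_sq, hx,
    RCLike.conj_to_real, real_inner_comm y]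
  field_simp
  ring

theorem sphereParam_contDiff (x : EuclideanSpace ℝ (Fin 5))
    (J : EuclideanSpace ℝ (Fin 4) →ₗᵢ[ℝ] EuclideanSpace ℝ (Fin 5)) :
    ContDiff ℝ ∞ (sphereParam x J) := by
  have h1 : ContDiff ℝ ∞ fun y : EuclideanSpace ℝ (Fin 4) => (‖y‖ ^ 2 + 4)⁻¹ :=
    ((contDiff_id.norm_sq ℝ).add contDiff_const).inv fun y => by
      have : (0 : ℝ) < ‖y‖ ^ 2 + 4 := by positivity
      exact this.ne'
  have h2 : ContDiff ℝ ∞ fun y => (4 : ℝ) • J y + (8 : ℝ) • x :=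
    (J.toContinuousLinearMap.contDiff.const_smul (4 : ℝ)).add contDiff_const
  exact (h1.smul h2).sub contDiff_const

theorem dS4_coord (x : S4) (J : EuclideanSpace ℝ (Fin 4) →ₗᵢ[ℝ] EuclideanSpace ℝ (Fin 5))
    (hJ : ∀ y, ((extChartAt (𝓡 4) x).symm y : EuclideanSpace ℝ (Fin 5)) = sphereParam x J y)
    (hT : (extChartAt (𝓡 4) x).target = Set.univ) (y v : EuclideanSpace ℝ (Fin 4)) :
    dS4 ((extChartAt (𝓡 4) x).symm y)
      (mfderiv (𝓡 4) (𝓡 4) (extChartAt (𝓡 4) x).symm y v) = sphereParamD x J y v := by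
  have : IsManifold (𝓡 4) ∞ S4 := IsManifold.of_le (n := ω) le_top
  rw [← fderiv_sphereParam]
  have h : ((↑) : S4 → EuclideanSpace ℝ (Fin 5)) ∘ (extChartAt (𝓡 4) x).symm = sphereParam x J :=
    funext hJ
  rw [← h]
  exact mvfderiv_comp_extChartAt_symm x (by rw [hT]; trivial)
    ((contMDiff_coe_sphere (m := ∞) (n := 4)).mdifferentiableAt (by simp)) v

theorem coordBilin_roundMetric (x : S4) (y v w : EuclideanSpace ℝ (Fin 4)) :
    coordBilin roundMetric x y v w = 16 * ((‖y‖ ^ 2 + 4) ^ 2)⁻¹ * ⟪v, w⟫ := by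
  obtain ⟨J, P, hJ, -, hφ, -, hT⟩ := exists_sphere_chart x
  rw [← inner_sphereParamD (norm_eq_of_mem_sphere x) J hJ, ← dS4_coord x J hφ hT y v,
    ← dS4_coord x J hφ hT y w]
  rfl

theorem isRiemannianMetric_roundMetric : IsRiemannianMetric roundMetric where
  symm x v w := (real_inner_comm (dS4 x v) (dS4 x w)).symm
  pos x v hv := by
    have h : dS4 x v ≠ 0 := fun h =>
      hv ((map_eq_zero_iff _ (NegSpinorBundle.dS4_injective x)).1 h)
    change 0 < ⟪dS4 x v, dS4 x v⟫
    exact real_inner_self_pos.2 h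
  smooth x v w := by
    simp only [coordBilin_roundMetric]
    refine ContDiff.contDiffOn ((contDiff_const.mul
      ((((contDiff_id.norm_sq ℝ).add contDiff_const).pow 2).inv fun y => ?_)).mul contDiff_const)
    have : (0 : ℝ) < ‖y‖ ^ 2 + 4 := by positivity
    exact (pow_pos this 2).ne'

theorem sphereVol_apply (x : S4) (v : Fin 4 → TangentSpace (𝓡 4) x) :
    sphereVol x v = (EuclideanSpace.basisFun (Fin 5) ℝ).toBasis.det
      (Matrix.vecCons (x : EuclideanSpace ℝ (Fin 5)) fun i => dS4 x (v i)) := by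
  unfold sphereVol
  rw [AlternatingMap.compLinearMap_apply, AlternatingMap.curryLeft_apply_apply]

theorem coordForm_sphereVol (x : S4) (J : EuclideanSpace ℝ (Fin 4) →ₗᵢ[ℝ] EuclideanSpace ℝ (Fin 5))
    (hJ : ∀ y, ((extChartAt (𝓡 4) x).symm y : EuclideanSpace ℝ (Fin 5)) = sphereParam x J y)
    (hT : (extChartAt (𝓡 4) x).target = Set.univ) (y : EuclideanSpace ℝ (Fin 4))
    (v : Fin 4 → EuclideanSpace ℝ (Fin 4)) :
    coordForm sphereVol x y v = (EuclideanSpace.basisFun (Fin 5) ℝ).toBasis.det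
      (Matrix.vecCons (sphereParam x J y) fun i => fderiv ℝ (sphereParam x J) y (v i)) := by
  unfold coordForm
  rw [sphereVol_apply, hJ]
  simp only [dS4_coord x J hJ hT, fderiv_sphereParam]

theorem inner_dS4 (x : S4) (v : TangentSpace (𝓡 4) x) :
    ⟪(x : EuclideanSpace ℝ (Fin 5)), dS4 x v⟫ = 0 := by
  have h : dS4 x v ∈ (ℝ ∙ (x : EuclideanSpace ℝ (Fin 5)))ᗮ := by
    rw [← range_mvfderiv_subtypeVal (n := 4) x]
    exact ⟨v, rfl⟩
  rwa [Submodule.mem_orthogonal_singleton_iff_inner_right] at h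

/-- Preceded by the unit normal x, an orthonormal tangent frame becomes an orthonormal basis of ℝ⁵.
-/
theorem isVolumeForm_sphereVol : IsVolumeForm roundMetric sphereVol where
  dim := by simp
  smooth x v := by
    obtain ⟨J, P, hJ, -, hφ, -, hT⟩ := exists_sphere_chart x
    simp only [coordForm_sphereVol x J hφ hT, Module.Basis.det_apply, Matrix.det_apply]
    have hS := sphereParam_contDiff (x : EuclideanSpace ℝ (Fin 5)) J
    refine ContDiff.contDiffOn (ContDiff.sum fun σ _ => ?_)
    simp only [zsmul_eq_mul, Units.smul_def]
    refine contDiff_const.mul (contDiff_prod fun i _ => ?_)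
    have hi : ∀ j : Fin 5, ContDiff ℝ ∞ fun u : EuclideanSpace ℝ (Fin 5) => u j := fun j =>
      (EuclideanSpace.proj (𝕜 := ℝ) j).contDiff
    refine (hi (σ i)).comp ?_
    refine Fin.cases ?_ (fun i => ?_) i
    · exact hS
    · exact (hS.fderiv_right (m := ∞) (by simp)).clm_apply contDiff_const
  unit x e he := by
    rw [sphereVol_apply]
    refine abs_det_eq_one _ _ fun i j => ?_
    have h : ∀ a b : EuclideanSpace ℝ (Fin 5), ∑ k, (EuclideanSpace.basisFun (Fin 5) ℝ).toBasis.repr a k *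
        (EuclideanSpace.basisFun (Fin 5) ℝ).toBasis.repr b k = ⟪a, b⟫ := fun a b => by
      simp [PiLp.inner_apply, mul_comm]
    rw [h]
    refine Fin.cases ?_ (fun i => ?_) i <;> refine Fin.cases ?_ (fun j => ?_) j
    · simp
    · rw [if_neg (Fin.succ_ne_zero j).symm]
      exact inner_dS4 x (e j)
    · rw [real_inner_comm, if_neg (Fin.succ_ne_zero i)]
      exact inner_dS4 x (e i)
    · simp only [Fin.succ_inj]
      exact he i j

/-! ### Polarised identities for the quaternionic forms -/

theorem qcurv_swap_left (X Y D E : ℍ[ℝ]) : qcurv Y X D E = -qcurv X Y D E := by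
  rw [qcurv, qcurv, ← neg_sub (star X * Y), neg_mul, inner_neg_right]
  ring

theorem qcurv_swap_right (X Y D E : ℍ[ℝ]) : qcurv X Y E D = -qcurv X Y D E := by
  simp only [qcurv, quaternion_inner, Quaternion.re_mul, Quaternion.imI_mul, Quaternion.imJ_mul,
    Quaternion.imK_mul, Quaternion.re_star, Quaternion.imI_star, Quaternion.imJ_star,
    Quaternion.imK_star, Quaternion.re_sub, Quaternion.imI_sub, Quaternion.imJ_sub,
    Quaternion.imK_sub]
  ring

theorem qcurv_add_one (X X' Y D E : ℍ[ℝ]) :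
    qcurv (X + X') Y D E = qcurv X Y D E + qcurv X' Y D E := by
  rw [qcurv, qcurv, qcurv, ← mul_add, ← inner_add_right, ← add_mul]
  congr 3
  rw [star_add]
  noncomm_ring

theorem qcurv_add_three (X Y D D' E : ℍ[ℝ]) :
    qcurv X Y (D + D') E = qcurv X Y D E + qcurv X Y D' E := by
  rw [qcurv, inner_add_left, mul_add]
  rfl

theorem qcurv_smul_one (c : ℝ) (X Y D E : ℍ[ℝ]) : qcurv (c • X) Y D E = c * qcurv X Y D E := by
  rw [qcurv, qcurv, Quaternion.star_smul, smul_mul_assoc, mul_smul_comm, ← smul_sub,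
    smul_mul_assoc, inner_smul_right]
  ring

theorem qcurv_smul_three (c : ℝ) (X Y D E : ℍ[ℝ]) : qcurv X Y (c • D) E = c * qcurv X Y D E := by
  rw [qcurv, qcurv, real_inner_smul_left]
  ring

theorem qcurv_smul_four (c : ℝ) (X Y D E : ℍ[ℝ]) : qcurv X Y D (c • E) = c * qcurv X Y D E := by
  rw [qcurv_swap_right, qcurv_smul_three, qcurv_swap_right _ _ E]
  ring

/-- The sum of the values of a function of four vectors with one argument replaced. -/
def slotSum {V : Type*} (F : V → V → V → V → ℝ) (a b c d a' b' c' d' : V) : ℝ :=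
  F a' b c d + F a b' c d + F a b c' d + F a b c d'

/-- Under X ↦ lX + Xr the product X̄ Y varies by r̄ X̄Y + 2 Re(l) X̄Y + X̄Y r. The variation D ↦ -rD
of both spinor arguments cancels the outer terms. -/
theorem qcurv_mul (l r X Y D E : ℍ[ℝ]) :
    qcurv (l * X + X * r) Y D E + qcurv X (l * Y + Y * r) D E - qcurv X Y (r * D) E
      - qcurv X Y D (r * E) = 2 * l.re * qcurv X Y D E := by
  simp only [qcurv, quaternion_inner, Quaternion.re_mul, Quaternion.imI_mul, Quaternion.imJ_mul,
    Quaternion.imK_mul, Quaternion.re_star, Quaternion.imI_star, Quaternion.imJ_star,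
    Quaternion.imK_star, Quaternion.re_sub, Quaternion.imI_sub, Quaternion.imJ_sub,
    Quaternion.imK_sub, Quaternion.re_add, Quaternion.imI_add, Quaternion.imJ_add,
    Quaternion.imK_add]
  ring

/-- The factor is the trace of left multiplication by r on ℍ. -/
theorem qvol_mul_left (r a b c d : ℍ[ℝ]) :
    slotSum qvol a b c d (r * a) (r * b) (r * c) (r * d) = 4 * r.re * qvol a b c d := by
  simp only [slotSum, qvol, quaternion_inner, Quaternion.re_mul, Quaternion.imI_mul,
    Quaternion.imJ_mul, Quaternion.imK_mul, Quaternion.re_star, Quaternion.imI_star,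
    Quaternion.imJ_star, Quaternion.imK_star]
  ring

/-- An infinitesimal gauge transformation. -/
def gauge (l r : ℍ[ℝ]) (u : ℍ[ℝ] × ℍ[ℝ]) : ℍ[ℝ] × ℍ[ℝ] := (l * u.1 + u.1 * r, -(r * u.2))

theorem qmixed_gauge (l r : ℍ[ℝ]) (u v w z : ℍ[ℝ] × ℍ[ℝ]) :
    slotSum qmixed u v w z (gauge l r u) (gauge l r v) (gauge l r w) (gauge l r z) =
      2 * l.re * qmixed u v w z := by
  have h3 : ∀ X Y D E, qcurv X Y (-D) E = -qcurv X Y D E := fun X Y D E => by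
    simpa using qcurv_smul_three (-1) X Y D E
  have h4 : ∀ X Y D E, qcurv X Y D (-E) = -qcurv X Y D E := fun X Y D E => by
    simpa using qcurv_smul_four (-1) X Y D E
  simp only [slotSum, qmixed, gauge, h3, h4]
  linear_combination qcurv_mul l r u.1 v.1 w.2 z.2 - qcurv_mul l r u.1 w.1 v.2 z.2
    + qcurv_mul l r u.1 z.1 v.2 w.2 + qcurv_mul l r v.1 w.1 u.2 z.2
    - qcurv_mul l r v.1 z.1 u.2 w.2 + qcurv_mul l r w.1 z.1 u.2 v.2

theorem qmixed_swap_one (u v w z : ℍ[ℝ] × ℍ[ℝ]) : qmixed v u w z = -qmixed u v w z := by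
  simp only [qmixed, qcurv_swap_left u.1 v.1, qcurv_swap_right _ _ u.2 v.2]
  ring

theorem qmixed_swap_two (u v w z : ℍ[ℝ] × ℍ[ℝ]) : qmixed u w v z = -qmixed u v w z := by
  simp only [qmixed, qcurv_swap_left v.1 w.1, qcurv_swap_right _ _ v.2 w.2]
  ring

theorem qmixed_swap_three (u v w z : ℍ[ℝ] × ℍ[ℝ]) : qmixed u v z w = -qmixed u v w z := by
  simp only [qmixed, qcurv_swap_left w.1 z.1, qcurv_swap_right _ _ w.2 z.2]
  ring

theorem qmixed_add (u u' v w z : ℍ[ℝ] × ℍ[ℝ]) :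
    qmixed (u + u') v w z = qmixed u v w z + qmixed u' v w z := by
  simp only [qmixed, Prod.fst_add, Prod.snd_add, qcurv_add_one, qcurv_add_three]
  ring

theorem qmixed_smul (c : ℝ) (u v w z : ℍ[ℝ] × ℍ[ℝ]) :
    qmixed (c • u) v w z = c * qmixed u v w z := by
  simp only [qmixed, Prod.smul_fst, Prod.smul_snd, qcurv_smul_one, qcurv_smul_three]
  ring

theorem qvol_swap_one (a b c d : ℍ[ℝ]) : qvol b a c d = -qvol a b c d := by
  simp only [qvol, quaternion_inner, Quaternion.re_mul, Quaternion.imI_mul,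
    Quaternion.imJ_mul, Quaternion.imK_mul, Quaternion.re_star, Quaternion.imI_star,
    Quaternion.imJ_star, Quaternion.imK_star]
  ring

theorem qvol_swap_two (a b c d : ℍ[ℝ]) : qvol a c b d = -qvol a b c d := by
  simp only [qvol, quaternion_inner, Quaternion.re_mul, Quaternion.imI_mul,
    Quaternion.imJ_mul, Quaternion.imK_mul, Quaternion.re_star, Quaternion.imI_star,
    Quaternion.imJ_star, Quaternion.imK_star]
  ring

theorem qvol_swap_three (a b c d : ℍ[ℝ]) : qvol a b d c = -qvol a b c d := by
  simp only [qvol, quaternion_inner, Quaternion.re_mul, Quaternion.imI_mul,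
    Quaternion.imJ_mul, Quaternion.imK_mul, Quaternion.re_star, Quaternion.imI_star,
    Quaternion.imJ_star, Quaternion.imK_star]
  ring

theorem qvol_add (a a' b c d : ℍ[ℝ]) : qvol (a + a') b c d = qvol a b c d + qvol a' b c d := by
  simp only [qvol, inner_add_left]
  ring

theorem qvol_smul_one (k : ℝ) (a b c d : ℍ[ℝ]) : qvol (k • a) b c d = k * qvol a b c d := by
  simp only [qvol, real_inner_smul_left]
  ring

/-- The alternating sum over pairs of five vectors that arises from the antisymmetrisation of a
derivative. -/
def pairSum {V : Type*} (F : V → V → V → V → ℝ) (A : Fin 5 → Fin 5 → V) (v : Fin 5 → V) : ℝ :=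
  F (A 0 1) (v 2) (v 3) (v 4) - F (A 0 2) (v 1) (v 3) (v 4) + F (A 0 3) (v 1) (v 2) (v 4)
    - F (A 0 4) (v 1) (v 2) (v 3) + F (A 1 2) (v 0) (v 3) (v 4) - F (A 1 3) (v 0) (v 2) (v 4)
    + F (A 1 4) (v 0) (v 2) (v 3) + F (A 2 3) (v 0) (v 1) (v 4) - F (A 2 4) (v 0) (v 1) (v 3)
    + F (A 3 4) (v 0) (v 1) (v 2)

/-- The alternating sum over five vectors of a function of one and four vectors. -/
def altSum {V : Type*} (G : V → V → V → V → V → ℝ) (v : Fin 5 → V) : ℝ :=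
  G (v 0) (v 1) (v 2) (v 3) (v 4) - G (v 1) (v 0) (v 2) (v 3) (v 4)
    + G (v 2) (v 0) (v 1) (v 3) (v 4) - G (v 3) (v 0) (v 1) (v 2) (v 4)
    + G (v 4) (v 0) (v 1) (v 2) (v 3)

/-- Move the varied argument to the first slot by transpositions; the twenty terms then pair up, so
only the antisymmetric part of `P` remains. Applied to the Hessian parts, this leaves the curvature.
-/
theorem altSum_slotSum {U V : Type*} [AddCommGroup V] (F : V → V → V → V → ℝ)
    (h1 : ∀ a b c d, F b a c d = -F a b c d) (h2 : ∀ a b c d, F a c b d = -F a b c d)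
    (h3 : ∀ a b c d, F a b d c = -F a b c d) (hs : ∀ a a' b c d, F (a + a') b c d =
      F a b c d + F a' b c d) (f : U → V) (P : U → U → V) (v : Fin 5 → U) :
    altSum (fun u a b c d => slotSum F (f a) (f b) (f c) (f d) (P u a) (P u b) (P u c) (P u d)) v =
      pairSum F (fun i j => P (v i) (v j) - P (v j) (v i)) fun i => f (v i) := by
  have e2 : ∀ a x c d, F a x c d = -F x a c d := fun a x c d => h1 x a c d
  have e3 : ∀ a b x d, F a b x d = F x a b d := fun a b x d => by rw [h2 a x b d, h1 x a b d, neg_neg]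
  have e4 : ∀ a b c x, F a b c x = -F x a b c := fun a b c x => by rw [h3 a b x c, e3]
  have hd : ∀ a a' b c d, F (a - a') b c d = F a b c d - F a' b c d := fun a a' b c d => by
    have := hs (a - a') a' b c d
    rw [sub_add_cancel] at this
    linarith
  simp only [altSum, slotSum, pairSum, hd]
  rw [e2 (f (v 1)) (P (v 0) (v 2)), e3 (f (v 1)) (f (v 2)) (P (v 0) (v 3)),
    e4 (f (v 1)) (f (v 2)) (f (v 3)) (P (v 0) (v 4)), e2 (f (v 0)) (P (v 1) (v 2)),
    e3 (f (v 0)) (f (v 2)) (P (v 1) (v 3)), e4 (f (v 0)) (f (v 2)) (f (v 3)) (P (v 1) (v 4)),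
    e2 (f (v 0)) (P (v 2) (v 1)), e3 (f (v 0)) (f (v 1)) (P (v 2) (v 3)),
    e4 (f (v 0)) (f (v 1)) (f (v 3)) (P (v 2) (v 4)), e2 (f (v 0)) (P (v 3) (v 1)),
    e3 (f (v 0)) (f (v 1)) (P (v 3) (v 2)), e4 (f (v 0)) (f (v 1)) (f (v 2)) (P (v 3) (v 4)),
    e2 (f (v 0)) (P (v 4) (v 1)), e3 (f (v 0)) (f (v 1)) (P (v 4) (v 2)),
    e4 (f (v 0)) (f (v 1)) (f (v 2)) (P (v 4) (v 3))]
  ring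

/-- This is a five-form on a four-dimensional space. -/
theorem altSum_inner_qvol (a : ℍ[ℝ]) (X : Fin 5 → ℍ[ℝ]) :
    altSum (fun u b c d e => ⟪a, u⟫ * qvol b c d e) X = 0 := by
  simp only [altSum, qvol, quaternion_inner, Quaternion.re_mul, Quaternion.imI_mul,
    Quaternion.imJ_mul, Quaternion.imK_mul, Quaternion.re_star, Quaternion.imI_star,
    Quaternion.imJ_star, Quaternion.imK_star]
  ring

/-- For imaginary P the two-form ⟨·, P ·⟩ is self-dual or anti-self-dual, so contracting the volume
form with P a gives ⟨a, ·⟩ ∧ ⟨·, P ·⟩. -/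
theorem qvol_curv (X Y a D E F : ℍ[ℝ]) : qvol ((star X * Y - star Y * X) * a) D E F =
    2 * (⟪a, D⟫ * qcurv X Y E F - ⟪a, E⟫ * qcurv X Y D F + ⟪a, F⟫ * qcurv X Y D E) := by
  have key : ∀ P : ℍ[ℝ], P.re = 0 → qvol (P * a) D E F =
      ⟪a, D⟫ * ⟪E, P * F⟫ - ⟪a, E⟫ * ⟪D, P * F⟫ + ⟪a, F⟫ * ⟪D, P * E⟫ := fun P hP => by
    simp only [qvol, quaternion_inner, Quaternion.re_mul, Quaternion.imI_mul,
      Quaternion.imJ_mul, Quaternion.imK_mul, Quaternion.re_star, Quaternion.imI_star,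
      Quaternion.imJ_star, Quaternion.imK_star, hP]
    ring
  rw [key]
  · simp only [qcurv]
    ring
  · simp only [Quaternion.re_sub, Quaternion.re_mul, Quaternion.re_star, Quaternion.imI_star,
      Quaternion.imJ_star, Quaternion.imK_star]
    ring

/-- Curvature inserted into the vertical volume: the part of dΦ with two base and three fibre
arguments, to be matched with the derivative of the coefficient of β. -/
theorem pairSum_qvol (a : ℍ[ℝ]) (v : Fin 5 → ℍ[ℝ] × ℍ[ℝ]) :
    pairSum qvol (fun i j => (star (v i).1 * (v j).1 - star (v j).1 * (v i).1) * a)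
      (fun i => (v i).2) = 2 * altSum (fun u b c d e => ⟪a, u.2⟫ * qmixed b c d e) v := by
  simp only [pairSum, altSum, qvol_curv, qmixed]
  ring

/-- Polarising |P a|² = |P|² |a|² separates ⟨a, D⟩ from the imaginary factors; what remains is the
square of the ℍ-valued two-form X̄ Y - Ȳ X, a multiple of the volume. -/
theorem qcurv_curv (X Y Z W a D : ℍ[ℝ]) :
    qcurv Z W ((star X * Y - star Y * X) * a) D - qcurv Y W ((star X * Z - star Z * X) * a) D
      + qcurv Y Z ((star X * W - star W * X) * a) D + qcurv X W ((star Y * Z - star Z * Y) * a) D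
      - qcurv X Z ((star Y * W - star W * Y) * a) D + qcurv X Y ((star Z * W - star W * Z) * a) D =
      -12 * (⟪a, D⟫ * qvol X Y Z W) := by
  have key : ∀ P Q : ℍ[ℝ], P.re = 0 → Q.re = 0 → ⟪P * a, Q * D⟫ + ⟪Q * a, P * D⟫ =
      2 * ⟪P, Q⟫ * ⟪a, D⟫ := fun P Q hP hQ => by
    simp only [quaternion_inner, Quaternion.re_mul, Quaternion.imI_mul,
      Quaternion.imJ_mul, Quaternion.imK_mul, hP, hQ]
    ring
  have hre : ∀ X Y : ℍ[ℝ], (star X * Y - star Y * X).re = 0 := fun X Y => by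
    simp only [Quaternion.re_sub, Quaternion.re_mul, Quaternion.re_star, Quaternion.imI_star,
      Quaternion.imJ_star, Quaternion.imK_star]
    ring
  -- Each of the three imaginary components contributes -4.
  have hX : ⟪star X * Y - star Y * X, star Z * W - star W * Z⟫
      - ⟪star X * Z - star Z * X, star Y * W - star W * Y⟫
      + ⟪star X * W - star W * X, star Y * Z - star Z * Y⟫ = -12 * qvol X Y Z W := by
    simp only [qvol, quaternion_inner, Quaternion.re_mul, Quaternion.imI_mul, Quaternion.imJ_mul,
      Quaternion.imK_mul, Quaternion.re_star, Quaternion.imI_star, Quaternion.imJ_star,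
      Quaternion.imK_star, Quaternion.re_sub, Quaternion.imI_sub, Quaternion.imJ_sub,
      Quaternion.imK_sub]
    ring
  simp only [qcurv]
  linear_combination (1 / 2) * key _ _ (hre X Y) (hre Z W) - (1 / 2) * key _ _ (hre X Z) (hre Y W)
    + (1 / 2) * key _ _ (hre X W) (hre Y Z) + ⟪a, D⟫ * hX

/-- Curvature inserted into the mixed form: the part of dΦ with four base arguments and one fibre
argument, to be matched with the derivative of the coefficient of the base volume. -/
theorem pairSum_qmixed (a : ℍ[ℝ]) (v : Fin 5 → ℍ[ℝ] × ℍ[ℝ]) :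
    pairSum qmixed (fun i j => (0, (star (v i).1 * (v j).1 - star (v j).1 * (v i).1) * a)) v =
      -12 * altSum (fun u b c d e => ⟪a, u.2⟫ * qvol b.1 c.1 d.1 e.1) v := by
  have h0 : ∀ Y D E, qcurv 0 Y D E = 0 := fun Y D E => by simp [qcurv]
  simp only [pairSum, altSum, qmixed, h0]
  linear_combination qcurv_curv (v 1).1 (v 2).1 (v 3).1 (v 4).1 a (v 0).2
    - qcurv_curv (v 0).1 (v 2).1 (v 3).1 (v 4).1 a (v 1).2
    + qcurv_curv (v 0).1 (v 1).1 (v 3).1 (v 4).1 a (v 2).2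
    - qcurv_curv (v 0).1 (v 1).1 (v 2).1 (v 4).1 a (v 3).2
    + qcurv_curv (v 0).1 (v 1).1 (v 2).1 (v 3).1 a (v 4).2

/-! ### Derivatives along lines -/

/-- Once differentiability is known, the derivatives of all coefficients can be computed in one real
variable along lines. -/
theorem fderiv_apply_eq {E F : Type*} [NormedAddCommGroup E] [NormedSpace ℝ E]
    [NormedAddCommGroup F] [NormedSpace ℝ F] {f : E → F} {y u : E} {d : F}
    (hf : DifferentiableAt ℝ f y) (hd : HasDerivAt (fun t : ℝ => f (y + t • u)) d 0) :
    fderiv ℝ f y u = d := by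
  have h1 : HasDerivAt (fun t : ℝ => y + t • u) u 0 := by
    simpa using ((hasDerivAt_id (0 : ℝ)).smul_const u).const_add y
  have h2 : HasFDerivAt f (fderiv ℝ f y) (y + (0 : ℝ) • u) := by
    rw [zero_smul, add_zero]
    exact hf.hasFDerivAt
  exact (h2.comp_hasDerivAt (0 : ℝ) h1).unique hd

theorem hasDerivAt_fst {u : ℝ → ℍ[ℝ] × ℍ[ℝ]} {u' : ℍ[ℝ] × ℍ[ℝ]} {t : ℝ} (h : HasDerivAt u u' t) :
    HasDerivAt (fun t => (u t).1) u'.1 t :=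
  (ContinuousLinearMap.fst ℝ ℍ[ℝ] ℍ[ℝ]).hasFDerivAt.comp_hasDerivAt t h

theorem hasDerivAt_snd {u : ℝ → ℍ[ℝ] × ℍ[ℝ]} {u' : ℍ[ℝ] × ℍ[ℝ]} {t : ℝ} (h : HasDerivAt u u' t) :
    HasDerivAt (fun t => (u t).2) u'.2 t :=
  (ContinuousLinearMap.snd ℝ ℍ[ℝ] ℍ[ℝ]).hasFDerivAt.comp_hasDerivAt t h

theorem hasDerivAt_qvol {a b c d : ℝ → ℍ[ℝ]} {a' b' c' d' : ℍ[ℝ]} {t : ℝ}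
    (ha : HasDerivAt a a' t) (hb : HasDerivAt b b' t) (hc : HasDerivAt c c' t)
    (hd : HasDerivAt d d' t) : HasDerivAt (fun t => qvol (a t) (b t) (c t) (d t))
      (slotSum qvol (a t) (b t) (c t) (d t) a' b' c' d') t := by
  have hc' : HasDerivAt (fun t => star (c t)) (star c') t := quatStar.hasFDerivAt.comp_hasDerivAt t hc
  have h := ((((ha.inner ℝ ((hb.mul hc').mul hd))).sub ((hb.inner ℝ hc).mul (ha.inner ℝ hd))).add
    ((hb.inner ℝ hd).mul (ha.inner ℝ hc))).sub ((hc.inner ℝ hd).mul (ha.inner ℝ hb))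
  refine (show HasDerivAt (fun t => qvol (a t) (b t) (c t) (d t)) _ t from h).congr_deriv ?_
  simp only [slotSum, qvol, Pi.mul_apply, add_mul, inner_add_right]
  ring

theorem hasDerivAt_qcurv {a b c d : ℝ → ℍ[ℝ]} {a' b' c' d' : ℍ[ℝ]} {t : ℝ}
    (ha : HasDerivAt a a' t) (hb : HasDerivAt b b' t) (hc : HasDerivAt c c' t)
    (hd : HasDerivAt d d' t) : HasDerivAt (fun t => qcurv (a t) (b t) (c t) (d t))
      (slotSum qcurv (a t) (b t) (c t) (d t) a' b' c' d') t := by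
  have ha' : HasDerivAt (fun t => star (a t)) (star a') t := quatStar.hasFDerivAt.comp_hasDerivAt t ha
  have hb' : HasDerivAt (fun t => star (b t)) (star b') t := quatStar.hasFDerivAt.comp_hasDerivAt t hb
  have h := (hc.inner ℝ (((ha'.mul hb).sub (hb'.mul ha)).mul hd)).const_mul (1 / 2 : ℝ)
  refine (show HasDerivAt (fun t => qcurv (a t) (b t) (c t) (d t)) _ t from h).congr_deriv ?_
  simp only [slotSum, qcurv, Pi.sub_apply, Pi.mul_apply, sub_mul, add_mul, inner_add_right,
    inner_sub_right]
  ring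

theorem hasDerivAt_qmixed {u v w z : ℝ → ℍ[ℝ] × ℍ[ℝ]} {u' v' w' z' : ℍ[ℝ] × ℍ[ℝ]} {t : ℝ}
    (hu : HasDerivAt u u' t) (hv : HasDerivAt v v' t) (hw : HasDerivAt w w' t)
    (hz : HasDerivAt z z' t) : HasDerivAt (fun t => qmixed (u t) (v t) (w t) (z t))
      (slotSum qmixed (u t) (v t) (w t) (z t) u' v' w' z') t := by
  have hu1 := hasDerivAt_fst hu
  have hv1 := hasDerivAt_fst hv
  have hw1 := hasDerivAt_fst hw
  have hz1 := hasDerivAt_fst hz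
  have hu2 := hasDerivAt_snd hu
  have hv2 := hasDerivAt_snd hv
  have hw2 := hasDerivAt_snd hw
  have hz2 := hasDerivAt_snd hz
  have h := ((((((hasDerivAt_qcurv hu1 hv1 hw2 hz2).sub (hasDerivAt_qcurv hu1 hw1 hv2 hz2)).add
    (hasDerivAt_qcurv hu1 hz1 hv2 hw2)).add (hasDerivAt_qcurv hv1 hw1 hu2 hz2)).sub
    (hasDerivAt_qcurv hv1 hz1 hu2 hw2)).add (hasDerivAt_qcurv hw1 hz1 hu2 hv2))
  refine (show HasDerivAt (fun t => qmixed (u t) (v t) (w t) (z t)) _ t from h).congr_deriv ?_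
  simp only [slotSum, qmixed]
  ring

/-! ### Derivatives of the connection and its curvature, in coordinates. -/

namespace NegSpinorBundle

variable (y u : Model)

theorem hasDerivAt_line : HasDerivAt (fun t : ℝ => y + t • u) u 0 := by
  simpa using ((hasDerivAt_id (0 : ℝ)).smul_const u).const_add y

theorem hasDerivAt_line_norm_sq : HasDerivAt (fun t : ℝ => 1 + ‖(y + t • u).1‖ ^ 2)
    (2 * ⟪y.1, u.1⟫) 0 := by
  have h := (hasDerivAt_fst (hasDerivAt_line y u)).norm_sq.const_add (1 : ℝ)
  simpa using h

/-- The derivative of the covariant derivative. -/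
def covDeriv (v : Model) : ℍ[ℝ] :=
  (1 + ‖y.1‖ ^ 2)⁻¹ • (star u.1 * v.1 * y.2 + star y.1 * v.1 * u.2)
    - (2 * ⟪y.1, u.1⟫ * ((1 + ‖y.1‖ ^ 2) ^ 2)⁻¹) • (star y.1 * v.1 * y.2)

theorem hasDerivAt_covD (v : Model) :
    HasDerivAt (fun t : ℝ => covD (y + t • u) v) (covDeriv y u v) 0 := by
  have h1 := hasDerivAt_fst (hasDerivAt_line y u)
  have h2 := hasDerivAt_snd (hasDerivAt_line y u)
  have h3 : HasDerivAt (fun t : ℝ => star (y + t • u).1) (star u.1) 0 :=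
    quatStar.hasFDerivAt.comp_hasDerivAt (0 : ℝ) h1
  have hs : (1 + ‖(y + (0 : ℝ) • u).1‖ ^ 2) ≠ 0 := (one_add_norm_pos _).ne'
  have h := (((hasDerivAt_line_norm_sq y u).inv hs).smul ((h3.mul_const v.1).mul h2)).const_add v.2
  refine HasDerivAt.congr_deriv (f := fun t : ℝ => covD (y + t • u) v) h ?_
  simp only [zero_smul, add_zero, covDeriv, Pi.mul_apply, Pi.inv_apply]
  module

theorem hasDerivAt_split (v : Model) :
    HasDerivAt (fun t : ℝ => split (y + t • u) v) (0, covDeriv y u v) 0 :=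
  (hasDerivAt_const (0 : ℝ) v.1).prodMk (hasDerivAt_covD y u v)

/-- The spin connection is metric: the real part of the connection form s⁻¹ q̄ dq is ds/(2s), so
differentiating r² = s |a|² involves only the covariant derivative. -/
theorem hasDerivAt_bsR (c₀ c₁ : ℝ) : HasDerivAt (fun t : ℝ => bsR c₀ c₁ (y + t • u))
    (2 * c₁ * (1 + ‖y.1‖ ^ 2) * ⟪y.2, covD y u⟫) 0 := by
  have h2 : HasDerivAt (fun t : ℝ => ‖(y + t • u).2‖ ^ 2) (2 * ⟪y.2, u.2⟫) 0 := by
    simpa using (hasDerivAt_snd (hasDerivAt_line y u)).norm_sq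
  have h := (((hasDerivAt_line_norm_sq y u).mul h2).const_mul c₁).const_add c₀
  refine HasDerivAt.congr_deriv (f := fun t : ℝ => bsR c₀ c₁ (y + t • u)) h ?_
  have hs := one_add_norm_pos y.1
  have h3 : ⟪y.2, star y.1 * u.1 * y.2⟫ = ⟪y.1, u.1⟫ * ‖y.2‖ ^ 2 := by
    simp only [quaternion_inner, quaternion_norm_sq, Quaternion.re_mul, Quaternion.imI_mul,
      Quaternion.imJ_mul, Quaternion.imK_mul, Quaternion.re_star, Quaternion.imI_star,
      Quaternion.imJ_star, Quaternion.imK_star]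
    ring
  rw [covD_apply, inner_add_right, real_inner_smul_right, h3]
  simp only [zero_smul, add_zero]
  field_simp
  ring

/-- The derivative of the covariant derivative, corrected by the connection form. -/
def covHess (v : Model) : ℍ[ℝ] :=
  covDeriv y u v + (1 + ‖y.1‖ ^ 2)⁻¹ • (star y.1 * u.1 * covD y v)

/-- This is the curvature dω + ω ∧ ω of the connection form ω = s⁻¹ q̄ dq, applied to a. -/
theorem covHess_sub (v : Model) : covHess y u v - covHess y v u =
    ((1 + ‖y.1‖ ^ 2) ^ 2)⁻¹ • ((star u.1 * v.1 - star v.1 * u.1) * y.2) := by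
  have hs := one_add_norm_pos y.1
  -- Multiplication by s² clears the denominators, leaving a polynomial identity in quaternion
  -- components.
  have h : ∀ u v : Model, (1 + ‖y.1‖ ^ 2) ^ 2 • covHess y u v =
      (1 + ‖y.1‖ ^ 2) • (star u.1 * v.1 * y.2 + star y.1 * v.1 * u.2 + star y.1 * u.1 * v.2)
      - (2 * ⟪y.1, u.1⟫) • (star y.1 * v.1 * y.2)
      + star y.1 * u.1 * (star y.1 * v.1 * y.2) := fun u v => by
    rw [covHess, covDeriv, covD_apply, mul_add, mul_smul_comm]
    match_scalars <;> field_simp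
  rw [← (smul_right_injective ℍ[ℝ] (pow_ne_zero 2 hs.ne')).eq_iff]
  rw [smul_sub, h, h, smul_smul, mul_inv_cancel₀ (pow_ne_zero 2 hs.ne'), one_smul]
  rw [quaternion_norm_sq, quaternion_inner, quaternion_inner]
  ext <;> simp only [Quaternion.re_sub, Quaternion.imI_sub, Quaternion.imJ_sub, Quaternion.imK_sub,
    Quaternion.re_add, Quaternion.imI_add, Quaternion.imJ_add, Quaternion.imK_add,
    Quaternion.re_smul, Quaternion.imI_smul, Quaternion.imJ_smul, Quaternion.imK_smul,
    Quaternion.re_mul, Quaternion.imI_mul, Quaternion.imJ_mul, Quaternion.imK_mul,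
    Quaternion.re_star, Quaternion.imI_star, Quaternion.imJ_star, Quaternion.imK_star,
    smul_eq_mul] <;> ring

/-- The Hessian part of the derivative of the split components. -/
def splitHess (v : Model) : Model :=
  (-((1 + ‖y.1‖ ^ 2)⁻¹ • (u.1 * star y.1 * v.1 + v.1 * (star y.1 * u.1))), covHess y u v)

/-- The base component is symmetric in u and v, so antisymmetrisation leaves only the curvature. -/
theorem splitHess_sub (v : Model) : splitHess y u v - splitHess y v u =
    ((1 + ‖y.1‖ ^ 2) ^ 2)⁻¹ • (0, (star u.1 * v.1 - star v.1 * u.1) * y.2) := by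
  refine Prod.ext ?_ ?_
  · change -_ - -_ = (_ : ℝ) • (0 : ℍ[ℝ])
    rw [smul_zero, sub_neg_eq_add, neg_add_eq_zero]
    congr 1
    noncomm_ring
  · exact covHess_sub y u v

/-- The base component of `splitHess` is chosen to cancel that of the gauge transformation, since dq
of a constant vector is constant. The gauge part then acts on `qmixed` by the scalar of
`qmixed_gauge`. -/
theorem zero_covDeriv_eq (v : Model) : ((0, covDeriv y u v) : Model) =
    splitHess y u v +
      (1 + ‖y.1‖ ^ 2)⁻¹ • gauge (u.1 * star y.1) (star y.1 * u.1) (split y v) := by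
  refine Prod.ext ?_ ?_
  · change 0 = -_ + _ • (_ * v.1 + v.1 * _)
    rw [neg_add_cancel]
  · change covDeriv y u v = covHess y u v + _ • -(_ * covD y v)
    rw [covHess]
    module

end NegSpinorBundle

namespace NegSpinorBundle

/-! ### Closedness of the Bryant–Salamon form -/

/-- The exponents 6/5, 1/5, -4/5 of w⁴, w²v², v⁴ differ successively by one, so differentiating one
coefficient produces the power found in the next. -/
theorem coordForm_bsForm_rpow {c₀ c₁ : ℝ} (hc₀ : 0 < c₀) (hc₁ : 0 < c₁) (p : NegSpinorBundle)
    (y : Model) (v : Fin 4 → Model) : coordForm (bsForm c₀ c₁) p y v =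
      400 * bsR c₀ c₁ y ^ (6 / 5 : ℝ) * ((1 + ‖y.1‖ ^ 2) ^ 4)⁻¹ *
        qvol (v 0).1 (v 1).1 (v 2).1 (v 3).1
      + 80 * c₁ * bsR c₀ c₁ y ^ (1 / 5 : ℝ) * (1 + ‖y.1‖ ^ 2)⁻¹ *
        qmixed (split y (v 0)) (split y (v 1)) (split y (v 2)) (split y (v 3))
      - 16 * c₁ ^ 2 * bsR c₀ c₁ y ^ (-(4 / 5) : ℝ) * (1 + ‖y.1‖ ^ 2) ^ 2 *
        qvol (covD y (v 0)) (covD y (v 1)) (covD y (v 2)) (covD y (v 3)) := by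
  have hR := bsR_pos hc₀ hc₁ y
  have h1 : bsR c₀ c₁ y ^ (6 / 5 : ℝ) = bsR c₀ c₁ y ^ (3 / 5 : ℝ) * bsR c₀ c₁ y ^ (3 / 5 : ℝ) := by
    rw [← Real.rpow_add hR]; norm_num
  have h2 : bsR c₀ c₁ y ^ (1 / 5 : ℝ) =
      bsR c₀ c₁ y ^ (3 / 5 : ℝ) * bsR c₀ c₁ y ^ (-(2 / 5) : ℝ) := by
    rw [← Real.rpow_add hR]; norm_num
  have h3 : bsR c₀ c₁ y ^ (-(4 / 5) : ℝ) =
      bsR c₀ c₁ y ^ (-(2 / 5) : ℝ) * bsR c₀ c₁ y ^ (-(2 / 5) : ℝ) := by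
    rw [← Real.rpow_add hR]; norm_num
  rw [coordForm_bsForm hc₀ hc₁, h1, h2, h3, coordW2, coordV2]
  ring

theorem hasDerivAt_rpow_bsR {c₀ c₁ : ℝ} (hc₀ : 0 < c₀) (hc₁ : 0 < c₁) (y u : Model) (k : ℝ) :
    HasDerivAt (fun t : ℝ => bsR c₀ c₁ (y + t • u) ^ k)
      (2 * c₁ * (1 + ‖y.1‖ ^ 2) * ⟪y.2, covD y u⟫ * k * bsR c₀ c₁ y ^ (k - 1)) 0 := by
  have h := (hasDerivAt_bsR y u c₀ c₁).rpow_const (p := k) (Or.inl (bsR_pos hc₀ hc₁ _).ne')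
  simpa using h

/-- The gauge term contributes 2 s⁻² Re(u q̄) = 2 s⁻² ⟨q, u⟩ times the form, which cancels the
derivative of s⁻¹. -/
theorem hasDerivAt_qmixed_split (y u a b c d : Model) :
    HasDerivAt (fun t : ℝ => (1 + ‖(y + t • u).1‖ ^ 2)⁻¹ * qmixed (split (y + t • u) a)
      (split (y + t • u) b) (split (y + t • u) c) (split (y + t • u) d))
      ((1 + ‖y.1‖ ^ 2)⁻¹ * slotSum qmixed (split y a) (split y b) (split y c) (split y d)
        (splitHess y u a) (splitHess y u b) (splitHess y u c) (splitHess y u d)) 0 := by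
  have hs := one_add_norm_pos y.1
  have h := ((hasDerivAt_line_norm_sq y u).inv (one_add_norm_pos _).ne').mul
    (hasDerivAt_qmixed (hasDerivAt_split y u a) (hasDerivAt_split y u b) (hasDerivAt_split y u c)
      (hasDerivAt_split y u d))
  refine h.congr_deriv ?_
  simp only [zero_smul, add_zero, Pi.inv_apply, zero_covDeriv_eq]
  -- Linearity is available in the first argument only; transpositions carry the other arguments
  -- there and back.
  have hlin : ∀ (k : ℝ) (a b c d a' b' c' d' a'' b'' c'' d'' : Model),
      slotSum qmixed a b c d (a' + k • a'') (b' + k • b'') (c' + k • c'') (d' + k • d'') =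
        slotSum qmixed a b c d a' b' c' d' + k * slotSum qmixed a b c d a'' b'' c'' d'' := by
    intro k a b c d a' b' c' d' a'' b'' c'' d''
    have e2 : ∀ a x c d, qmixed a x c d = -qmixed x a c d := fun a x c d => qmixed_swap_one x a c d
    have e3 : ∀ a b x d, qmixed a b x d = -qmixed a x b d := fun a b x d => qmixed_swap_two a x b d
    have e4 : ∀ a b c x, qmixed a b c x = -qmixed a b x c := fun a b c x => qmixed_swap_three a b x c
    simp only [slotSum]
    rw [qmixed_add, qmixed_smul, e2 a (b' + _), e3 a b (c' + _), e2 a (c' + _), e4 a b c (d' + _),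
      e3 a b (d' + _), e2 a (d' + _)]
    simp only [qmixed_add, qmixed_smul]
    rw [e2 a b', e2 a b'', e3 a b c', e2 a c' , e3 a b c'', e2 a c'', e4 a b c d', e3 a b d',
      e2 a d', e4 a b c d'', e3 a b d'', e2 a d'']
    ring
  rw [hlin, qmixed_gauge]
  have hre : (u.1 * star y.1).re = ⟪y.1, u.1⟫ := by
    rw [quaternion_inner]
    simp
    ring
  rw [hre]
  field_simp
  ring

/-- The connection term scales the volume by -4 s⁻¹ Re(q̄ u), which cancels the derivative of s². -/
theorem hasDerivAt_qvol_covD (y u a b c d : Model) :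
    HasDerivAt (fun t : ℝ => (1 + ‖(y + t • u).1‖ ^ 2) ^ 2 * qvol (covD (y + t • u) a)
      (covD (y + t • u) b) (covD (y + t • u) c) (covD (y + t • u) d))
      ((1 + ‖y.1‖ ^ 2) ^ 2 * slotSum qvol (covD y a) (covD y b) (covD y c) (covD y d)
        (covHess y u a) (covHess y u b) (covHess y u c) (covHess y u d)) 0 := by
  have hs := one_add_norm_pos y.1
  have h := ((hasDerivAt_line_norm_sq y u).pow 2).mul
    (hasDerivAt_qvol (hasDerivAt_covD y u a) (hasDerivAt_covD y u b) (hasDerivAt_covD y u c)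
      (hasDerivAt_covD y u d))
  refine h.congr_deriv ?_
  simp only [zero_smul, add_zero, Pi.pow_apply, covHess]
  have hlin : ∀ (k : ℝ) (a b c d a' b' c' d' a'' b'' c'' d'' : ℍ[ℝ]),
      slotSum qvol a b c d (a' + k • a'') (b' + k • b'') (c' + k • c'') (d' + k • d'') =
        slotSum qvol a b c d a' b' c' d' + k * slotSum qvol a b c d a'' b'' c'' d'' := by
    intro k a b c d a' b' c' d' a'' b'' c'' d''
    have e2 : ∀ a x c d, qvol a x c d = -qvol x a c d := fun a x c d => qvol_swap_one x a c d
    have e3 : ∀ a b x d, qvol a b x d = -qvol a x b d := fun a b x d => qvol_swap_two a x b d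
    have e4 : ∀ a b c x, qvol a b c x = -qvol a b x c := fun a b c x => qvol_swap_three a b x c
    simp only [slotSum]
    rw [qvol_add, qvol_smul_one, e2 a (b' + _), e3 a b (c' + _), e2 a (c' + _), e4 a b c (d' + _),
      e3 a b (d' + _), e2 a (d' + _)]
    simp only [qvol_add, qvol_smul_one]
    rw [e2 a b', e2 a b'', e3 a b c', e2 a c' , e3 a b c'', e2 a c'', e4 a b c d', e3 a b d',
      e2 a d', e4 a b c d'', e3 a b d'', e2 a d'']
    ring
  rw [hlin, qvol_mul_left]
  have hre : (star y.1 * u.1).re = ⟪y.1, u.1⟫ := by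
    rw [quaternion_inner]
    simp
  rw [hre]
  field_simp
  norm_num
  ring

theorem hasDerivAt_inv_pow_four (y u : Model) :
    HasDerivAt (fun t : ℝ => ((1 + ‖(y + t • u).1‖ ^ 2) ^ 4)⁻¹)
      (-8 * ((1 + ‖y.1‖ ^ 2) ^ 5)⁻¹ * ⟪y.1, u.1⟫) 0 := by
  have hs := one_add_norm_pos y.1
  have h := ((hasDerivAt_line_norm_sq y u).pow 4).inv (pow_ne_zero 4 (one_add_norm_pos _).ne')
  refine h.congr_deriv ?_
  simp only [zero_smul, add_zero, Pi.pow_apply]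
  field_simp
  norm_num
  ring

/-- With dR = 2 c₁ s ⟨a, D⟩ for R = c₀ + c₁ r², the constants are 960 = 400·(6/5)·2, 32 = 80·(1/5)·2
and 128/5 = 16·(4/5)·2; -3200 = -8·400 comes from s⁻⁴. -/
theorem fderiv_coordForm_bsForm {c₀ c₁ : ℝ} (hc₀ : 0 < c₀) (hc₁ : 0 < c₁) (p : NegSpinorBundle)
    (y u : Model) (v : Fin 4 → Model) : fderiv ℝ (fun y => coordForm (bsForm c₀ c₁) p y v) y u =
      960 * c₁ * bsR c₀ c₁ y ^ (1 / 5 : ℝ) * ((1 + ‖y.1‖ ^ 2) ^ 3)⁻¹ *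
        (⟪y.2, covD y u⟫ * qvol (v 0).1 (v 1).1 (v 2).1 (v 3).1)
      + -3200 * bsR c₀ c₁ y ^ (6 / 5 : ℝ) * ((1 + ‖y.1‖ ^ 2) ^ 5)⁻¹ *
        (⟪y.1, u.1⟫ * qvol (v 0).1 (v 1).1 (v 2).1 (v 3).1)
      + 32 * c₁ ^ 2 * bsR c₀ c₁ y ^ (-(4 / 5) : ℝ) * (⟪y.2, covD y u⟫ *
        qmixed (split y (v 0)) (split y (v 1)) (split y (v 2)) (split y (v 3)))
      + 80 * c₁ * bsR c₀ c₁ y ^ (1 / 5 : ℝ) * (1 + ‖y.1‖ ^ 2)⁻¹ *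
        slotSum qmixed (split y (v 0)) (split y (v 1)) (split y (v 2)) (split y (v 3))
          (splitHess y u (v 0)) (splitHess y u (v 1)) (splitHess y u (v 2)) (splitHess y u (v 3))
      + 128 / 5 * c₁ ^ 3 * bsR c₀ c₁ y ^ (-(9 / 5) : ℝ) * (1 + ‖y.1‖ ^ 2) ^ 3 *
        (⟪y.2, covD y u⟫ *
          qvol (covD y (v 0)) (covD y (v 1)) (covD y (v 2)) (covD y (v 3)))
      + -16 * c₁ ^ 2 * bsR c₀ c₁ y ^ (-(4 / 5) : ℝ) * (1 + ‖y.1‖ ^ 2) ^ 2 *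
        slotSum qvol (covD y (v 0)) (covD y (v 1)) (covD y (v 2)) (covD y (v 3))
          (covHess y u (v 0)) (covHess y u (v 1)) (covHess y u (v 2)) (covHess y u (v 3)) := by
  have hs := one_add_norm_pos y.1
  refine fderiv_apply_eq ?_ ?_
  · have h := isSmoothForm_bsForm hc₀ hc₁ p v
    rw [extChartAt_target_eq, contDiffOn_univ] at h
    exact h.differentiable (by simp) y
  · simp only [coordForm_bsForm_rpow hc₀ hc₁]
    have h4 := ((hasDerivAt_rpow_bsR hc₀ hc₁ y u (6 / 5)).mul (hasDerivAt_inv_pow_four y u)).const_mul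
      (400 * qvol (v 0).1 (v 1).1 (v 2).1 (v 3).1)
    have h2 := ((hasDerivAt_rpow_bsR hc₀ hc₁ y u (1 / 5)).mul
      (hasDerivAt_qmixed_split y u (v 0) (v 1) (v 2) (v 3))).const_mul (80 * c₁)
    have h0 := ((hasDerivAt_rpow_bsR hc₀ hc₁ y u (-(4 / 5))).mul
      (hasDerivAt_qvol_covD y u (v 0) (v 1) (v 2) (v 3))).const_mul (16 * c₁ ^ 2)
    refine (((h4.add h2).sub h0).congr_deriv ?_).congr_of_eventuallyEq ?_
    · simp only [zero_smul, add_zero]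
      rw [show (6 / 5 : ℝ) - 1 = 1 / 5 by norm_num, show (1 / 5 : ℝ) - 1 = -(4 / 5) by norm_num,
        show (-(4 / 5) : ℝ) - 1 = -(9 / 5) by norm_num]
      field_simp
      ring
    · refine Filter.Eventually.of_forall fun t => ?_
      simp only [Pi.add_apply, Pi.sub_apply, Pi.mul_apply]
      ring

theorem altSum_combination {V : Type*} (F₁ F₂ F₃ F₄ F₅ F₆ : V → V → V → V → V → ℝ)
    (k₁ k₂ k₃ k₄ k₅ k₆ : ℝ) (v : Fin 5 → V) :
    altSum (fun u a b c d => k₁ * F₁ u a b c d + k₂ * F₂ u a b c d + k₃ * F₃ u a b c d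
      + k₄ * F₄ u a b c d + k₅ * F₅ u a b c d + k₆ * F₆ u a b c d) v =
    k₁ * altSum F₁ v + k₂ * altSum F₂ v + k₃ * altSum F₃ v + k₄ * altSum F₄ v
      + k₅ * altSum F₅ v + k₆ * altSum F₆ v := by
  simp only [altSum]
  ring

theorem sum_succAbove_eq_altSum {V : Type*} (G : V → V → V → V → V → ℝ) (v : Fin 5 → V) :
    ∑ i : Fin 5, (-1 : ℝ) ^ (i : ℕ) * G (v i) (v (i.succAbove 0)) (v (i.succAbove 1))
      (v (i.succAbove 2)) (v (i.succAbove 3)) = altSum G v := by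
  rw [Fin.sum_univ_five, altSum]
  change (-1 : ℝ) ^ 0 * G (v 0) (v 1) (v 2) (v 3) (v 4) +
    (-1 : ℝ) ^ 1 * G (v 1) (v 0) (v 2) (v 3) (v 4) + (-1 : ℝ) ^ 2 * G (v 2) (v 0) (v 1) (v 3) (v 4)
    + (-1 : ℝ) ^ 3 * G (v 3) (v 0) (v 1) (v 2) (v 4)
    + (-1 : ℝ) ^ 4 * G (v 4) (v 0) (v 1) (v 2) (v 3) = _
  ring

/-- After alternation the second and fifth terms are five-forms on ℍ and vanish. The fourth cancels
the first because 80·12 = 960, and the sixth cancels the third because 16·2 = 32. -/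
theorem isClosedForm_bsForm {c₀ c₁ : ℝ} (hc₀ : 0 < c₀) (hc₁ : 0 < c₁) :
    IsClosedForm (bsForm c₀ c₁) := by
  intro p v
  set y := extChartAt 𝓘(ℝ, Model) p p
  have hs := one_add_norm_pos y.1
  simp only [fderiv_coordForm_bsForm hc₀ hc₁]
  have h := altSum_combination
    (fun u a b c d => ⟪y.2, covD y u⟫ * qvol a.1 b.1 c.1 d.1)
    (fun u a b c d : Model => ⟪y.1, u.1⟫ * qvol a.1 b.1 c.1 d.1)
    (fun u a b c d => ⟪y.2, covD y u⟫ * qmixed (split y a) (split y b) (split y c) (split y d))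
    (fun u a b c d => slotSum qmixed (split y a) (split y b) (split y c) (split y d)
      (splitHess y u a) (splitHess y u b) (splitHess y u c) (splitHess y u d))
    (fun u a b c d => ⟪y.2, covD y u⟫ * qvol (covD y a) (covD y b) (covD y c) (covD y d))
    (fun u a b c d => slotSum qvol (covD y a) (covD y b) (covD y c) (covD y d)
      (covHess y u a) (covHess y u b) (covHess y u c) (covHess y u d))
    (960 * c₁ * bsR c₀ c₁ y ^ (1 / 5 : ℝ) * ((1 + ‖y.1‖ ^ 2) ^ 3)⁻¹)
    (-3200 * bsR c₀ c₁ y ^ (6 / 5 : ℝ) * ((1 + ‖y.1‖ ^ 2) ^ 5)⁻¹)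
    (32 * c₁ ^ 2 * bsR c₀ c₁ y ^ (-(4 / 5) : ℝ))
    (80 * c₁ * bsR c₀ c₁ y ^ (1 / 5 : ℝ) * (1 + ‖y.1‖ ^ 2)⁻¹)
    (128 / 5 * c₁ ^ 3 * bsR c₀ c₁ y ^ (-(9 / 5) : ℝ) * (1 + ‖y.1‖ ^ 2) ^ 3)
    (-16 * c₁ ^ 2 * bsR c₀ c₁ y ^ (-(4 / 5) : ℝ) * (1 + ‖y.1‖ ^ 2) ^ 2) v
  have hA2 : altSum (fun u a b c d : Model => ⟪y.1, u.1⟫ * qvol a.1 b.1 c.1 d.1) v = 0 :=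
    altSum_inner_qvol y.1 fun i => (v i).1
  have hA5 : altSum (fun u a b c d => ⟪y.2, covD y u⟫ *
      qvol (covD y a) (covD y b) (covD y c) (covD y d)) v = 0 :=
    altSum_inner_qvol y.2 fun i => covD y (v i)
  have hA4 := altSum_slotSum qmixed qmixed_swap_one qmixed_swap_two qmixed_swap_three qmixed_add
    (split y) (splitHess y) v
  have hA6 := altSum_slotSum qvol qvol_swap_one qvol_swap_two qvol_swap_three qvol_add
    (covD y) (covHess y) v
  have hpm : ∀ (k : ℝ) (A : Fin 5 → Fin 5 → Model) (w : Fin 5 → Model),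
      pairSum qmixed (fun i j => k • A i j) w = k * pairSum qmixed A w := fun k A w => by
    simp only [pairSum, qmixed_smul]
    ring
  have hpv : ∀ (k : ℝ) (A : Fin 5 → Fin 5 → ℍ[ℝ]) (w : Fin 5 → ℍ[ℝ]),
      pairSum qvol (fun i j => k • A i j) w = k * pairSum qvol A w := fun k A w => by
    simp only [pairSum, qvol_smul_one]
    ring
  simp only [splitHess_sub] at hA4
  simp only [covHess_sub] at hA6
  rw [hpm] at hA4
  rw [hpv] at hA6
  have hB4 := pairSum_qmixed y.2 fun i => split y (v i)
  have hB6 := pairSum_qvol y.2 fun i => split y (v i)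
  refine (sum_succAbove_eq_altSum _ v).trans (h.trans ?_)
  have hC4 := hA4.trans (congrArg (((1 + ‖y.1‖ ^ 2) ^ 2)⁻¹ * ·) hB4)
  have hC6 := hA6.trans (congrArg (((1 + ‖y.1‖ ^ 2) ^ 2)⁻¹ * ·) hB6)
  rw [hA2, hA5, hC4, hC6]
  simp only [altSum, split]
  field_simp
  ring

end NegSpinorBundle

/-! ### The divergence in an orthonormal basis -/

section Divergence

variable {E F ι : Type*} [NormedAddCommGroup E] [NormedSpace ℝ E] [FiniteDimensional ℝ E]
  [NormedAddCommGroup F] [NormedSpace ℝ F] [Fintype ι] [DecidableEq ι]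

/-- On the diagonal the first two terms of the Christoffel formula coincide, which removes their
factor ½. This is the divergence when the target Christoffel term is absent. -/
theorem metricTrace_sub_christoffel (G : E → E → E → ℝ) (y : E)
    (H : E →ₗ[ℝ] E →ₗ[ℝ] ℝ) (hH : ∀ v w, G y v w = H v w) (D : E →ₗ[ℝ] E →ₗ[ℝ] E →ₗ[ℝ] ℝ)
    (hD : ∀ u v w, fderiv ℝ (fun t => G t v w) y u = D u v w) (e : Module.Basis ι ℝ E)
    (he : ∀ i j, H (e i) (e j) = if i = j then 1 else 0) (T : E →L[ℝ] E →L[ℝ] F) (f : E →L[ℝ] F) :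
    metricTrace (G y) (fun v w => T v w - f (christoffel G y v w)) =
      ∑ k, T (e k) (e k) -
        ∑ i, (∑ k, (D (e k) (e k) (e i) - (1 / 2) * D (e i) (e k) (e k))) • f (e i) := by
  have h1 : G y = fun v w => H v w := by ext; exact hH _ _
  let B : E →ₗ[ℝ] E →ₗ[ℝ] F := LinearMap.mk₂ ℝ
    (fun v w => T v w -
      ∑ i, ((1 / 2 : ℝ) * (D v w (e i) + D w v (e i) - D (e i) v w)) • f (e i))
    (fun v v' w => by
      simp only [map_add, LinearMap.add_apply, _root_.add_apply]
      rw [sub_add_sub_comm, ← Finset.sum_add_distrib]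
      congr 1
      refine Finset.sum_congr rfl fun i _ => ?_
      module)
    (fun c v w => by
      simp only [map_smul, LinearMap.smul_apply, _root_.smul_apply, smul_eq_mul]
      rw [smul_sub, Finset.smul_sum]
      congr 1
      refine Finset.sum_congr rfl fun i _ => ?_
      module)
    (fun v w w' => by
      simp only [map_add, LinearMap.add_apply]
      rw [sub_add_sub_comm, ← Finset.sum_add_distrib]
      congr 1
      refine Finset.sum_congr rfl fun i _ => ?_
      module)
    (fun c v w => by
      simp only [map_smul, LinearMap.smul_apply, smul_eq_mul]
      rw [smul_sub, Finset.smul_sum]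
      congr 1
      refine Finset.sum_congr rfl fun i _ => ?_
      module)
  have h2 : (fun v w => T v w - f (christoffel G y v w)) = fun v w => B v w := by
    funext v w
    rw [christoffel_eq_sum G y H hH D hD e he, map_sum]
    simp only [map_smul]
    rfl
  have h3 := metricTrace_eq_sum H B e he
  rw [h2, h1, h3]
  simp only [B, LinearMap.mk₂_apply]
  rw [Finset.sum_sub_distrib]
  congr 1
  rw [Finset.sum_comm]
  refine Finset.sum_congr rfl fun i _ => ?_
  rw [Finset.sum_smul]
  refine Finset.sum_congr rfl fun k _ => ?_
  congr 1
  ring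

end Divergence

/-! ### Vanishing target Christoffel symbols and second derivatives. -/

theorem christoffel_eq_zero {E : Type*} [NormedAddCommGroup E] [NormedSpace ℝ E]
    [FiniteDimensional ℝ E] (G : E → E → E → ℝ) (y : E)
    (h : ∀ v w, fderiv ℝ (fun t => G t v w) y = 0) (v w : E) : christoffel G y v w = 0 := by
  simp [christoffel, metricTrace, h]

/-- The conformal factor 16 (|y|² + 4)⁻² is critical at the origin, where the preferred chart puts
its centre. -/
theorem christoffel_roundMetric (x : S4) (v w : EuclideanSpace ℝ (Fin 4)) :
    christoffel (coordBilin roundMetric x) 0 v w = 0 := by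
  refine christoffel_eq_zero _ _ (fun v w => ?_) _ _
  simp only [coordBilin_roundMetric]
  have h1 : HasFDerivAt (fun y : EuclideanSpace ℝ (Fin 4) => ‖y‖ ^ 2 + 4)
      (0 : EuclideanSpace ℝ (Fin 4) →L[ℝ] ℝ) 0 := by
    have := ((hasStrictFDerivAt_norm_sq (0 : EuclideanSpace ℝ (Fin 4))).hasFDerivAt).add_const
      (4 : ℝ)
    simpa using this
  have h3 : HasDerivAt (fun r : ℝ => 16 * (r ^ 2)⁻¹ * ⟪v, w⟫)
      (16 * (-(2 * 4) / (4 ^ 2) ^ 2) * ⟪v, w⟫) (‖(0 : EuclideanSpace ℝ (Fin 4))‖ ^ 2 + 4) := by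
    have h := (((hasDerivAt_pow 2 (‖(0 : EuclideanSpace ℝ (Fin 4))‖ ^ 2 + 4)).inv
      (by simp)).const_mul (16 : ℝ)).mul_const ⟪v, w⟫
    refine h.congr_deriv ?_
    simp
  have h2 := h3.comp_hasFDerivAt (0 : EuclideanSpace ℝ (Fin 4)) h1
  rw [smul_zero] at h2
  exact h2.fderiv

/-- The coefficients of a field of bilinear forms at a point, as a bilinear form. -/
def coordBilinLin {E : Type*} [NormedAddCommGroup E] [NormedSpace ℝ E] {M : Type*}
    [TopologicalSpace M] [ChartedSpace E M] (h : BilinField E M) (x : M) (y : E) :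
    E →ₗ[ℝ] E →ₗ[ℝ] ℝ :=
  (h ((extChartAt 𝓘(ℝ, E) x).symm y)).compl₁₂
    (mfderiv 𝓘(ℝ, E) 𝓘(ℝ, E) (extChartAt 𝓘(ℝ, E) x).symm y).toLinearMap
    (mfderiv 𝓘(ℝ, E) 𝓘(ℝ, E) (extChartAt 𝓘(ℝ, E) x).symm y).toLinearMap

theorem coordBilinLin_apply {E : Type*} [NormedAddCommGroup E] [NormedSpace ℝ E] {M : Type*}
    [TopologicalSpace M] [ChartedSpace E M] (h : BilinField E M) (x : M) (y v w : E) :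
    coordBilinLin h x y v w = coordBilin h x y v w := rfl

/-- The first derivatives of the coefficients of a metric. -/
def coordBilinDeriv {E : Type*} [NormedAddCommGroup E] [NormedSpace ℝ E] {M : Type*}
    [TopologicalSpace M] [ChartedSpace E M] (h : BilinField E M) (x : M) (y : E)
    (hd : ∀ v w, DifferentiableAt ℝ (fun t => coordBilin h x t v w) y) :
    E →ₗ[ℝ] E →ₗ[ℝ] E →ₗ[ℝ] ℝ where
  toFun u := LinearMap.mk₂ ℝ (fun v w => fderiv ℝ (fun t => coordBilin h x t v w) y u)
    (fun v v' w => by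
      have : (fun t => coordBilin h x t (v + v') w) = fun t =>
        coordBilin h x t v w + coordBilin h x t v' w := by
        funext t
        simp only [← coordBilinLin_apply, map_add, LinearMap.add_apply]
      rw [this, fderiv_fun_add (hd v w) (hd v' w)]
      rfl)
    (fun c v w => by
      have : (fun t => coordBilin h x t (c • v) w) = fun t => c * coordBilin h x t v w := by
        funext t
        simp only [← coordBilinLin_apply, map_smul, LinearMap.smul_apply, smul_eq_mul]
      rw [this, fderiv_const_mul (hd v w)]
      rfl)
    (fun v w w' => by
      have : (fun t => coordBilin h x t v (w + w')) = fun t =>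
        coordBilin h x t v w + coordBilin h x t v w' := by
        funext t
        simp only [← coordBilinLin_apply, map_add]
      rw [this, fderiv_fun_add (hd v w) (hd v w')]
      rfl)
    (fun c v w => by
      have : (fun t => coordBilin h x t v (c • w)) = fun t => c * coordBilin h x t v w := by
        funext t
        simp only [← coordBilinLin_apply, map_smul, smul_eq_mul]
      rw [this, fderiv_const_mul (hd v w)]
      rfl)
  map_add' u u' := by
    ext v w
    simp
  map_smul' c u := by
    ext v w
    simp

/-- All terms of the product rule but one contain dλ or S at y. This lets the conformal factor
between two stereographic charts be ignored to second order. -/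
theorem fderiv_fderiv_smul_of_critical {E F : Type*} [NormedAddCommGroup E] [NormedSpace ℝ E]
    [NormedAddCommGroup F] [NormedSpace ℝ F] {lam : E → ℝ} {S : E → F} {y : E}
    (hl : ContDiffAt ℝ 2 lam y) (hS : ContDiffAt ℝ 2 S y) (h1 : lam y = 1)
    (hd : fderiv ℝ lam y = 0) (h0 : S y = 0) (v w : E) :
    fderiv ℝ (fderiv ℝ fun t => lam t • S t) y v w = fderiv ℝ (fderiv ℝ S) y v w := by
  have e1 : fderiv ℝ (fun t => lam t • S t) =ᶠ[nhds y]
      fun t => lam t • fderiv ℝ S t + (fderiv ℝ lam t).smulRight (S t) := by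
    filter_upwards [hl.eventually (by simp), hS.eventually (by simp)] with t ht ht'
    exact fderiv_fun_smul (ht.differentiableAt (by simp)) (ht'.differentiableAt (by simp))
  have dl : HasFDerivAt (fderiv ℝ lam) (fderiv ℝ (fderiv ℝ lam) y) y :=
    ((hl.fderiv_right (m := 1) (by norm_num)).differentiableAt (by simp)).hasFDerivAt
  have dS : HasFDerivAt (fderiv ℝ S) (fderiv ℝ (fderiv ℝ S) y) y :=
    ((hS.fderiv_right (m := 1) (by norm_num)).differentiableAt (by simp)).hasFDerivAt
  have dl0 := (hl.differentiableAt (by simp)).hasFDerivAt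
  have dS0 := (hS.differentiableAt (by simp)).hasFDerivAt
  have e2 : HasFDerivAt (fun t => lam t • fderiv ℝ S t + (fderiv ℝ lam t).smulRight (S t))
      _ y := (dl0.smul dS).add
        ((ContinuousLinearMap.smulRightL ℝ E F).hasFDerivAt_of_bilinear dl dS0)
  rw [e1.fderiv_eq, e2.fderiv]
  simp [h1, hd, h0]

namespace NegSpinorBundle

/-! ### The projection is `4`-harmonic -/

/-- The second derivative of inverse stereographic projection. -/
def stereoDD (q V W : ℍ[ℝ]) : EuclideanSpace ℝ (Fin 5) :=
  -((4 * ⟪q, V⟫ * ((1 + ‖q‖ ^ 2) ^ 2)⁻¹) • quatVec W)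
    - (2 * ⟪V, W⟫ * (1 + ‖q‖ ^ 2)⁻¹ - 4 * ⟪q, W⟫ * ⟪q, V⟫ * ((1 + ‖q‖ ^ 2) ^ 2)⁻¹) •
      (stereoInv q + northPole)
    - (2 * ⟪q, W⟫ * (1 + ‖q‖ ^ 2)⁻¹) • stereoD q V

theorem hasDerivAt_stereoD (q V W : ℍ[ℝ]) :
    HasDerivAt (fun t : ℝ => stereoD (q + t • V) W) (stereoDD q V W) 0 := by
  have hl : HasDerivAt (fun t : ℝ => q + t • V) V 0 := by
    simpa using ((hasDerivAt_id (0 : ℝ)).smul_const V).const_add q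
  have hq : q + (0 : ℝ) • V = q := by simp
  have h1 : HasDerivAt (fun t : ℝ => 2 * (1 + ‖q + t • V‖ ^ 2)⁻¹)
      (-(4 * ⟪q, V⟫ * ((1 + ‖q‖ ^ 2) ^ 2)⁻¹)) 0 := by
    have h := (((hasFDerivAt_inv_one_add_norm_sq (q + (0 : ℝ) • V)).comp_hasDerivAt (0 : ℝ)
      hl).const_mul (2 : ℝ))
    refine h.congr_deriv ?_
    rw [hq]
    simp
    ring
  have h2 : HasDerivAt (fun t : ℝ => stereoInv (q + t • V)) (stereoD q V) 0 := by
    have h := (hasFDerivAt_stereoInv (q + (0 : ℝ) • V)).comp_hasDerivAt (0 : ℝ) hl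
    rw [hq] at h
    exact h
  have h3 : HasDerivAt (fun t : ℝ => ⟪q + t • V, W⟫) ⟪V, W⟫ 0 := by
    have h := hl.inner ℝ (hasDerivAt_const (0 : ℝ) W)
    simpa using h
  have h := (h1.smul_const (quatVec W)).sub ((h3.mul h1).smul (h2.add_const northPole))
  simp only [stereoD_apply]
  refine h.congr_deriv ?_
  simp only [hq, stereoDD, Pi.mul_apply]
  module

theorem sum_inner_smul_qbasis {V : Type*} [AddCommGroup V] [Module ℝ V] (q : ℍ[ℝ])
    (f : ℍ[ℝ] →ₗ[ℝ] V) : ∑ i, ⟪q, qbasis i⟫ • f (qbasis i) = f q := by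
  have h : ∀ i, ⟪q, qbasis i⟫ = qbasis.repr q i := fun i => by
    rw [quaternion_inner, qbasis_repr, qbasis_apply]
    fin_cases i <;> simp
  simp only [h, ← map_smul, ← map_sum]
  rw [Module.Basis.sum_repr]

theorem inner_qbasis (i j : Fin 4) : ⟪qbasis i, qbasis j⟫ = if i = j then (1 : ℝ) else 0 := by
  rw [quaternion_inner, qbasis_apply, qbasis_apply]
  fin_cases i <;> fin_cases j <;> simp

/-- Up to the factor s²/4 the left side is the Laplacian of the conformal metric 4 s⁻² |dq|² in
dimension four, and linear functions on S⁴ have eigenvalue 4. Only normality to the sphere matters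
later. -/
theorem sum_stereoDD (q : ℍ[ℝ]) : ∑ i, stereoDD q (qbasis i) (qbasis i) -
    (4 * (1 + ‖q‖ ^ 2)⁻¹) • stereoD q q = -((16 * ((1 + ‖q‖ ^ 2) ^ 2)⁻¹) • stereoInv q) := by
  have hs := one_add_norm_pos q
  have h1 := sum_inner_smul_qbasis q quatVec.toLinearMap
  have h2 := sum_inner_smul_qbasis q (stereoD q).toLinearMap
  have h3 : ∑ i, ⟪q, qbasis i⟫ * ⟪q, qbasis i⟫ = ‖q‖ ^ 2 := by
    rw [← real_inner_self_eq_norm_sq]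
    exact sum_inner_smul_qbasis q (innerₗ ℍ[ℝ] q)
  have h4 : ∀ i, stereoDD q (qbasis i) (qbasis i) =
      -(4 * ((1 + ‖q‖ ^ 2) ^ 2)⁻¹) • (⟪q, qbasis i⟫ • quatVec (qbasis i))
      - (2 * (1 + ‖q‖ ^ 2)⁻¹) • (stereoInv q + northPole)
      + (⟪q, qbasis i⟫ * ⟪q, qbasis i⟫) • (4 * ((1 + ‖q‖ ^ 2) ^ 2)⁻¹) • (stereoInv q + northPole)
      - (2 * (1 + ‖q‖ ^ 2)⁻¹) • (⟪q, qbasis i⟫ • stereoD q (qbasis i)) := fun i => by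
    rw [stereoDD, inner_qbasis, if_pos rfl]
    module
  simp only [h4, Finset.sum_sub_distrib, Finset.sum_add_distrib, ← Finset.smul_sum,
    ← Finset.sum_smul]
  change -(4 * ((1 + ‖q‖ ^ 2) ^ 2)⁻¹) • (∑ i, ⟪q, qbasis i⟫ • quatVec.toLinearMap (qbasis i)) - _
    + _ - (2 * (1 + ‖q‖ ^ 2)⁻¹) •
      (∑ i, ⟪q, qbasis i⟫ • (stereoD q).toLinearMap (qbasis i)) - _ = _
  rw [h1, h2, h3]
  change -(4 * ((1 + ‖q‖ ^ 2) ^ 2)⁻¹) • quatVec q - _ + _ - _ • stereoD q q - _ = _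
  rw [stereoD_apply, real_inner_self_eq_norm_sq, stereoInv_eq]
  simp only [Finset.sum_const, Finset.card_univ, Fintype.card_fin]
  match_scalars <;> field_simp <;> ring

variable {F : Type*} [NormedAddCommGroup F] [NormedSpace ℝ F]

theorem comp_stereoInv_contDiff (Q : EuclideanSpace ℝ (Fin 5) →L[ℝ] F) :
    ContDiff ℝ ∞ fun y : Model => Q (stereoInv y.1) :=
  Q.contDiff.comp (stereoInv_contDiff.comp contDiff_fst)

theorem fderiv_comp_stereoInv (Q : EuclideanSpace ℝ (Fin 5) →L[ℝ] F) (y v : Model) :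
    fderiv ℝ (fun y : Model => Q (stereoInv y.1)) y v = Q (stereoD y.1 v.1) := by
  have h := Q.hasFDerivAt.comp y
    ((hasFDerivAt_stereoInv y.1).comp y (hasFDerivAt_fst (𝕜 := ℝ) (p := y)))
  exact congrArg (fun T : Model →L[ℝ] F => T v) h.fderiv

theorem fderiv_fderiv_comp_stereoInv (Q : EuclideanSpace ℝ (Fin 5) →L[ℝ] F) (y v w : Model) :
    fderiv ℝ (fderiv ℝ fun y : Model => Q (stereoInv y.1)) y v w = Q (stereoDD y.1 v.1 w.1) := by
  have hd : DifferentiableAt ℝ (fderiv ℝ fun y : Model => Q (stereoInv y.1)) y :=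
    ((comp_stereoInv_contDiff Q).fderiv_right (m := ∞) (by simp)).differentiable (by simp) y
  have h1 := fderiv_clm_apply hd (differentiableAt_const w)
  have h2 : fderiv ℝ (fun t => fderiv ℝ (fun y : Model => Q (stereoInv y.1)) t w) y v =
      Q (stereoDD y.1 v.1 w.1) := by
    refine fderiv_apply_eq (hd.clm_apply (differentiableAt_const w)) ?_
    simp only [fderiv_comp_stereoInv]
    exact Q.hasFDerivAt.comp_hasDerivAt (0 : ℝ) (hasDerivAt_stereoD y.1 v.1 w.1)
  rw [← h2, h1]
  simp

/-- The conformal factor that relates two stereographic charts. -/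
def chartFactor (q : ℍ[ℝ]) (y : Model) : ℝ := 2 / (1 + ⟪stereoInv q, stereoInv y.1⟫)

theorem inner_stereoInv_self (q : ℍ[ℝ]) : ⟪stereoInv q, stereoInv q⟫ = (1 : ℝ) := by
  have h := one_add_norm_pos q
  rw [inner_eq_quat, quat_stereoInv, stereoInv_four, real_inner_smul_left, real_inner_smul_right,
    real_inner_self_eq_norm_sq]
  field_simp
  ring

theorem chartFactor_contDiffAt (y : Model) : ContDiffAt ℝ 2 (chartFactor y.1) y := by
  have h : ContDiff ℝ 2 fun z : Model => 1 + ⟪stereoInv y.1, stereoInv z.1⟫ :=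
    contDiff_const.add (contDiff_const.inner ℝ
      ((stereoInv_contDiff.comp contDiff_fst).of_le (WithTop.coe_le_coe.2 le_top)))
  refine contDiffAt_const.div h.contDiffAt ?_
  rw [inner_stereoInv_self]
  norm_num

theorem chartFactor_self (y : Model) : chartFactor y.1 y = 1 := by
  rw [chartFactor, inner_stereoInv_self]
  norm_num

theorem fderiv_chartFactor (y : Model) : fderiv ℝ (chartFactor y.1) y = 0 := by
  have h0 : HasFDerivAt (fun z : Model => 1 + ⟪stereoInv y.1, stereoInv z.1⟫)
      (0 : Model →L[ℝ] ℝ) y := by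
    have h := ((innerSL ℝ (stereoInv y.1)).hasFDerivAt.comp y
      ((hasFDerivAt_stereoInv y.1).comp y (hasFDerivAt_fst (𝕜 := ℝ) (p := y)))).const_add (1 : ℝ)
    refine h.congr_fderiv ?_
    refine ContinuousLinearMap.ext fun v => ?_
    exact inner_stereoInv_stereoD y.1 v.1
  have h1 : HasDerivAt (fun r : ℝ => 2 / r) (2 * (-((1 + ⟪stereoInv y.1, stereoInv y.1⟫) ^ 2)⁻¹))
      (1 + ⟪stereoInv y.1, stereoInv y.1⟫) := by
    have hne : 1 + ⟪stereoInv y.1, stereoInv y.1⟫ ≠ (0 : ℝ) := by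
      rw [inner_stereoInv_self]; norm_num
    simp only [div_eq_mul_inv]
    exact (hasDerivAt_inv hne).const_mul 2
  have h2 := h1.comp_hasFDerivAt y h0
  rw [smul_zero] at h2
  exact h2.fderiv

/-- `Q` is the projection killing the normal at u(p), composed with the isometry of the chart;
`chartFactor` is the change of scale to the stereographic chart centred at u(p). -/
theorem exists_writtenInExtChartAt_proj (p : NegSpinorBundle) :
    ∃ Q : EuclideanSpace ℝ (Fin 5) →L[ℝ] EuclideanSpace ℝ (Fin 4),
      Q (stereoInv (extChartAt 𝓘(ℝ, Model) p p).1) = 0 ∧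
      writtenInExtChartAt 𝓘(ℝ, Model) (𝓡 4) p proj = fun y =>
        chartFactor (extChartAt 𝓘(ℝ, Model) p p).1 y • Q (stereoInv y.1) := by
  obtain ⟨L, S, hLS, hc⟩ := exists_chart p
  obtain ⟨J, P, -, hP, -, hφ, -⟩ := exists_sphere_chart (proj p)
  have hx : (proj p : EuclideanSpace ℝ (Fin 5)) =
      L (stereoInv (extChartAt 𝓘(ℝ, Model) p p).1) := by
    rw [← (hc _).1, extChartAt_to_inv]
  refine ⟨P ∘L L.toContinuousLinearMap, ?_, ?_⟩
  · rw [hx] at hP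
    exact hP
  · funext y
    have h := hφ (proj ((extChartAt 𝓘(ℝ, Model) p).symm y))
    rw [(hc y).1, hx, hLS.inner_base] at h
    exact h

end NegSpinorBundle

/-! ### The trace of the Christoffel symbols and the 4-tension. -/

namespace NegSpinorBundle

variable {c₀ c₁ : ℝ}

theorem fderiv_coordBilin_bsMetric (hc₀ : 0 < c₀) (hc₁ : 0 < c₁) (p : NegSpinorBundle)
    (y u v w : Model) : fderiv ℝ (fun t => coordBilin (bsMetric c₀ c₁) p t v w) y u =
      fderiv ℝ (coordA c₀ c₁) y u * ⟪v.1, w.1⟫ + fderiv ℝ (coordB c₀ c₁) y u * ⟪covD y v, covD y w⟫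
        + coordB c₀ c₁ y * (⟪covD y v, covDeriv y u w⟫ + ⟪covDeriv y u v, covD y w⟫) := by
  have hA : HasDerivAt (fun t : ℝ => coordA c₀ c₁ (y + t • u)) (fderiv ℝ (coordA c₀ c₁) y u) 0 := by
    have h := (((coordA_contDiff hc₀ hc₁).differentiable (by simp)) (y + (0 : ℝ) • u)).hasFDerivAt
    have h' := h.comp_hasDerivAt (0 : ℝ) (hasDerivAt_line y u)
    rwa [zero_smul, add_zero] at h'
  have hB : HasDerivAt (fun t : ℝ => coordB c₀ c₁ (y + t • u)) (fderiv ℝ (coordB c₀ c₁) y u) 0 := by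
    have h := (((coordB_contDiff hc₀ hc₁).differentiable (by simp)) (y + (0 : ℝ) • u)).hasFDerivAt
    have h' := h.comp_hasDerivAt (0 : ℝ) (hasDerivAt_line y u)
    rwa [zero_smul, add_zero] at h'
  have hd : ContDiff ℝ ∞ fun t => coordBilin (bsMetric c₀ c₁) p t v w := by
    simp only [coordBilin_bsMetric hc₀ hc₁]
    exact ((coordA_contDiff hc₀ hc₁).mul contDiff_const).add ((coordB_contDiff hc₀ hc₁).mul
      ((covD_contDiff v).inner ℝ (covD_contDiff w)))
  refine fderiv_apply_eq (hd.differentiable (by simp) y) ?_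
  simp only [coordBilin_bsMetric hc₀ hc₁]
  have h := (hA.mul_const ⟪v.1, w.1⟫).add
    (hB.mul ((hasDerivAt_covD y u v).inner ℝ (hasDerivAt_covD y u w)))
  refine HasDerivAt.congr_deriv h ?_
  simp only [zero_smul, add_zero]
  ring

/-- In horizontal directions r is constant, so only the factor s⁻² is differentiated. -/
theorem fderiv_coordA_of_covD_eq_zero (hc₀ : 0 < c₀) (hc₁ : 0 < c₁) {y u : Model}
    (hu : covD y u = 0) : fderiv ℝ (coordA c₀ c₁) y u =
      -(4 * coordA c₀ c₁ y * ⟪y.1, u.1⟫ * (1 + ‖y.1‖ ^ 2)⁻¹) := by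
  have hs := one_add_norm_pos y.1
  refine fderiv_apply_eq ((coordA_contDiff hc₀ hc₁).differentiable (by simp) y) ?_
  have h := ((hasDerivAt_rpow_bsR hc₀ hc₁ y u (3 / 5)).const_mul (5 : ℝ)).mul
    ((((hasDerivAt_line_norm_sq y u).pow 2).inv
      (pow_ne_zero 2 (one_add_norm_pos _).ne')).const_mul (4 : ℝ))
  refine HasDerivAt.congr_deriv h ?_
  simp only [hu, inner_zero_right, zero_smul, add_zero, coordA, coordW2, Pi.pow_apply]
  field_simp
  ring

theorem fderiv_coordB_of_covD_eq_zero (hc₀ : 0 < c₀) (hc₁ : 0 < c₁) {y u : Model}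
    (hu : covD y u = 0) : fderiv ℝ (coordB c₀ c₁) y u =
      2 * coordB c₀ c₁ y * ⟪y.1, u.1⟫ * (1 + ‖y.1‖ ^ 2)⁻¹ := by
  have hs := one_add_norm_pos y.1
  refine fderiv_apply_eq ((coordB_contDiff hc₀ hc₁).differentiable (by simp) y) ?_
  have h := ((hasDerivAt_rpow_bsR hc₀ hc₁ y u (-(2 / 5))).const_mul (4 * c₁)).mul
    (hasDerivAt_line_norm_sq y u)
  refine HasDerivAt.congr_deriv h ?_
  simp only [hu, inner_zero_right, zero_smul, add_zero, coordB, coordV2]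
  field_simp
  ring

theorem contDiff_four_div_coordW2 (hc₀ : 0 < c₀) (hc₁ : 0 < c₁) :
    ContDiff ℝ ∞ fun y => 4 / coordW2 c₀ c₁ y :=
  contDiff_const.div (coordW2_contDiff hc₀ hc₁) fun y => (coordW2_pos hc₀ hc₁ y).ne'

theorem fderiv_four_div_coordW2_of_covD_eq_zero (hc₀ : 0 < c₀) (hc₁ : 0 < c₁) {y u : Model}
    (hu : covD y u = 0) : fderiv ℝ (fun y => 4 / coordW2 c₀ c₁ y) y u = 0 := by
  refine fderiv_apply_eq
    ((contDiff_four_div_coordW2 hc₀ hc₁).differentiable (by simp) y) ?_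
  have h := (((hasDerivAt_rpow_bsR hc₀ hc₁ y u (3 / 5)).const_mul (5 : ℝ)).inv
    (coordW2_pos hc₀ hc₁ _).ne').const_mul (4 : ℝ)
  refine HasDerivAt.congr_deriv h ?_
  simp [hu]

theorem inner_mul_self_right (q d : ℍ[ℝ]) : ⟪d, q * d⟫ = q.re * ‖d‖ ^ 2 := by
  rw [← real_inner_self_eq_norm_sq, quaternion_inner, quaternion_inner]
  simp only [Quaternion.re_mul, Quaternion.imI_mul, Quaternion.imJ_mul, Quaternion.imK_mul]
  ring

/-- Vertical vectors do not contribute to the trace of the Christoffel symbols. -/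
theorem christoffelTrace_vertical (hc₀ : 0 < c₀) (hc₁ : 0 < c₁) (p : NegSpinorBundle)
    {y u v : Model} (hu : u.1 = 0) (hv : covD y v = 0) :
    fderiv ℝ (fun t => coordBilin (bsMetric c₀ c₁) p t u v) y u -
      (1 / 2) * fderiv ℝ (fun t => coordBilin (bsMetric c₀ c₁) p t u u) y v = 0 := by
  have hs := one_add_norm_pos y.1
  -- The curvature vanishes on a vertical argument, so the two Hessians agree. The real part of the
  -- remaining connection term cancels the derivative of B.
  have h1 : covDeriv y u v = covDeriv y v u + (1 + ‖y.1‖ ^ 2)⁻¹ • (star y.1 * v.1 * covD y u) := by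
    have h := covHess_sub y u v
    rw [covHess, covHess, hu, hv] at h
    simp only [star_zero, zero_mul, mul_zero, sub_zero, smul_zero, add_zero] at h
    exact sub_eq_zero.1 h
  have h2 : (star y.1 * v.1).re = ⟪y.1, v.1⟫ := by
    rw [quaternion_inner]
    simp only [Quaternion.re_mul, Quaternion.re_star, Quaternion.imI_star, Quaternion.imJ_star,
      Quaternion.imK_star]
    ring
  have h3 := real_inner_self_eq_norm_sq (covD y u)
  rw [fderiv_coordBilin_bsMetric hc₀ hc₁, fderiv_coordBilin_bsMetric hc₀ hc₁,
    fderiv_coordB_of_covD_eq_zero hc₀ hc₁ hv, h1, hu, hv, inner_add_right, real_inner_smul_right,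
    inner_mul_self_right, h2, h3,
    real_inner_comm (covD y u) (covDeriv y v u)]
  simp only [inner_zero_left, inner_zero_right]
  ring

theorem christoffelTrace_horizontal (hc₀ : 0 < c₀) (hc₁ : 0 < c₁) (p : NegSpinorBundle)
    {y u v : Model} (hu : covD y u = 0) (hv : covD y v = 0) :
    fderiv ℝ (fun t => coordBilin (bsMetric c₀ c₁) p t u v) y u -
      (1 / 2) * fderiv ℝ (fun t => coordBilin (bsMetric c₀ c₁) p t u u) y v =
    (1 + ‖y.1‖ ^ 2)⁻¹ * (2 * ⟪y.1, v.1⟫ * (coordA c₀ c₁ y * ⟪u.1, u.1⟫)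
      - 4 * ⟪y.1, u.1⟫ * (coordA c₀ c₁ y * ⟪u.1, v.1⟫)) := by
  rw [fderiv_coordBilin_bsMetric hc₀ hc₁, fderiv_coordBilin_bsMetric hc₀ hc₁,
    fderiv_coordA_of_covD_eq_zero hc₀ hc₁ hv, fderiv_coordA_of_covD_eq_zero hc₀ hc₁ hu, hu, hv]
  simp only [inner_zero_left, inner_zero_right]
  ring

section Basis

variable (hc₀ : 0 < c₀) (hc₁ : 0 < c₁) (y : Model) (i : Fin 4)

theorem bsBasis_left_fst : (bsBasis hc₀ hc₁ y (Fin.castAdd 4 i)).1 = 0 := by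
  have h := bsFrame_fst hc₀ hc₁ y (bsBasis hc₀ hc₁ y (Fin.castAdd 4 i))
  rw [bsFrame_bsBasis_left] at h
  exact (smul_eq_zero.1 h.symm).resolve_left (Real.sqrt_pos.2 (coordA_pos hc₀ hc₁ y)).ne'

theorem bsBasis_right_fst : (bsBasis hc₀ hc₁ y (Fin.natAdd 4 i)).1 =
    (√(coordA c₀ c₁ y))⁻¹ • qbasis i := by
  have h := bsFrame_fst hc₀ hc₁ y (bsBasis hc₀ hc₁ y (Fin.natAdd 4 i))
  rw [bsFrame_bsBasis_right] at h
  rw [show qbasis i = _ from h, inv_smul_smul₀ (Real.sqrt_pos.2 (coordA_pos hc₀ hc₁ y)).ne']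

theorem covD_bsBasis_right : covD y (bsBasis hc₀ hc₁ y (Fin.natAdd 4 i)) = 0 := by
  have h := bsFrame_snd hc₀ hc₁ y (bsBasis hc₀ hc₁ y (Fin.natAdd 4 i))
  rw [bsFrame_bsBasis_right] at h
  exact (smul_eq_zero.1 h.symm).resolve_left (Real.sqrt_pos.2 (coordB_pos hc₀ hc₁ y)).ne'

/-- The vertical half vanishes. The horizontal half is a trace in dimension four: the two terms of
`christoffelTrace_horizontal` sum to 8 and -4 times s⁻¹ ⟨q, ·⟩. -/
theorem sum_christoffelTrace (p : NegSpinorBundle) :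
    ∑ k, (fderiv ℝ (fun t => coordBilin (bsMetric c₀ c₁) p t (bsBasis hc₀ hc₁ y k)
        (bsBasis hc₀ hc₁ y (Fin.natAdd 4 i))) y (bsBasis hc₀ hc₁ y k) -
      (1 / 2) * fderiv ℝ (fun t => coordBilin (bsMetric c₀ c₁) p t (bsBasis hc₀ hc₁ y k)
        (bsBasis hc₀ hc₁ y k)) y (bsBasis hc₀ hc₁ y (Fin.natAdd 4 i))) =
    4 * (1 + ‖y.1‖ ^ 2)⁻¹ * ((√(coordA c₀ c₁ y))⁻¹ * ⟪y.1, qbasis i⟫) := by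
  have hA := coordA_pos hc₀ hc₁ y
  have h1 : ∀ a b : Fin 4, coordA c₀ c₁ y * ⟪(√(coordA c₀ c₁ y))⁻¹ • qbasis a,
      (√(coordA c₀ c₁ y))⁻¹ • qbasis b⟫ = if a = b then (1 : ℝ) else 0 := fun a b => by
    rw [real_inner_smul_left, real_inner_smul_right, inner_qbasis, ← mul_assoc, ← mul_assoc,
      mul_assoc (coordA c₀ c₁ y), ← mul_inv, Real.mul_self_sqrt hA.le, mul_inv_cancel₀ hA.ne', one_mul]
  rw [Fin.sum_univ_add (a := 4) (b := 4)]
  rw [Finset.sum_eq_zero fun k _ => christoffelTrace_vertical hc₀ hc₁ p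
    (bsBasis_left_fst hc₀ hc₁ y k) (covD_bsBasis_right hc₀ hc₁ y i), zero_add]
  simp only [christoffelTrace_horizontal hc₀ hc₁ p (covD_bsBasis_right hc₀ hc₁ y _)
    (covD_bsBasis_right hc₀ hc₁ y i), bsBasis_right_fst, h1, if_true]
  rw [← Finset.mul_sum, Finset.sum_sub_distrib]
  simp only [mul_ite, mul_one, mul_zero, Finset.sum_ite_eq', Finset.mem_univ, if_true,
    Finset.sum_const, Finset.card_univ, Fintype.card_fin, real_inner_smul_right]
  ring

end Basis

theorem stereoDD_smul_smul (q V W : ℍ[ℝ]) (c : ℝ) :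
    stereoDD q (c • V) (c • W) = c ^ 2 • stereoDD q V W := by
  simp only [stereoDD, real_inner_smul_left, real_inner_smul_right, map_smul]
  module

theorem stereoDD_zero_zero (q : ℍ[ℝ]) : stereoDD q 0 0 = 0 := by
  simp [stereoDD]

theorem duNorm_symm_rpow (hc₀ : 0 < c₀) (hc₁ : 0 < c₁) (p : NegSpinorBundle) (y : Model) :
    duNorm (bsMetric c₀ c₁) roundMetric proj ((extChartAt 𝓘(ℝ, Model) p).symm y) ^ (4 - 2 : ℝ) =
      4 / coordW2 c₀ c₁ y := by
  rw [duNorm_eq hc₀ hc₁, bsW_eq_sqrt hc₀ hc₁, show (4 - 2 : ℝ) = (2 : ℕ) by norm_num,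
    Real.rpow_natCast, div_pow, Real.sq_sqrt (coordW2_pos hc₀ hc₁ y).le]
  norm_num

/-- In the adapted basis the 4-tension becomes |du|²/A times `Q` of the left side of `sum_stereoDD`,
which is normal to the sphere at u(p). -/
theorem pTension_bsMetric_proj (hc₀ : 0 < c₀) (hc₁ : 0 < c₁) (p : NegSpinorBundle) :
    pTension 4 (bsMetric c₀ c₁) roundMetric proj p = 0 := by
  obtain ⟨Q, hQ, hU⟩ := exists_writtenInExtChartAt_proj p
  unfold pTension
  simp only [duNorm_symm_rpow hc₀ hc₁, hU]
  set y := extChartAt 𝓘(ℝ, Model) p p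
  set U : Model → EuclideanSpace ℝ (Fin 4) := fun z => chartFactor y.1 z • Q (stereoInv z.1)
    with hUdef
  have hl := chartFactor_contDiffAt y
  have hS : ContDiffAt ℝ 2 (fun z : Model => Q (stereoInv z.1)) y :=
    ((comp_stereoInv_contDiff Q).of_le (WithTop.coe_le_coe.2 le_top)).contDiffAt
  have hU2 : ContDiffAt ℝ 2 U y := hl.smul hS
  have hU1 : ∀ v, fderiv ℝ U y v = Q (stereoD y.1 v.1) := fun v => by
    rw [hUdef, fderiv_fun_smul (hl.differentiableAt (by simp)) (hS.differentiableAt (by simp)),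
      fderiv_chartFactor, chartFactor_self, hQ]
    simp [fderiv_comp_stereoInv]
  have hU3 : ∀ v w, fderiv ℝ (fderiv ℝ U) y v w = Q (stereoDD y.1 v.1 w.1) := fun v w => by
    rw [hUdef, fderiv_fderiv_smul_of_critical hl hS (chartFactor_self y) (fderiv_chartFactor y) hQ,
      fderiv_fderiv_comp_stereoInv]
  set m : Model → ℝ := fun z => 4 / coordW2 c₀ c₁ z
  have hm : DifferentiableAt ℝ m y := (contDiff_four_div_coordW2 hc₀ hc₁).differentiable (by simp) y
  have hT : ∀ v w, fderiv ℝ (fun z => m z • fderiv ℝ U z) y v w =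
      m y • Q (stereoDD y.1 v.1 w.1) + fderiv ℝ m y v • Q (stereoD y.1 w.1) := fun v w => by
    rw [fderiv_fun_smul hm
      ((hU2.fderiv_right (m := 1) (by norm_num)).differentiableAt (by simp))]
    simp [hU1, hU3]
  -- The target chart is centred at u(p), so its Christoffel term is evaluated at the origin.
  simp only [hQ, smul_zero, christoffel_roundMetric, add_zero]
  have hd : ∀ v w, DifferentiableAt ℝ (fun t => coordBilin (bsMetric c₀ c₁) p t v w) y :=
    fun v w => by
      have hd : ContDiff ℝ ∞ fun t => coordBilin (bsMetric c₀ c₁) p t v w := by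
        simp only [coordBilin_bsMetric hc₀ hc₁]
        exact ((coordA_contDiff hc₀ hc₁).mul contDiff_const).add ((coordB_contDiff hc₀ hc₁).mul
          ((covD_contDiff v).inner ℝ (covD_contDiff w)))
      exact hd.differentiable (by simp) y
  have h := metricTrace_sub_christoffel (coordBilin (bsMetric c₀ c₁) p) y
    (coordBilinLin (bsMetric c₀ c₁) p y) (fun _ _ => rfl)
    (coordBilinDeriv (bsMetric c₀ c₁) p y hd) (fun _ _ _ => rfl) (bsBasis hc₀ hc₁ y)
    (fun i j => (coordBilin_eq_qdot hc₀ hc₁ p y _ _).trans (qdot_bsBasis hc₀ hc₁ y i j))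
    (fderiv ℝ (fun z => m z • fderiv ℝ U z) y) (m y • fderiv ℝ U y)
  refine h.trans ?_
  have hC : ∀ i, ∑ k, (coordBilinDeriv (bsMetric c₀ c₁) p y hd (bsBasis hc₀ hc₁ y k)
        (bsBasis hc₀ hc₁ y k) (bsBasis hc₀ hc₁ y (Fin.natAdd 4 i)) -
      (1 / 2) * coordBilinDeriv (bsMetric c₀ c₁) p y hd (bsBasis hc₀ hc₁ y (Fin.natAdd 4 i))
        (bsBasis hc₀ hc₁ y k) (bsBasis hc₀ hc₁ y k)) =
      4 * (1 + ‖y.1‖ ^ 2)⁻¹ * ((√(coordA c₀ c₁ y))⁻¹ * ⟪y.1, qbasis i⟫) := fun i =>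
    sum_christoffelTrace hc₀ hc₁ y i p
  rw [Fin.sum_univ_add (a := 4) (b := 4), Fin.sum_univ_add (a := 4) (b := 4)]
  simp only [hC]
  -- Vertical directions drop out because the map depends on q alone; in horizontal directions the
  -- derivative of |du|² vanishes.
  simp only [hT, smul_apply, hU1, bsBasis_left_fst, bsBasis_right_fst, stereoDD_zero_zero,
    stereoDD_smul_smul, map_zero, map_smul, smul_zero, add_zero, Finset.sum_const_zero, zero_add,
    m, fderiv_four_div_coordW2_of_covD_eq_zero hc₀ hc₁ (covD_bsBasis_right hc₀ hc₁ y _), zero_smul]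
  have hq := sum_inner_smul_qbasis y.1 (stereoD y.1).toLinearMap
  have h0 := congrArg Q (sum_stereoDD y.1)
  rw [map_neg, map_smul, hQ, smul_zero, neg_zero, map_sub, map_smul, map_sum] at h0
  have h1 := congrArg Q hq
  rw [map_sum] at h1
  simp only [map_smul] at h1
  change ∑ i, ⟪y.1, qbasis i⟫ • Q (stereoD y.1 (qbasis i)) = Q (stereoD y.1 y.1) at h1
  rw [← h1, Finset.smul_sum, ← Finset.sum_sub_distrib] at h0
  rw [← Finset.sum_sub_distrib]
  have h2 := congrArg (fun z => (4 / coordW2 c₀ c₁ y * (√(coordA c₀ c₁ y))⁻¹ ^ 2) • z) h0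
  simp only [smul_zero, Finset.smul_sum] at h2
  rw [← h2]
  refine Finset.sum_congr rfl fun i _ => ?_
  module

theorem isPHarmonic_proj (hc₀ : 0 < c₀) (hc₁ : 0 < c₁) :
    IsPHarmonic 4 (bsMetric c₀ c₁) roundMetric proj :=
  ⟨proj_contMDiff, pTension_bsMetric_proj hc₀ hc₁⟩

end NegSpinorBundle

end Smith

end

theorem mainTheorem12 (c₀ c₁ : ℝ) (hc₀ : 0 < c₀) (hc₁ : 0 < c₁) :
    Smith.IsSpin7Structure (Smith.NegSpinorBundle.bsMetric c₀ c₁)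
      (Smith.NegSpinorBundle.bsVol c₀ c₁) (Smith.NegSpinorBundle.bsForm c₀ c₁) ∧
    Smith.IsClosedForm (Smith.NegSpinorBundle.bsForm c₀ c₁) ∧
    Smith.IsSmithSubmersion (Smith.NegSpinorBundle.bsMetric c₀ c₁)
      (Smith.NegSpinorBundle.bsVol c₀ c₁) Smith.roundMetric Smith.sphereVol
      (Smith.NegSpinorBundle.bsForm c₀ c₁) Smith.NegSpinorBundle.proj ∧
    Smith.IsHorizontallyConformalSubmersion (Smith.NegSpinorBundle.bsMetric c₀ c₁)
      Smith.roundMetric Smith.NegSpinorBundle.proj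
      (fun p => 1 / Smith.NegSpinorBundle.bsW c₀ c₁ p) ∧
    (∀ p, Smith.duNorm (Smith.NegSpinorBundle.bsMetric c₀ c₁) Smith.roundMetric
      Smith.NegSpinorBundle.proj p / √4 = 1 / Smith.NegSpinorBundle.bsW c₀ c₁ p) ∧
    Smith.IsPHarmonic 4 (Smith.NegSpinorBundle.bsMetric c₀ c₁) Smith.roundMetric
      Smith.NegSpinorBundle.proj ∧
    Smith.HasCalibratedFibres (Smith.NegSpinorBundle.bsMetric c₀ c₁)
      (Smith.NegSpinorBundle.bsVol c₀ c₁) Smith.sphereVol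
      (Smith.NegSpinorBundle.bsForm c₀ c₁) Smith.NegSpinorBundle.proj := by
  have h2 : Smith.IsSmithSubmersion (Smith.NegSpinorBundle.bsMetric c₀ c₁)
      (Smith.NegSpinorBundle.bsVol c₀ c₁) Smith.roundMetric Smith.sphereVol
      (Smith.NegSpinorBundle.bsForm c₀ c₁) Smith.NegSpinorBundle.proj :=
    { metric_dom := Smith.NegSpinorBundle.isRiemannianMetric_bsMetric hc₀ hc₁
      vol_dom := Smith.NegSpinorBundle.isVolumeForm_bsVol hc₀ hc₁
      metric_cod := Smith.isRiemannianMetric_roundMetric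
      vol_cod := Smith.isVolumeForm_sphereVol
      calibration := Smith.NegSpinorBundle.isCalibration_bsForm hc₀ hc₁
      smooth := Smith.NegSpinorBundle.proj_contMDiff
      surjective := Smith.NegSpinorBundle.proj_surjective
      smith := fun x => by
        have h := Smith.NegSpinorBundle.duNorm_div hc₀ hc₁ x
        push_cast
        rw [h]
        exact Smith.NegSpinorBundle.wedge_bsForm_pullbackForm hc₀ hc₁ x
      conformal := fun x => by
        have h := Smith.NegSpinorBundle.duNorm_div hc₀ hc₁ x
        push_cast
        rw [h]
        exact Smith.NegSpinorBundle.conformalOnHorizontal hc₀ hc₁ x }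
  exact ⟨Smith.NegSpinorBundle.isSpin7Structure hc₀ hc₁,
    Smith.NegSpinorBundle.isClosedForm_bsForm hc₀ hc₁, h2,
    Smith.NegSpinorBundle.isHorizontallyConformalSubmersion hc₀ hc₁,
    Smith.NegSpinorBundle.duNorm_div hc₀ hc₁, Smith.NegSpinorBundle.isPHarmonic_proj hc₀ hc₁,
    Smith.NegSpinorBundle.hasCalibratedFibres hc₀ hc₁⟩
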